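/- Let $I$ be a finite set, $n=|I|$, and $k$ a field. Let $\mathcal P=(\widetilde{\mathcal M},g,f)$ be an oriented matroid program: an oriented matroid $\widetilde{\mathcal M}$ on $I\sqcup\{g,f\}$ such that $g$ is not a loop and $f$ is not a coloop. Put $\mathcal N=\widetilde{\mathcal M}\setminus f$, $\mathcal M=\mathcal N/g$, and let $d$ be the rank of $\mathcal M$. Assume that $\mathcal P$ is generic: every signed cocircuit $Y$ of $\mathcal N$ with more than $d$ zeros has $Y(g)=0$, and every signed circuit $X$ of $\widetilde{\mathcal M}/g$ with more than $n-d$ zeros has $X(f)=0$. Let $\mathcal P^\vee=(\widetilde{\mathcal M}^\vee,f,g)$ be the dual program. A feasible covector is a covector $Y$ of $\mathcal N$ with $Y(g)=+$. Let $\mathcal F\subset\{+,-\}^I$ be the set of $\alpha$ such that $\alpha$, extended by $+$ at $g$, is a tope $T_\alpha$ of $\mathcal N$. A sign vector $\alpha\in\{+,-\}^I$ is bounded if there is no covector $Z$ of $\widetilde{\mathcal M}$ with $Z(g)=0$, $Z(f)=+$ and $Z|_I$ a face of $\alpha$. Let $\mathcal P_{bf}$ be the set of bounded feasible sign vectors of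 $\mathcal P$; it is also the set of bounded feasible sign vectors of $\mathcal P^\vee$. The algebra $\widetilde A(\mathcal P)$. Let $Q$ be the quiver with vertex set $\mathcal F$ and an arrow from $\alpha$ to $\beta$ whenever they differ in exactly one component; let $e_\alpha$ and $p(\alpha,\beta)$ be the trivial paths and the arrows in the path algebra $P(Q)$. Then $\widetilde A(\mathcal P)$ is the quotient of $P(Q)\otimes_k k[u_i\mid i\in I]$ by the relations: $e_\alpha=0$ for $\alpha\in\mathcal F$ not bounded; $p(\alpha,\gamma)p(\gamma,\beta)=p(\alpha,\delta)p(\delta,\beta)$ for four distinct $\alpha,\beta,\gamma,\delta\in\mathcal F$ with $\alpha$ and $\beta$ each adjacent to $\gamma$ and $\delta$; and $p(\alpha,\beta)p(\beta,\alpha)=u_ie_\alpha$ whenever $\alpha,\beta\in\mathcal F$ differ exactly in the component $i$. It is graded by $\deg e_\alpha=0$, $\deg p(\alpha,\beta)=1$, $\deg u_i=2$. For a subspace $U\subset k^I$, let $U^\perp\subset (k^I)^*$ be its annihilator and $A(\mathcal P,U)=\widetilde A(\mathcal P)\otimes_{\mathrm{Sym}((k^I)^*)}\mathrm{Sym}((k^I)^*/U^\perp)$.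 For the dual program, the variables are called $t_i$ instead of $u_i$, so that $\widetilde A(\mathcal P^\vee)$ is an algebra over $\mathrm{Sym}(k^I)=k[t_i\mid i\in I]$, and $A(\mathcal P^\vee,U^\perp)=\widetilde A(\mathcal P^\vee)\otimes_{\mathrm{Sym}(k^I)}\mathrm{Sym}(k^I/U)$. The algebra $\widetilde B(\mathcal P)$. For $\alpha_1,\dots,\alpha_r\in\mathcal P_{bf}$ let $\Delta_{\alpha_1\cdots\alpha_r}$ be the simplicial complex of those $S\subset I$ for which some feasible covector $Y$ that is a face of all the $T_{\alpha_j}$ vanishes on $S$, and let $\widetilde R_{\alpha_1\cdots\alpha_r}=k[t_i\mid i\in I]/(\prod_{i\in S}t_i\mid S\notin\Delta_{\alpha_1\cdots\alpha_r})$ be its face ring. Let $d_{\alpha\beta}$ be the number of components in which $\alpha,\beta$ differ, and $S^\beta_{\alpha\gamma}=\{i\mid\alpha(i)=\gamma(i)\ne\beta(i)\}$. Then $\widetilde B(\mathcal P)=\bigoplus_{\alpha,\beta\in\mathcal P_{bf}}\widetilde R_{\alpha\beta}\langle-d_{\alpha\beta}\rangle$, where $\deg t_i=2$ and the unit $1_{\alpha\beta}$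 of $\widetilde R_{\alpha\beta}$ is put in degree $d_{\alpha\beta}$. The product of $x\in\widetilde R_{\alpha\beta}$ and $y\in\widetilde R_{\beta\gamma}$ is obtained by multiplying their images in $\widetilde R_{\alpha\beta\gamma}$ and applying the map $\widetilde R_{\alpha\beta\gamma}\to\widetilde R_{\alpha\gamma}$ induced by multiplication by $\prod_{i\in S^\beta_{\alpha\gamma}}t_i$; all other products of components are zero. It is an algebra over $k[t_i\mid i\in I]=\mathrm{Sym}(k^I)$ through the diagonal components. Put $B(\mathcal P,U)=\widetilde B(\mathcal P)\otimes_{\mathrm{Sym}(k^I)}\mathrm{Sym}(k^I)/(U)$. Theorem. There is an isomorphism of graded $\mathrm{Sym}(k^I)$-algebras $\varphi:\widetilde A(\mathcal P^\vee)\to\widetilde B(\mathcal P)$ with $\varphi(e_\alpha)=1_{\alpha\alpha}$ for all $\alpha\in\mathcal P_{bf}$ and $\varphi(p(\alpha,\beta))=1_{\alpha\beta}$ for all adjacent $\alpha,\beta\in\mathcal P_{bf}$. If $U\subset k^I$ is a parameter space for the underlying matroid of $\mathcal M$, that is, if the coordinate projection $U\to k^b$ is an isomorphism for each basis $b$ of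 it, then $\varphi$ induces an isomorphism of graded rings (and of $\mathrm{Sym}(k^I)$-algebras) $A(\mathcal P^\vee,U^\perp)\cong B(\mathcal P,U)$. -/

import Mathlib

open scoped Classical TensorProduct

noncomputable section

/-! ## Sign vectors and oriented matroids -/

/-- Functions `E → {0,+,-}`. -/
abbrev SignVec (E : Type*) := E → SignType

namespace SignVec

variable {E : Type*}

/-- The zero set `z(X)`. -/
def zeroSet (X : SignVec E) : Set E := {e | X e = 0}

/-- The composition `X ∘ Y`. -/
def comp (X Y : SignVec E) : SignVec E := fun e => if X e ≠ 0 then X e else Y e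

/-- `X` is a face of `Y` when `X ∘ Y = Y`. -/
def IsFace (X Y : SignVec E) : Prop := comp X Y = Y

/-- Orthogonality of sign vectors: the products `X e * Y e` are either all zero or take both
signs. -/
def Orth (X Y : SignVec E) : Prop := (∃ e, X e * Y e = 1) ↔ (∃ e, X e * Y e = -1)

theorem isFace_iff {X Y : SignVec E} : IsFace X Y ↔ ∀ e, X e ≠ 0 → X e = Y e := by
  unfold IsFace comp
  rw [funext_iff]
  refine forall_congr' fun e => ?_
  by_cases h : X e = 0 <;> simp [h]

end SignVec

namespace OM

open SignVec

section OrientedMatroid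

variable {E J : Type*}

/-- The signed circuit axioms: `C` is the set of signed circuits of an oriented matroid on `E`. -/
structure IsOrientedMatroid (C : Set (SignVec E)) : Prop where
  zero_notMem : (0 : SignVec E) ∉ C
  neg_mem : ∀ X ∈ C, -X ∈ C
  eq_or_eq_neg : ∀ X ∈ C, ∀ Y ∈ C, Function.support X ⊆ Function.support Y → X = Y ∨ X = -Y
  elimination : ∀ X ∈ C, ∀ Y ∈ C, X ≠ -Y → ∀ e, X e = 1 → Y e = -1 →
    ∃ Z ∈ C, Z e = 0 ∧ (∀ i, Z i = 1 → X i = 1 ∨ Y i = 1) ∧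
      (∀ i, Z i = -1 → X i = -1 ∨ Y i = -1)

/-- The signed cocircuits of the oriented matroid with signed circuits `C`: the nonzero sign vectors
of minimal support among those orthogonal to every signed circuit. They are the signed circuits of
the dual oriented matroid. -/
def cocircuits (C : Set (SignVec E)) : Set (SignVec E) :=
  {Y | Y ≠ 0 ∧ (∀ X ∈ C, Orth X Y) ∧
    ∀ Y' : SignVec E, Y' ≠ 0 → (∀ X ∈ C, Orth X Y') →
      Function.support Y' ⊆ Function.support Y → Function.support Y' = Function.support Y}

/-- Covectors: the zero vector and all compositions of signed cocircuits. -/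
inductive IsCovector (C : Set (SignVec E)) : SignVec E → Prop
  | zero : IsCovector C 0
  | comp {Y Z : SignVec E} : Y ∈ cocircuits C → IsCovector C Z → IsCovector C (SignVec.comp Y Z)

/-- Topes: maximal covectors for the face order. -/
def IsTope (C : Set (SignVec E)) (T : SignVec E) : Prop :=
  IsCovector C T ∧ ∀ X, IsCovector C X → IsFace T X → X = T

/-- Signed circuits of the deletion of the complement of the range of the injection `φ : J → E`. -/
def deletion (φ : J → E) (C : Set (SignVec E)) : Set (SignVec J) :=
  {X' | ∃ X ∈ C, (∀ e, X e ≠ 0 → e ∈ Set.range φ) ∧ X' = X ∘ φ}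

/-- Signed circuits of the contraction of the complement of the range of the injection
`φ : J → E`. -/
def contraction (φ : J → E) (C : Set (SignVec E)) : Set (SignVec J) :=
  {X' | ∃ X ∈ C, X' = X ∘ φ ∧ X' ≠ 0 ∧
    ∀ W ∈ C, W ∘ φ ≠ 0 → Function.support (W ∘ φ) ⊆ Function.support X' →
      Function.support (W ∘ φ) = Function.support X'}

/-- Independent sets of the underlying matroid. -/
def IsIndep (C : Set (SignVec E)) (S : Set E) : Prop := ∀ X ∈ C, ¬ Function.support X ⊆ S

/-- Bases of the underlying matroid. -/
def IsBasis (C : Set (SignVec E)) (b : Set E) : Prop := Maximal (IsIndep C) b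

/-- The rank of the underlying matroid (for a finite ground set). -/
def rank (C : Set (SignVec E)) : ℕ := sSup {m | ∃ S, IsIndep C S ∧ S.ncard = m}

/-- `e` is a loop. -/
def IsLoop (C : Set (SignVec E)) (e : E) : Prop := ∃ X ∈ C, Function.support X = {e}

/-- `e` is a coloop. -/
def IsColoop (C : Set (SignVec E)) (e : E) : Prop := ∀ X ∈ C, X e = 0

end OrientedMatroid

/-! ## Oriented matroid programs -/

/-- The ground set `I ⊔ {g, f}`. -/
inductive Ext (I : Type*)
  | elt : I → Ext I
  | g : Ext I
  | f : Ext I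

namespace Ext

variable {I : Type*}

/-- The inclusion `I ⊔ {g} → I ⊔ {g, f}`; `none` stands for `g`. -/
def inclG : Option I → Ext I
  | none => g
  | some i => elt i

/-- The inclusion `I ⊔ {f} → I ⊔ {g, f}`; `none` stands for `f`. -/
def inclF : Option I → Ext I
  | none => f
  | some i => elt i

/-- The exchange of `g` and `f`. -/
def swap : Ext I → Ext I
  | elt i => elt i
  | g => f
  | f => g

end Ext

section Program

variable {I : Type*}

/-- The affine oriented matroid: the deletion of `f`, on `I ⊔ {g}`. -/
def affine (C : Set (SignVec (Ext I))) : Set (SignVec (Option I)) := deletion Ext.inclG C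

/-- The contraction of `g`, on `I ⊔ {f}`. -/
def contractG (C : Set (SignVec (Ext I))) : Set (SignVec (Option I)) := contraction Ext.inclF C

/-- The oriented matroid on `I` obtained by deleting `f` and contracting `g`. -/
def core (C : Set (SignVec (Ext I))) : Set (SignVec I) := contraction some (affine C)

/-- The set `C` of signed circuits on `I ⊔ {g, f}` defines an oriented matroid program
`(C, g, f)`. -/
structure IsProgram (C : Set (SignVec (Ext I))) : Prop where
  isOrientedMatroid : IsOrientedMatroid C
  g_not_loop : ¬ IsLoop C Ext.g
  f_not_coloop : ¬ IsColoop C Ext.f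

/-- Generic oriented matroid programs. -/
structure IsGeneric [Fintype I] (C : Set (SignVec (Ext I))) : Prop where
  cocircuit_g : ∀ Y ∈ cocircuits (affine C), rank (core C) < (zeroSet Y).ncard → Y none = 0
  circuit_f : ∀ X ∈ contractG C,
    Fintype.card I < (zeroSet X).ncard + rank (core C) → X none = 0

/-- The dual program `(C^∨, f, g)`: the dual oriented matroid, with the roles of `g` and `f`
exchanged. -/
def dualProgram (C : Set (SignVec (Ext I))) : Set (SignVec (Ext I)) :=
  {X | X ∘ Ext.swap ∈ cocircuits C}

/-- The sign vector on `I ⊔ {g}` extending `α` by `+` at `g`. -/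
def withG (α : SignVec I) : SignVec (Option I)
  | none => 1
  | some i => α i

/-- Affine space: the feasible covectors. -/
def affineSpace (C : Set (SignVec (Ext I))) : Set (SignVec (Option I)) :=
  {Y | IsCovector (affine C) Y ∧ Y none = 1}

/-- Feasible sign vectors `α ∈ {+,-}^I`, identified with the feasible topes. -/
def feasible (C : Set (SignVec (Ext I))) : Set (SignVec I) :=
  {α | (∀ i, α i ≠ 0) ∧ IsTope (affine C) (withG α)}

/-- Bounded sign vectors `α ∈ {+,-}^I`: there is no direction (a covector vanishing at `g`) which is
increasing (positive at `f`) and whose restriction to `I` is a face of `α`. -/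
def bounded (C : Set (SignVec (Ext I))) : Set (SignVec I) :=
  {α | (∀ i, α i ≠ 0) ∧
    ¬ ∃ Z, IsCovector C Z ∧ Z Ext.g = 0 ∧ Z Ext.f = 1 ∧ IsFace (Z ∘ Ext.elt) α}

/-- Bounded feasible sign vectors. -/
def boundedFeasible (C : Set (SignVec (Ext I))) : Set (SignVec I) := feasible C ∩ bounded C

/-- `α` and `β` differ exactly in the `i`-th component. -/
def DiffersAt (i : I) (α β : SignVec I) : Prop := ∀ j, α j ≠ β j ↔ j = i

/-- `α` and `β` differ in exactly one component. -/
def Adjacent (α β : SignVec I) : Prop := ∃ i, DiffersAt i α β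

end Program

/-! ## Parameter spaces -/

section Parameter

variable {I : Type*} [Fintype I] (k : Type*) [Field k]

variable {k} in
/-- `U ⊆ k^I` is a parameter space for the underlying matroid of the oriented matroid with signed
circuits `D`: the projection of `U` to `k^b` is an isomorphism for every basis `b`. -/
def IsParameterSpace (D : Set (SignVec I)) (U : Submodule k (I → k)) : Prop :=
  ∀ b : Set I, IsBasis D b →
    Function.Bijective (fun (u : U) (i : b) => (u : I → k) i)

variable {k} in
/-- The orthogonal complement of `U` in `(k^I)^* = k^I`. -/
def orthCompl (U : Submodule k (I → k)) : Submodule k (I → k) where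
  carrier := {x | ∀ u ∈ U, ∑ i, x i * u i = 0}
  zero_mem' := by simp
  add_mem' := by
    intro x y hx hy u hu
    simp [add_mul, Finset.sum_add_distrib, hx u hu, hy u hu]
  smul_mem' := by
    intro c x hx u hu
    simp [mul_assoc, ← Finset.mul_sum, hx u hu]

variable {k} in
/-- The ideal of the polynomial ring generated by the linear forms `∑ x_i t_i` with `x ∈ W`. -/
def linearIdeal (W : Submodule k (I → k)) : Ideal (MvPolynomial I k) :=
  Ideal.span {p | ∃ x ∈ W, p = ∑ i, MvPolynomial.C (x i) * MvPolynomial.X i}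

end Parameter

/-! ## Path algebras -/

section PathAlgebra

variable (k : Type*) [Field k] {V : Type*} [Fintype V] (adj : V → V → Prop)

/-- Generators of the path algebra: trivial paths and arrows. -/
inductive PathGen
  | idem : V → PathGen
  | arrow : (a b : V) → adj a b → PathGen

/-- Defining relations of the path algebra of the quiver with finite vertex set `V` and one arrow
from `a` to `b` whenever `adj a b`. Paths are composed from left to right. -/
inductive PathRel : FreeAlgebra k (PathGen adj) → FreeAlgebra k (PathGen adj) → Prop
  | idem_mul_self (a : V) :
      PathRel (FreeAlgebra.ι k (.idem a) * FreeAlgebra.ι k (.idem a)) (FreeAlgebra.ι k (.idem a))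
  | idem_mul_of_ne (a b : V) : a ≠ b →
      PathRel (FreeAlgebra.ι k (.idem a) * FreeAlgebra.ι k (.idem b)) 0
  | idem_mul_arrow (a b : V) (h : adj a b) :
      PathRel (FreeAlgebra.ι k (.idem a) * FreeAlgebra.ι k (.arrow a b h))
        (FreeAlgebra.ι k (.arrow a b h))
  | arrow_mul_idem (a b : V) (h : adj a b) :
      PathRel (FreeAlgebra.ι k (.arrow a b h) * FreeAlgebra.ι k (.idem b))
        (FreeAlgebra.ι k (.arrow a b h))
  | sum_idem : PathRel (∑ a : V, FreeAlgebra.ι k (.idem a)) 1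

/-- The path algebra over `k`. -/
abbrev PathAlgebra := RingQuot (PathRel k adj)

variable {adj}

/-- The trivial path at `a`. -/
def pathIdem (adj : V → V → Prop) (a : V) : PathAlgebra k adj :=
  RingQuot.mkAlgHom k (PathRel k adj) (FreeAlgebra.ι k (.idem a))

/-- The path of length one from `a` to `b`. -/
def pathArrow (a b : V) (h : adj a b) : PathAlgebra k adj :=
  RingQuot.mkAlgHom k (PathRel k adj) (FreeAlgebra.ι k (.arrow a b h))

/-- `IsPathOfLength l a b x`: the element `x` is a path of length `l` from `a` to `b`. -/
inductive IsPathOfLength : ℕ → V → V → PathAlgebra k adj → Prop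
  | nil (a : V) : IsPathOfLength 0 a a (pathIdem k adj a)
  | snoc {l : ℕ} {a b c : V} {x : PathAlgebra k adj} (h : adj b c) :
      IsPathOfLength l a b x → IsPathOfLength (l + 1) a c (x * pathArrow k b c h)

end PathAlgebra

/-! ## The algebras `Ã` and `A` -/

section AlgebraA

variable {I : Type*} [Fintype I] (k : Type*) [Field k] (C : Set (SignVec (Ext I)))

instance instFintypeFeasible : Fintype (feasible C) := Fintype.ofFinite _

instance instFintypeBoundedFeasible : Fintype (boundedFeasible C) := Fintype.ofFinite _

/-- Adjacency in the quiver `Q`, whose vertices are the feasible sign vectors. -/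
def quiverAdj (a b : feasible C) : Prop := Adjacent (a : SignVec I) b

/-- The algebra `P(Q) ⊗ Sym`, written with the polynomial ring on the left. -/
abbrev PolyPath := MvPolynomial I k ⊗[k] PathAlgebra k (quiverAdj C)

/-- The defining relations of `Ã`. -/
inductive ARel : PolyPath k C → PolyPath k C → Prop
  | unbounded (a : feasible C) : (a : SignVec I) ∉ boundedFeasible C →
      ARel (1 ⊗ₜ pathIdem k (quiverAdj C) a) 0
  | square (a b c d : feasible C) : a ≠ b → a ≠ c → a ≠ d → b ≠ c → b ≠ d → c ≠ d →
      ∀ (hac : quiverAdj C a c) (hcb : quiverAdj C c b)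
        (had : quiverAdj C a d) (hdb : quiverAdj C d b),
      ARel (1 ⊗ₜ (pathArrow k a c hac * pathArrow k c b hcb))
        (1 ⊗ₜ (pathArrow k a d had * pathArrow k d b hdb))
  | loop (a b : feasible C) (i : I) : DiffersAt i (a : SignVec I) b →
      ∀ (hab : quiverAdj C a b) (hba : quiverAdj C b a),
      ARel (1 ⊗ₜ (pathArrow k a b hab * pathArrow k b a hba))
        (MvPolynomial.X i ⊗ₜ pathIdem k (quiverAdj C) a)

/-- The algebra `Ã` of a program, an algebra over the polynomial ring. -/
abbrev ATilde := RingQuot (ARel k C)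

/-- The quotient map from `Sym ⊗ P(Q)` to `Ã`. -/
def ATilde.mk : PolyPath k C →ₐ[MvPolynomial I k] ATilde k C :=
  RingQuot.mkAlgHom (MvPolynomial I k) (ARel k C)

/-- The idempotent `e_α` in `Ã`. -/
def ATilde.e (a : feasible C) : ATilde k C :=
  ATilde.mk k C (1 ⊗ₜ pathIdem k (quiverAdj C) a)

/-- The element `p(α,β)` in `Ã`. -/
def ATilde.p (a b : feasible C) (h : quiverAdj C a b) : ATilde k C :=
  ATilde.mk k C (1 ⊗ₜ pathArrow k a b h)

/-- The graded pieces of `Ã`: paths are graded by length and the variables have degree two. -/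
def ATilde.grade (m : ℕ) : Submodule k (ATilde k C) :=
  Submodule.span k {z | ∃ (c : I →₀ ℕ) (l : ℕ) (a b : feasible C)
    (x : PathAlgebra k (quiverAdj C)),
    IsPathOfLength k l a b x ∧ 2 * c.degree + l = m ∧
      z = ATilde.mk k C (MvPolynomial.monomial c 1 ⊗ₜ x)}

variable {k}

/-- The algebra `A = Sym(k^I / U^⊥) ⊗_Sym Ã`. -/
def AAlg (U : Submodule k (I → k)) :=
  (MvPolynomial I k ⧸ linearIdeal (orthCompl U)) ⊗[MvPolynomial I k] ATilde k C

instance (U : Submodule k (I → k)) : Ring (AAlg C U) :=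
  inferInstanceAs (Ring ((MvPolynomial I k ⧸ linearIdeal (orthCompl U)) ⊗[MvPolynomial I k] ATilde k C))

instance (U : Submodule k (I → k)) : Algebra (MvPolynomial I k) (AAlg C U) :=
  inferInstanceAs (Algebra (MvPolynomial I k)
    ((MvPolynomial I k ⧸ linearIdeal (orthCompl U)) ⊗[MvPolynomial I k] ATilde k C))

instance (U : Submodule k (I → k)) : Algebra k (AAlg C U) :=
  inferInstanceAs (Algebra k ((MvPolynomial I k ⧸ linearIdeal (orthCompl U)) ⊗[MvPolynomial I k] ATilde k C))

/-- The canonical map from `Ã` to `A`. -/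
def AAlg.mk (U : Submodule k (I → k)) : ATilde k C →ₐ[MvPolynomial I k] AAlg C U :=
  (Algebra.TensorProduct.includeRight : ATilde k C →ₐ[MvPolynomial I k]
    (MvPolynomial I k ⧸ linearIdeal (orthCompl U)) ⊗[MvPolynomial I k] ATilde k C)

/-- The graded pieces of `A`: the images of those of `Ã`. -/
def AAlg.grade (U : Submodule k (I → k)) (m : ℕ) : Submodule k (AAlg C U) :=
  Submodule.span k (AAlg.mk C U '' (ATilde.grade k C m : Set (ATilde k C)))

end AlgebraA

/-! ## Face rings and the algebras `B̃` and `B` -/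

section AlgebraB

variable {I : Type*} (k : Type*) [Field k] (C : Set (SignVec (Ext I)))

/-- The monomial `t_S`. -/
def tMonomial (S : Finset I) : MvPolynomial I k := ∏ i ∈ S, MvPolynomial.X i

/-- The feasible covectors that are faces of every sign vector in `A`. -/
def commonFaces (A : Set (SignVec I)) : Set (SignVec (Option I)) :=
  {Y | Y ∈ affineSpace C ∧ ∀ α ∈ A, IsFace Y (withG α)}

/-- The simplicial complex of the subsets of `I` on which some feasible common face vanishes. -/
def zeroComplex (A : Set (SignVec I)) : Set (Finset I) :=
  {S | ∃ Y ∈ commonFaces C A, ∀ i ∈ S, Y (some i) = 0}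

/-- The ideal of nonfaces. -/
def nonfaceIdeal (A : Set (SignVec I)) : Ideal (MvPolynomial I k) :=
  Ideal.span {p | ∃ S, S ∉ zeroComplex C A ∧ p = tMonomial k S}

/-- The face ring of `zeroComplex C A`. -/
abbrev FaceRing (A : Set (SignVec I)) := MvPolynomial I k ⧸ nonfaceIdeal k C A

theorem nonfaceIdeal_mono {A A' : Set (SignVec I)} (h : A ⊆ A') :
    nonfaceIdeal k C A ≤ nonfaceIdeal k C A' := by
  refine Ideal.span_mono ?_
  rintro p ⟨S, hS, rfl⟩
  exact ⟨S, fun ⟨Y, hY, hz⟩ => hS ⟨Y, ⟨hY.1, fun α hα => hY.2 α (h hα)⟩, hz⟩, rfl⟩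

/-- The quotient map between face rings given by enlarging the set of sign vectors. -/
def FaceRing.res {A A' : Set (SignVec I)} (h : A ⊆ A') :
    FaceRing k C A →ₐ[MvPolynomial I k] FaceRing k C A' :=
  Ideal.Quotient.factorₐ (MvPolynomial I k) (nonfaceIdeal_mono k C h)

variable [Fintype I]

/-- The set of the components `i` with `α i = γ i ≠ β i`. -/
def detour (α β γ : SignVec I) : Finset I :=
  Finset.univ.filter fun i => α i = γ i ∧ γ i ≠ β i

/-- The number of components in which `α` and `β` differ. -/
def dist (α β : SignVec I) : ℕ := (Finset.univ.filter fun i => α i ≠ β i).card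

theorem nonfaceIdeal_le_comap (α β γ : SignVec I) :
    nonfaceIdeal k C {α, β, γ} ≤
      Submodule.comap
        (LinearMap.mulLeft (MvPolynomial I k) (tMonomial k (detour α β γ)))
        (nonfaceIdeal k C {α, γ}) := by
  refine Submodule.span_le.2 ?_
  rintro p ⟨S, hS, rfl⟩
  change tMonomial k (detour α β γ) * tMonomial k S ∈ nonfaceIdeal k C {α, γ}
  have hU : detour α β γ ∪ S ∉ zeroComplex C {α, γ} := by
    rintro ⟨Y, hY, hz⟩
    refine hS ⟨Y, ⟨hY.1, ?_⟩, fun i hi => hz i (Finset.mem_union_right _ hi)⟩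
    have ha := isFace_iff.1 (hY.2 α (by simp))
    have hc := isFace_iff.1 (hY.2 γ (by simp))
    intro δ hδ
    simp only [Set.mem_insert_iff, Set.mem_singleton_iff] at hδ
    rcases hδ with rfl | rfl | rfl
    · exact hY.2 _ (by simp)
    · refine isFace_iff.2 fun e he => ?_
      cases e with
      | none => exact ha none he
      | some i =>
        have h1 : Y (some i) = α i := ha _ he
        have h2 : Y (some i) = γ i := hc _ he
        by_contra hne
        refine he (hz i (Finset.mem_union_left _ ?_))
        simp only [detour, Finset.mem_filter, Finset.mem_univ, true_and]
        exact ⟨h1.symm.trans h2, fun h => hne (h2.trans h)⟩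
    · exact hY.2 _ (by simp)
  have hdvd : tMonomial k (detour α β γ ∪ S) ∣ tMonomial k (detour α β γ) * tMonomial k S := by
    refine ⟨tMonomial k (detour α β γ ∩ S), ?_⟩
    exact (Finset.prod_union_inter).symm
  exact Ideal.mem_of_dvd _ hdvd (Ideal.subset_span ⟨_, hU, rfl⟩)

/-- The map between face rings induced by multiplication by the monomial of the detour set. -/
def FaceRing.push (α β γ : SignVec I) :
    FaceRing k C {α, β, γ} →ₗ[MvPolynomial I k] FaceRing k C {α, γ} :=
  Submodule.mapQ (nonfaceIdeal k C {α, β, γ}) (nonfaceIdeal k C {α, γ})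
    (LinearMap.mulLeft (MvPolynomial I k) (tMonomial k (detour α β γ)))
    (nonfaceIdeal_le_comap k C α β γ)

/-- The component `R̃_{αβ} ⊗ R̃_{βγ} → R̃_{αγ}` of the twisted multiplication. -/
def FaceRing.star (α β γ : SignVec I) (x : FaceRing k C {α, β}) (y : FaceRing k C {β, γ}) :
    FaceRing k C {α, γ} :=
  FaceRing.push k C α β γ
    (FaceRing.res k C (by intro; simp; tauto) x * FaceRing.res k C (by intro; simp; tauto) y)

/-- The underlying module of `B̃`: the direct sum of the face rings `R̃_{αβ}` over all pairs of
bounded feasible sign vectors. -/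
def BTilde := ∀ α β : boundedFeasible C, FaceRing k C {(α : SignVec I), (β : SignVec I)}

namespace BTilde

section Structure

/-- The additive group of `B̃`. -/
abbrev addCommGroupAux : AddCommGroup (BTilde k C) := inferInstanceAs (AddCommGroup
  (∀ α β : boundedFeasible C, FaceRing k C {(α : SignVec I), (β : SignVec I)}))

attribute [local instance] addCommGroupAux

/-- The componentwise action of the polynomial ring on `B̃`. -/
abbrev modulePolyAux : Module (MvPolynomial I k) (BTilde k C) :=
  inferInstanceAs (Module (MvPolynomial I k)
    (∀ α β : boundedFeasible C, FaceRing k C {(α : SignVec I), (β : SignVec I)}))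

/-- The componentwise action of the base field on `B̃`. -/
abbrev moduleAux : Module k (BTilde k C) := inferInstanceAs (Module k
  (∀ α β : boundedFeasible C, FaceRing k C {(α : SignVec I), (β : SignVec I)}))

/-- The twisted multiplication. -/
abbrev mulAux : Mul (BTilde k C) :=
  ⟨fun x y α γ => ∑ β : boundedFeasible C, FaceRing.star k C α β γ (x α β) (y β γ)⟩

/-- The unit: the sum of the units of the rings `R̃_{αα}`. -/
abbrev oneAux : One (BTilde k C) := ⟨fun α β => if α = β then 1 else 0⟩

attribute [local instance] modulePolyAux moduleAux mulAux oneAux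

variable {k C}

theorem mul_apply (x y : BTilde k C) (α γ : boundedFeasible C) :
    (x * y) α γ = ∑ β : boundedFeasible C, FaceRing.star k C α β γ (x α β) (y β γ) := rfl

theorem one_apply (α β : boundedFeasible C) : (1 : BTilde k C) α β = if α = β then 1 else 0 := rfl

theorem add_apply (x y : BTilde k C) (α β : boundedFeasible C) :
    (x + y) α β = x α β + y α β := rfl

theorem zero_apply (α β : boundedFeasible C) : (0 : BTilde k C) α β = 0 := rfl

theorem smul_apply (r : MvPolynomial I k) (x : BTilde k C) (α β : boundedFeasible C) :
    (r • x) α β = r • x α β := rfl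

theorem star_mk (α β γ : SignVec I) (p q : MvPolynomial I k) :
    FaceRing.star k C α β γ (Ideal.Quotient.mk _ p) (Ideal.Quotient.mk _ q) =
      Ideal.Quotient.mk _ (tMonomial k (detour α β γ) * (p * q)) := rfl

theorem star_add_left (α β γ : SignVec I) (x x' : FaceRing k C {α, β}) (y : FaceRing k C {β, γ}) :
    FaceRing.star k C α β γ (x + x') y =
      FaceRing.star k C α β γ x y + FaceRing.star k C α β γ x' y := by
  simp only [FaceRing.star, map_add, add_mul]

theorem star_add_right (α β γ : SignVec I) (x : FaceRing k C {α, β}) (y y' : FaceRing k C {β, γ}) :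
    FaceRing.star k C α β γ x (y + y') =
      FaceRing.star k C α β γ x y + FaceRing.star k C α β γ x y' := by
  simp only [FaceRing.star, map_add, mul_add]

theorem star_zero_left (α β γ : SignVec I) (y : FaceRing k C {β, γ}) :
    FaceRing.star k C α β γ 0 y = 0 := by
  simp only [FaceRing.star, map_zero, zero_mul]

theorem star_zero_right (α β γ : SignVec I) (x : FaceRing k C {α, β}) :
    FaceRing.star k C α β γ x 0 = 0 := by
  simp only [FaceRing.star, map_zero, mul_zero]

theorem star_smul_left (r : MvPolynomial I k) (α β γ : SignVec I) (x : FaceRing k C {α, β})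
    (y : FaceRing k C {β, γ}) :
    FaceRing.star k C α β γ (r • x) y = r • FaceRing.star k C α β γ x y := by
  simp only [FaceRing.star, map_smul, smul_mul_assoc]

theorem star_smul_right (r : MvPolynomial I k) (α β γ : SignVec I) (x : FaceRing k C {α, β})
    (y : FaceRing k C {β, γ}) :
    FaceRing.star k C α β γ x (r • y) = r • FaceRing.star k C α β γ x y := by
  simp only [FaceRing.star, map_smul, mul_smul_comm]

theorem star_sum_left {ι : Type*} (s : Finset ι) (α β γ : SignVec I)
    (x : ι → FaceRing k C {α, β}) (y : FaceRing k C {β, γ}) :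
    FaceRing.star k C α β γ (∑ i ∈ s, x i) y = ∑ i ∈ s, FaceRing.star k C α β γ (x i) y := by
  simp only [FaceRing.star, map_sum, Finset.sum_mul]

theorem star_sum_right {ι : Type*} (s : Finset ι) (α β γ : SignVec I)
    (x : FaceRing k C {α, β}) (y : ι → FaceRing k C {β, γ}) :
    FaceRing.star k C α β γ x (∑ i ∈ s, y i) = ∑ i ∈ s, FaceRing.star k C α β γ x (y i) := by
  simp only [FaceRing.star, map_sum, Finset.mul_sum]

theorem tMonomial_eq (S : Finset I) :
    tMonomial k S = ∏ i, (if i ∈ S then MvPolynomial.X i else 1) := by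
  simp [tMonomial, Finset.prod_ite_mem]

theorem detour_assoc (α β γ δ : SignVec I) (hα : ∀ i, α i ≠ 0) (hβ : ∀ i, β i ≠ 0)
    (hγ : ∀ i, γ i ≠ 0) (hδ : ∀ i, δ i ≠ 0) :
    tMonomial k (detour α γ δ) * tMonomial k (detour α β γ) =
      tMonomial k (detour α β δ) * tMonomial k (detour β γ δ) := by
  simp only [tMonomial_eq, ← Finset.prod_mul_distrib]
  refine Finset.prod_congr rfl fun i _ => ?_
  simp only [detour, Finset.mem_filter, Finset.mem_univ, true_and]
  have h1 := hα i
  have h2 := hβ i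
  have h3 := hγ i
  have h4 := hδ i
  generalize α i = a at *
  generalize β i = b at *
  generalize γ i = c at *
  generalize δ i = d at *
  cases a <;> cases b <;> cases c <;> cases d <;> simp_all

theorem star_assoc (α β γ δ : SignVec I) (hα : ∀ i, α i ≠ 0) (hβ : ∀ i, β i ≠ 0)
    (hγ : ∀ i, γ i ≠ 0) (hδ : ∀ i, δ i ≠ 0)
    (x : FaceRing k C {α, β}) (y : FaceRing k C {β, γ}) (z : FaceRing k C {γ, δ}) :
    FaceRing.star k C α γ δ (FaceRing.star k C α β γ x y) z =
      FaceRing.star k C α β δ x (FaceRing.star k C β γ δ y z) := by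
  obtain ⟨p, rfl⟩ := Ideal.Quotient.mk_surjective x
  obtain ⟨q, rfl⟩ := Ideal.Quotient.mk_surjective y
  obtain ⟨r, rfl⟩ := Ideal.Quotient.mk_surjective z
  simp only [star_mk]
  congr 1
  linear_combination (p * q * r) * detour_assoc (k := k) α β γ δ hα hβ hγ hδ

theorem one_star (α β : SignVec I) (x : FaceRing k C {α, β}) :
    FaceRing.star k C α α β 1 x = x := by
  obtain ⟨p, rfl⟩ := Ideal.Quotient.mk_surjective x
  have h : detour α α β = ∅ := by ext i; simp [detour]; tauto
  rw [← map_one (Ideal.Quotient.mk (nonfaceIdeal k C {α, α})), star_mk, h]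
  simp [tMonomial]

theorem star_one (α β : SignVec I) (x : FaceRing k C {α, β}) :
    FaceRing.star k C α β β x 1 = x := by
  obtain ⟨p, rfl⟩ := Ideal.Quotient.mk_surjective x
  have h : detour α β β = ∅ := by ext i; simp [detour]
  rw [← map_one (Ideal.Quotient.mk (nonfaceIdeal k C {β, β})), star_mk, h]
  simp [tMonomial]

instance : Ring (BTilde k C) :=
  { addCommGroupAux k C, mulAux k C, oneAux k C with
    left_distrib := by
      intro x y z
      funext α γ
      simp only [mul_apply, add_apply, star_add_right, Finset.sum_add_distrib]
    right_distrib := by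
      intro x y z
      funext α γ
      simp only [mul_apply, add_apply, star_add_left, Finset.sum_add_distrib]
    zero_mul := by
      intro x
      funext α γ
      simp only [mul_apply, zero_apply, star_zero_left, Finset.sum_const_zero]
    mul_zero := by
      intro x
      funext α γ
      simp only [mul_apply, zero_apply, star_zero_right, Finset.sum_const_zero]
    mul_assoc := by
      intro x y z
      funext α δ
      simp only [mul_apply, star_sum_left, star_sum_right]
      rw [Finset.sum_comm]
      refine Finset.sum_congr rfl fun β _ => Finset.sum_congr rfl fun γ _ => ?_
      exact star_assoc _ _ _ _ α.2.1.1 β.2.1.1 γ.2.1.1 δ.2.1.1 _ _ _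
    one_mul := by
      intro x
      funext α γ
      rw [mul_apply, Finset.sum_eq_single α]
      · rw [one_apply, if_pos rfl, one_star]
      · intro β _ hβ
        rw [one_apply, if_neg (Ne.symm hβ), star_zero_left]
      · simp
    mul_one := by
      intro x
      funext α γ
      rw [mul_apply, Finset.sum_eq_single γ]
      · rw [one_apply, if_pos rfl, star_one]
      · intro β _ hβ
        rw [one_apply, if_neg hβ, star_zero_right]
      · simp }

theorem smul_mul (r : MvPolynomial I k) (x y : BTilde k C) : r • x * y = r • (x * y) := by
  funext α γ
  simp only [mul_apply, smul_apply, star_smul_left, Finset.smul_sum]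

theorem mul_smul' (r : MvPolynomial I k) (x y : BTilde k C) : x * r • y = r • (x * y) := by
  funext α γ
  simp only [mul_apply, smul_apply, star_smul_right, Finset.smul_sum]

/-- The structure map of this algebra sends a polynomial to the element all of whose diagonal
components are its classes, and whose other components are zero. -/
instance : Algebra (MvPolynomial I k) (BTilde k C) := Algebra.ofModule smul_mul mul_smul'

theorem smul_eq_C_smul (c : k) (x : BTilde k C) : c • x = MvPolynomial.C (σ := I) c • x := by
  funext α β
  change c • x α β = MvPolynomial.C (σ := I) c • x α β
  rw [← MvPolynomial.algebraMap_eq, algebraMap_smul]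

instance : Algebra k (BTilde k C) :=
  Algebra.ofModule (fun c x y => by simp only [smul_eq_C_smul, smul_mul_assoc])
    (fun c x y => by simp only [smul_eq_C_smul, mul_smul_comm])

end Structure

/-- The element of `B̃` with only one nonzero component, namely `x` in `R̃_{αβ}`. -/
def single (α β : boundedFeasible C) (x : FaceRing k C {(α : SignVec I), (β : SignVec I)}) :
    BTilde k C :=
  Pi.single α (Pi.single β x)

/-- The graded pieces of `B̃`: the variables have degree two, and `R̃_{αβ}` is shifted so that its
unit has degree `dist α β`. -/
def grade (m : ℕ) : Submodule k (BTilde k C) :=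
  Submodule.span k {z | ∃ (α β : boundedFeasible C) (c : I →₀ ℕ),
    2 * c.degree + dist (α : SignVec I) β = m ∧
      z = single k C α β (Ideal.Quotient.mk _ (MvPolynomial.monomial c 1))}

end BTilde

variable {k}

/-- The algebra `B = Sym(k^I) / (U) ⊗_Sym B̃`. -/
def BAlg (U : Submodule k (I → k)) :=
  (MvPolynomial I k ⧸ linearIdeal U) ⊗[MvPolynomial I k] BTilde k C

instance (U : Submodule k (I → k)) : Ring (BAlg C U) :=
  inferInstanceAs (Ring ((MvPolynomial I k ⧸ linearIdeal U) ⊗[MvPolynomial I k] BTilde k C))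

instance (U : Submodule k (I → k)) : Algebra (MvPolynomial I k) (BAlg C U) :=
  inferInstanceAs (Algebra (MvPolynomial I k)
    ((MvPolynomial I k ⧸ linearIdeal U) ⊗[MvPolynomial I k] BTilde k C))

instance (U : Submodule k (I → k)) : Algebra k (BAlg C U) :=
  inferInstanceAs (Algebra k ((MvPolynomial I k ⧸ linearIdeal U) ⊗[MvPolynomial I k] BTilde k C))

/-- The canonical map from `B̃` to `B`. -/
def BAlg.mk (U : Submodule k (I → k)) : BTilde k C →ₐ[MvPolynomial I k] BAlg C U :=
  (Algebra.TensorProduct.includeRight : BTilde k C →ₐ[MvPolynomial I k]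
    (MvPolynomial I k ⧸ linearIdeal U) ⊗[MvPolynomial I k] BTilde k C)

/-- The graded pieces of `B`: the images of those of `B̃`. -/
def BAlg.grade (U : Submodule k (I → k)) (m : ℕ) : Submodule k (BAlg C U) :=
  Submodule.span k (BAlg.mk C U '' (BTilde.grade k C m : Set (BTilde k C)))

end AlgebraB

end OM

/-! The proof lives on the sign vectors feasible for the dual program. Let L be the set of
restrictions to I of the vectors V of the oriented matroid (sign vectors orthogonal to all
cocircuits) with V(f) = +. The painting lemma, an oriented form of Farkas' lemma, and genericity
show that a sign vector without zeros is bounded exactly when it lies in L (`mem_bounded_iff`).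
Genericity also makes L stable under composition with arbitrary sign vectors, and L always admits
elimination. These two properties (`IsCubical`) make the zero-free members of L behave like chambers
of an arrangement: two of them are joined by a gallery crossing only the components in which they
differ (`exists_step`), and any two such galleries are related by moves across squares
(`step_connected`).

Hence the square relations attach to every pair (a, b) one element `taut a b` of the algebra Ã of
the dual program, and the relations p(α,β)p(β,α) = t_i e_α give `taut a b * taut b c = t_D • taut a
c` with D the detour set (`taut_mul_taut`). This is the multiplication rule of the units 1_{αβ} of
B̃. The taut elements span Ã over the polynomial ring (`span_taut`). Conversely the units, extended
by zero to unbounded or infeasible indices, satisfy the relations of Ã (`unit_mul_unit`), which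
gives a homomorphism Ã → B̃ sending taut elements to units.

It is bijective because every nonface monomial kills the corresponding taut element
(`tMonomial_smul_taut`). If S is not a face of Δ_{αβ}, painting produces a bounded infeasible γ that
agrees with α outside S and outside the components where α and β differ. Since e_γ = 0, the product
`taut α γ * taut γ β` vanishes; it equals t_D • `taut α β` with D contained in S.

The grading of B̃ is built by hand and transported to Ã. The statement on A and B follows by base
change: U^⊥⊥ = U, and the ideal generated by linear forms is homogeneous, so the gradings descend.
The oriented matroid theory needed (strong elimination, painting, duality) is derived from the
circuit axioms. -/

namespace SignVec

/-! ### Orthogonality and composition of sign vectors. -/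

variable {E : Type*} {X Y Z : SignVec E}

theorem Orth.symm (h : Orth X Y) : Orth Y X := by
  unfold Orth at *
  simpa only [mul_comm] using h

theorem Orth.neg_left (h : Orth X Y) : Orth (-X) Y := by
  unfold Orth at *
  have h1 : ∀ a b : SignType, (-a) * b = 1 ↔ a * b = -1 := by decide
  have h2 : ∀ a b : SignType, (-a) * b = -1 ↔ a * b = 1 := by decide
  simpa only [Pi.neg_apply, h1, h2] using h.symm

theorem Orth.neg_right (h : Orth X Y) : Orth X (-Y) := h.symm.neg_left.symm

/-- The standard source of contradictions below: orthogonal sign vectors whose products are all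
nonnegative cannot have a positive product. -/
theorem Orth.mul_eq_zero (h : Orth X Y) (h' : ∀ e, X e * Y e ≠ -1) (e : E) : X e * Y e = 0 := by
  have h1 : X e * Y e ≠ 1 := fun h1 => by
    obtain ⟨i, hi⟩ := h.1 ⟨e, h1⟩
    exact h' i hi
  have h2 := h' e
  generalize X e * Y e = a at *
  cases a <;> simp_all

/-- Orthogonal sign vectors never have exactly one common support element, as a single product would
have no partner of opposite sign. -/
theorem Orth.eq_zero_of_single (h : Orth X Y) {e : E} (he : X e ≠ 0)
    (hother : ∀ i, i ≠ e → X i * Y i = 0) : Y e = 0 := by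
  by_contra hne
  have hsgn : ∀ a b : SignType, a ≠ 0 → b ≠ 0 → a * b = 1 ∨ a * b = -1 := by decide
  have key : ∀ s t : SignType, s ≠ t → t ≠ 0 → X e * Y e = s → ∀ i, X i * Y i ≠ t := by
    intro s t hst ht hs i hi
    by_cases hie : i = e
    · exact hst (by rw [← hs, ← hi, hie])
    · exact ht (by rw [← hi, hother i hie])
  rcases hsgn _ _ he hne with h1 | h1
  · obtain ⟨i, hi⟩ := h.1 ⟨e, h1⟩
    exact key 1 (-1) (by decide) (by decide) h1 i hi
  · obtain ⟨i, hi⟩ := h.2 ⟨e, h1⟩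
    exact key (-1) 1 (by decide) (by decide) h1 i hi

theorem orth_of_mul_eq_zero (h : ∀ e, X e * Y e = 0) : Orth X Y := by
  simp [Orth, h]

theorem exists_of_not_orth (h : ¬ Orth X Y) :
    ∃ Z, (Z = X ∨ Z = -X) ∧ (∀ e, Z e * Y e ≠ -1) ∧ ∃ e, Z e * Y e = 1 := by
  have h2 : ∀ a b : SignType, (-a) * b = -1 ↔ a * b = 1 := by decide
  have h1 : ∀ a b : SignType, (-a) * b = 1 ↔ a * b = -1 := by decide
  unfold Orth at h
  by_cases hp : ∃ e, X e * Y e = 1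
  · refine ⟨X, Or.inl rfl, ?_, hp⟩
    intro e he
    exact h ⟨fun _ => ⟨e, he⟩, fun _ => hp⟩
  · by_cases hn : ∃ e, X e * Y e = -1
    · refine ⟨-X, Or.inr rfl, fun e he => hp ⟨e, (h2 _ _).1 he⟩, ?_⟩
      obtain ⟨e, he⟩ := hn
      exact ⟨e, (h1 _ _).2 he⟩
    · exact absurd ⟨fun h => absurd h hp, fun h => absurd h hn⟩ h

theorem comp_apply (X Y : SignVec E) (e : E) : comp X Y e = if X e ≠ 0 then X e else Y e := rfl

theorem comp_apply_of_ne {e : E} (h : X e ≠ 0) : comp X Y e = X e := by simp [comp, h]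

theorem comp_apply_of_eq {e : E} (h : X e = 0) : comp X Y e = Y e := by simp [comp, h]

/-- If X and Y have disjoint supports, the composition has the same products with X as Z. Otherwise
products of both signs already occur on the support of Y, and composition does not alter them. -/
theorem Orth.comp (h1 : Orth X Y) (h2 : Orth X Z) : Orth X (comp Y Z) := by
  by_cases h : ∀ e, X e * Y e = 0
  · have key : ∀ e, X e * SignVec.comp Y Z e = X e * Z e := by
      intro e
      rcases _root_.mul_eq_zero.1 (h e) with h | h <;> simp [SignVec.comp, h]
    unfold Orth at *
    simpa only [key] using h2
  · push Not at h
    obtain ⟨e, he⟩ := h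
    have key : ∀ e, X e * Y e ≠ 0 → X e * SignVec.comp Y Z e = X e * Y e := by
      intro e he
      simp [SignVec.comp, right_ne_zero_of_mul he]
    have hpos : ∃ e, X e * Y e = 1 := by
      have : X e * Y e = 1 ∨ X e * Y e = -1 := by
        generalize X e * Y e = a at *
        cases a <;> simp_all
      rcases this with h | h
      · exact ⟨e, h⟩
      · exact h1.2 ⟨e, h⟩
    obtain ⟨i, hi⟩ := hpos
    obtain ⟨j, hj⟩ := h1.1 ⟨i, hi⟩
    exact ⟨fun _ => ⟨j, by rw [key j (by simp [hj]), hj]⟩,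
      fun _ => ⟨i, by rw [key i (by simp [hi]), hi]⟩⟩

theorem support_neg (X : SignVec E) : Function.support (-X) = Function.support X := by
  ext i
  simp

theorem orth_zero (X : SignVec E) : Orth X 0 := orth_of_mul_eq_zero (by simp)

end SignVec

namespace OM

open SignVec

/-! ### Strong elimination from the circuit axioms. -/

section Circuits

variable {E : Type*} {C : Set (SignVec E)}

/-- `Y` is orthogonal to every member of `C`. -/
def Perp (C : Set (SignVec E)) (Y : SignVec E) : Prop := ∀ X ∈ C, Orth X Y

theorem Perp.comp {Y Z : SignVec E} (hY : Perp C Y) (hZ : Perp C Z) : Perp C (comp Y Z) :=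
  fun X hX => (hY X hX).comp (hZ X hX)

theorem Perp.neg {Y : SignVec E} (hY : Perp C Y) : Perp C (-Y) :=
  fun X hX => (hY X hX).neg_right

theorem perp_zero : Perp C 0 := fun X _ => orth_zero X

theorem IsOrientedMatroid.weak_elimination (hC : IsOrientedMatroid C) {X Y : SignVec E}
    (hX : X ∈ C) (hY : Y ∈ C) (hne : X ≠ -Y) {e : E} (he : X e ≠ 0) (hYe : Y e = -X e) :
    ∃ Z ∈ C, Z e = 0 ∧ ∀ i, Z i ≠ 0 → Z i = X i ∨ Z i = Y i := by
  have key : ∀ x y z : SignType, (z = 1 → x = 1 ∨ y = 1) → (z = -1 → x = -1 ∨ y = -1) →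
      z ≠ 0 → z = x ∨ z = y := by decide
  have h : X e = 1 ∨ X e = -1 := by
    generalize X e = a at *
    cases a <;> simp_all
  rcases h with h | h
  · obtain ⟨Z, hZ, h0, h1, h2⟩ := hC.elimination X hX Y hY hne e h (by rw [hYe, h])
    exact ⟨Z, hZ, h0, fun i => key _ _ _ (h1 i) (h2 i)⟩
  · obtain ⟨Z, hZ, h0, h1, h2⟩ := hC.elimination Y hY X hX (fun h => hne (by rw [h, neg_neg])) e
      (by rw [hYe, h]; rfl) h
    exact ⟨Z, hZ, h0, fun i hi => (key _ _ _ (h1 i) (h2 i) hi).symm⟩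

variable [Fintype E]

/-- The union of the supports. -/
def supportUnion (X Y : SignVec E) : Finset E := Finset.univ.filter fun i => X i ≠ 0 ∨ Y i ≠ 0

theorem mem_supportUnion {X Y : SignVec E} {i : E} :
    i ∈ supportUnion X Y ↔ X i ≠ 0 ∨ Y i ≠ 0 := by simp [supportUnion]

theorem supportUnion_card_lt {X Y X' Y' : SignVec E} {e : E}
    (h : ∀ i, X' i ≠ 0 ∨ Y' i ≠ 0 → X i ≠ 0 ∨ Y i ≠ 0) (he : X e ≠ 0 ∨ Y e ≠ 0)
    (hX : X' e = 0) (hY : Y' e = 0) :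
    (supportUnion X' Y').card < (supportUnion X Y).card := by
  refine Finset.card_lt_card ⟨fun i hi => mem_supportUnion.2 (h i (mem_supportUnion.1 hi)), ?_⟩
  intro hs
  have := mem_supportUnion.1 (hs (mem_supportUnion.2 he))
  simp [hX, hY] at this

/-- The strong elimination property for the pair `X`, `Y`. -/
def StrongElim (C : Set (SignVec E)) (X Y : SignVec E) (e f : E) : Prop :=
  X ∈ C → Y ∈ C → X e ≠ 0 → Y e = -X e → X f ≠ 0 → Y f ≠ -X f →
    ∃ Z ∈ C, Z e = 0 ∧ Z f ≠ 0 ∧ ∀ i, Z i ≠ 0 → Z i = X i ∨ Z i = Y i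

/-- Wrong signs of a circuit can be removed, one at a time, by elimination with a circuit
without wrong signs. -/
theorem strongElim_repair {X Y Z₁ : SignVec E} {e f : E}
    (IH : ∀ X' Y' e' f', (supportUnion X' Y').card < (supportUnion X Y).card →
      StrongElim C X' Y' e' f')
    (hXe : X e ≠ 0)
    (hZ₁ : Z₁ ∈ C) (he : Z₁ e = 0) (hf : Z₁ f = 0)
    (hs : ∀ i, Z₁ i ≠ 0 → Z₁ i = X i ∨ Z₁ i = Y i) :
    ∀ n, ∀ Z ∈ C, Z e = 0 → Z f ≠ 0 → (∀ i, Z i ≠ 0 → X i ≠ 0 ∨ Y i ≠ 0) →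
      (∀ i, Z i ≠ 0 → Z i ≠ X i → Z i ≠ Y i → Z i = -Z₁ i) →
      (Finset.univ.filter fun i => Z i ≠ 0 ∧ Z i ≠ X i ∧ Z i ≠ Y i).card ≤ n →
      ∃ Z ∈ C, Z e = 0 ∧ Z f ≠ 0 ∧ ∀ i, Z i ≠ 0 → Z i = X i ∨ Z i = Y i := by
  have hs' : ∀ i, Z₁ i ≠ 0 → X i ≠ 0 ∨ Y i ≠ 0 := by
    intro i hi
    rcases hs i hi with h | h <;> rw [h] at hi
    · exact Or.inl hi
    · exact Or.inr hi
  intro n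
  induction n with
  | zero =>
    intro Z hZ hZe hZf _ _ hcard
    refine ⟨Z, hZ, hZe, hZf, fun i hi => ?_⟩
    have := Finset.card_eq_zero.1 (Nat.le_zero.1 hcard)
    by_contra hcon
    push Not at hcon
    have hmem : i ∈ (Finset.univ.filter fun i => Z i ≠ 0 ∧ Z i ≠ X i ∧ Z i ≠ Y i) := by
      simp [hi, hcon]
    rw [this] at hmem
    simp at hmem
  | succ n ih =>
    intro Z hZ hZe hZf hsup hbad hcard
    by_cases hex : ∃ h, Z h ≠ 0 ∧ Z h ≠ X h ∧ Z h ≠ Y h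
    · obtain ⟨h, h0, hX, hY⟩ := hex
      have hh := hbad h h0 hX hY
      have hlt : (supportUnion Z Z₁).card < (supportUnion X Y).card := by
        refine supportUnion_card_lt (e := e) ?_ (Or.inl hXe) hZe he
        rintro i (hi | hi)
        · exact hsup i hi
        · exact hs' i hi
      -- Eliminating the wrong sign at `h` against `Z₁` keeps `f`, where `Z₁` vanishes, and imports
      -- only signs of `Z₁`, which are right. The induction hypothesis applies because `Z` and `Z₁`
      -- both vanish at `e`, whereas `X` does not.
      obtain ⟨Z₂, hZ₂, h20, h2f, h2⟩ := IH Z Z₁ h f hlt hZ hZ₁ h0 (by rw [hh, neg_neg]) hZf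
        (by rw [hf]; intro h; apply hZf; rw [← neg_neg (Z f), ← h]; rfl)
      refine ih Z₂ hZ₂ ?_ h2f ?_ ?_ ?_
      · by_contra hcon
        rcases h2 e hcon with h | h
        · exact hcon (h.trans hZe)
        · exact hcon (h.trans he)
      · intro i hi
        rcases h2 i hi with h | h <;> rw [h] at hi
        · exact hsup i hi
        · exact hs' i hi
      · intro i hi hiX hiY
        rcases h2 i hi with h | h <;> rw [h] at hi hiX hiY ⊢
        · exact hbad i hi hiX hiY
        · exact absurd (hs i hi) (by simp [hiX, hiY])
      · refine Nat.lt_succ_iff.1 (lt_of_lt_of_le (Finset.card_lt_card ?_) hcard)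
        refine ⟨?_, fun hsub => ?_⟩
        · intro i hi
          simp only [Finset.mem_filter, Finset.mem_univ, true_and] at hi ⊢
          obtain ⟨hi, hiX, hiY⟩ := hi
          rcases h2 i hi with h | h <;> rw [h] at hi hiX hiY
          · exact ⟨hi, hiX, hiY⟩
          · exact absurd (hs i hi) (by simp [hiX, hiY])
        · have : h ∈ (Finset.univ.filter fun i => Z i ≠ 0 ∧ Z i ≠ X i ∧ Z i ≠ Y i) := by
            simp [h0, hX, hY]
          have := hsub this
          simp [h20] at this
    · push Not at hex
      refine ⟨Z, hZ, hZe, hZf, fun i hi => ?_⟩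
      by_cases h : Z i = X i
      · exact Or.inl h
      · exact Or.inr (hex i hi h)

/-- Weak elimination of `e` may lose `f`. In that case the result `Z₁` is used to replace `Y` by a
circuit `Y'` that still passes through `e` but avoids some `g` outside the support of `X`. The union
of the supports of `X` and `Y'` is smaller, and the signs of `-Z₁` that enter through `Y'` are
removed by `strongElim_repair`. -/
theorem IsOrientedMatroid.strongElim_of (hC : IsOrientedMatroid C) {X Y : SignVec E} {e f : E}
    (IH : ∀ X' Y' e' f', (supportUnion X' Y').card < (supportUnion X Y).card →
      StrongElim C X' Y' e' f')
    (hY' : ∀ Z₁ ∈ C, Z₁ e = 0 → Z₁ f = 0 → (∀ i, Z₁ i ≠ 0 → Z₁ i = X i ∨ Z₁ i = Y i) →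
      ∀ g, Z₁ g ≠ 0 → X g = 0 → ∃ Y' ∈ C, Y' g = 0 ∧ Y' e ≠ 0 ∧
        ∀ i, Y' i ≠ 0 → Y' i = Y i ∨ Y' i = (-Z₁) i) :
    StrongElim C X Y e f := by
  intro hX hY hXe hYe hXf hYf
  have hne : X ≠ -Y := by
    rintro rfl
    exact hYf (by simp)
  obtain ⟨Z₁, hZ₁, he, hs⟩ := hC.weak_elimination hX hY hne hXe hYe
  by_cases hf : Z₁ f = 0
  swap
  · exact ⟨Z₁, hZ₁, he, hf, hs⟩
  -- A circuit supported inside `X` would be `X` or `-X`, but `Z₁` vanishes at `f`.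
  obtain ⟨g, hg, hXg⟩ : ∃ g, Z₁ g ≠ 0 ∧ X g = 0 := by
    by_contra hcon
    push Not at hcon
    rcases hC.eq_or_eq_neg Z₁ hZ₁ X hX (fun i hi => hcon i hi) with h | h
    · exact hXf (by rw [← h, hf])
    · apply hXf
      have := congrFun h f
      rw [hf] at this
      simpa using this.symm
  obtain ⟨Y', hY'C, hY'g, hY'e, hY's⟩ := hY' Z₁ hZ₁ he hf hs g hg hXg
  have hY'e' : Y' e = -X e := by
    rcases hY's e hY'e with h | h
    · rw [h, hYe]
    · exact absurd (h.trans (by simp [he])) hY'e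
  have hsup : ∀ i, Y' i ≠ 0 → X i ≠ 0 ∨ Y i ≠ 0 := by
    intro i hi
    rcases hY's i hi with h | h
    · exact Or.inr (h ▸ hi)
    · have : Z₁ i ≠ 0 := by
        intro h0
        rw [h] at hi
        simp [h0] at hi
      rcases hs i this with h | h
      · exact Or.inl (h ▸ this)
      · exact Or.inr (h ▸ this)
  have hg' : X g ≠ 0 ∨ Y g ≠ 0 := by
    rcases hs g hg with h | h
    · exact Or.inl (h ▸ hg)
    · exact Or.inr (h ▸ hg)
  have hlt : (supportUnion X Y').card < (supportUnion X Y).card := by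
    refine supportUnion_card_lt (e := g) ?_ hg' hXg hY'g
    rintro i (hi | hi)
    · exact Or.inl hi
    · exact hsup i hi
  have hY'f : Y' f ≠ -X f := by
    intro h
    have h0 : Y' f ≠ 0 := by
      rw [h]
      simpa using hXf
    rcases hY's f h0 with h' | h'
    · exact hYf (h' ▸ h)
    · exact h0 (h'.trans (by simp [hf]))
  obtain ⟨Z, hZ, hZe, hZf, hZs⟩ := IH X Y' e f hlt hX hY'C hXe hY'e' hXf hY'f
  refine strongElim_repair IH hXe hZ₁ he hf hs _ Z hZ hZe hZf ?_ ?_ le_rfl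
  · intro i hi
    rcases hZs i hi with h | h
    · exact Or.inl (h ▸ hi)
    · exact hsup i (h ▸ hi)
  · intro i hi hiX hiY
    rcases hZs i hi with h | h
    · exact absurd h hiX
    · rcases hY's i (h ▸ hi) with h' | h'
      · exact absurd (h.trans h') hiY
      · exact h.trans h'

/-- Induction on the size of the union of the supports. The circuit `Y'` required by `strongElim_of`
comes from eliminating `g` between `Y` and `-Z₁` while keeping `e`. If `Y f = 0`, both vanish at
`f`, so their union is smaller and induction applies (`A`). In general the pair `Y`, `-Z₁` is itself
covered by `A`, with `e` in the role of `f`, because `-Z₁` vanishes at `e`. -/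
theorem IsOrientedMatroid.strongElim_of_card_lt (hC : IsOrientedMatroid C) (n : ℕ) :
    ∀ X Y e f, (supportUnion X Y).card < n → StrongElim C X Y e f := by
  induction n with
  | zero => intro X Y e f h; omega
  | succ n IH =>
    have IH' : ∀ X Y : SignVec E, (supportUnion X Y).card < n + 1 → ∀ X' Y' e' f',
        (supportUnion X' Y').card < (supportUnion X Y).card → StrongElim C X' Y' e' f' :=
      fun X Y h X' Y' e' f' h' => IH X' Y' e' f' (by omega)
    have union_le : ∀ X Y Z₁ : SignVec E, (∀ i, Z₁ i ≠ 0 → Z₁ i = X i ∨ Z₁ i = Y i) →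
        ∀ i, Y i ≠ 0 ∨ (-Z₁) i ≠ 0 → X i ≠ 0 ∨ Y i ≠ 0 := by
      rintro X Y Z₁ hs i (hi | hi)
      · exact Or.inr hi
      · have hi' : Z₁ i ≠ 0 := by simpa using hi
        rcases hs i hi' with h | h
        · exact Or.inl (h ▸ hi')
        · exact Or.inr (h ▸ hi')
    have A : ∀ X Y e f, (supportUnion X Y).card < n + 1 → Y f = 0 → StrongElim C X Y e f := by
      intro X Y e f hcard hYf hX hY hXe hYe hXf hYf'
      refine hC.strongElim_of (IH' X Y hcard) ?_ hX hY hXe hYe hXf hYf'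
      intro Z₁ hZ₁ he hf hs g hg hXg
      have hgY : Z₁ g = Y g := (hs g hg).resolve_left fun h => hg (h.trans hXg)
      have hYe0 : Y e ≠ 0 := by rw [hYe]; simpa using hXe
      obtain ⟨Y', h1, h2, h3, h4⟩ := IH' X Y hcard Y (-Z₁) g e
        (supportUnion_card_lt (e := f) (union_le X Y Z₁ hs) (Or.inl hXf) hYf (by simp [hf]))
        hY (hC.neg_mem _ hZ₁) (hgY ▸ hg) (by simp [hgY]) hYe0
        (by simp only [Pi.neg_apply, he]; intro h; exact hYe0 (by simpa using h.symm))
      exact ⟨Y', h1, h2, h3, h4⟩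
    intro X Y e f hcard hX hY hXe hYe hXf hYf
    refine hC.strongElim_of (IH' X Y hcard) ?_ hX hY hXe hYe hXf hYf
    intro Z₁ hZ₁ he hf hs g hg hXg
    have hgY : Z₁ g = Y g := (hs g hg).resolve_left fun h => hg (h.trans hXg)
    have hYe0 : Y e ≠ 0 := by rw [hYe]; simpa using hXe
    have hle : (supportUnion Y (-Z₁)).card ≤ (supportUnion X Y).card :=
      Finset.card_le_card fun i hi =>
        mem_supportUnion.2 (union_le X Y Z₁ hs i (mem_supportUnion.1 hi))
    obtain ⟨Y', h1, h2, h3, h4⟩ := A Y (-Z₁) g e (by omega) (by simp [he])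
      hY (hC.neg_mem _ hZ₁) (hgY ▸ hg) (by simp [hgY]) hYe0
      (by simp only [Pi.neg_apply, he]; intro h; exact hYe0 (by simpa using h.symm))
    exact ⟨Y', h1, h2, h3, h4⟩

/-- Strong elimination of signed circuits. -/
theorem IsOrientedMatroid.strong_elimination (hC : IsOrientedMatroid C) {X Y : SignVec E}
    (hX : X ∈ C) (hY : Y ∈ C) {e f : E} (hXe : X e ≠ 0) (hYe : Y e = -X e) (hXf : X f ≠ 0)
    (hYf : Y f ≠ -X f) :
    ∃ Z ∈ C, Z e = 0 ∧ Z f ≠ 0 ∧ ∀ i, Z i ≠ 0 → Z i = X i ∨ Z i = Y i :=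
  hC.strongElim_of_card_lt _ X Y e f (Nat.lt_succ_self _) hX hY hXe hYe hXf hYf

end Circuits

/-! ### The painting lemma and elimination for vectors orthogonal to all circuits. -/

section Painting

variable {E : Type*} [Fintype E] {C : Set (SignVec E)}

/-- A sign vector orthogonal to the circuits inside `S` can be changed at one further element so as
to become orthogonal to the circuits inside `insert f S`. -/
theorem IsOrientedMatroid.exists_orth_insert (hC : IsOrientedMatroid C) {S : Set E} {f : E}
    (hf : f ∉ S) {y : SignVec E} (hy : ∀ X ∈ C, Function.support X ⊆ S → Orth X y) :
    ∃ s : SignType, ∀ X ∈ C, Function.support X ⊆ insert f S → Orth X (Function.update y f s) := by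
  by_contra hcon
  push Not at hcon
  -- For each candidate sign there is a violating circuit, oriented so that its products are
  -- nonnegative and not all zero. It passes through `f`, since circuits inside `S` are orthogonal
  -- to `y`.
  have key : ∀ s, ∃ X ∈ C, Function.support X ⊆ insert f S ∧
      (∀ e, X e * Function.update y f s e ≠ -1) ∧ (∃ e, X e * Function.update y f s e = 1) ∧
      X f ≠ 0 := by
    intro s
    obtain ⟨X, hX, hXS, hno⟩ := hcon s
    obtain ⟨Z, hZ, h1, h2⟩ := exists_of_not_orth hno
    have hZC : Z ∈ C := by
      rcases hZ with rfl | rfl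
      · exact hX
      · exact hC.neg_mem _ hX
    have hZS : Function.support Z ⊆ insert f S := by
      rcases hZ with rfl | rfl
      · exact hXS
      · simpa using hXS
    refine ⟨Z, hZC, hZS, h1, h2, fun hZf => ?_⟩
    have hyZ : ∀ e, Z e * Function.update y f s e = Z e * y e := by
      intro e
      by_cases he : e = f
      · subst he; simp [hZf]
      · simp [Function.update_of_ne he]
    have hort : Orth Z y := hy Z hZC fun i hi => (hZS hi).resolve_left (by rintro rfl; exact hi hZf)
    obtain ⟨e, he⟩ := h2
    simp only [hyZ] at h1 he
    have := hort.mul_eq_zero h1 e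
    simp [this] at he
  -- The candidate `-X₀ f` forces the second circuit to be opposite to `X₀` at `f`. Eliminating `f`
  -- while keeping `a`, where `X₀ a * y a = 1`, gives a circuit inside `S` whose products with `y`
  -- are nonnegative and not all zero.
  obtain ⟨X₀, hX₀, hS₀, h0, ⟨a, ha⟩, hf0⟩ := key 0
  obtain ⟨X₁, hX₁, hS₁, h1, -, hf1⟩ := key (-X₀ f)
  have haf : a ≠ f := by
    rintro rfl
    simp at ha
  rw [Function.update_of_ne haf] at ha
  have hf1' : X₁ f = -X₀ f := by
    have := h1 f
    rw [Function.update_self] at this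
    revert this hf1 hf0
    generalize X₀ f = u
    generalize X₁ f = v
    revert u v
    decide
  have ha1 : X₁ a * y a ≠ -1 := by
    have := h1 a
    rwa [Function.update_of_ne haf] at this
  have hX₀a : X₀ a ≠ 0 := by
    intro h
    simp [h] at ha
  have hX₁a : X₁ a ≠ -X₀ a := by
    intro h
    apply ha1
    rw [h, neg_mul, ha]
  obtain ⟨Z, hZ, hZf, hZa, hZs⟩ := hC.strong_elimination hX₀ hX₁ hf0 hf1' hX₀a hX₁a
  have hZS : Function.support Z ⊆ S := by
    intro i hi
    have hif : i ≠ f := by rintro rfl; exact hi hZf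
    rcases hZs i hi with h | h
    · exact (hS₀ (show X₀ i ≠ 0 from h ▸ hi)).resolve_left hif
    · exact (hS₁ (show X₁ i ≠ 0 from h ▸ hi)).resolve_left hif
  have hZy : ∀ e, Z e * y e ≠ -1 := by
    intro e
    by_cases hZe : Z e = 0
    · simp [hZe]
    have hef : e ≠ f := by rintro rfl; exact hZe hZf
    rcases hZs e hZe with h | h
    · have := h0 e
      rwa [Function.update_of_ne hef, ← h] at this
    · have := h1 e
      rwa [Function.update_of_ne hef, ← h] at this
  have := (hy Z hZ hZS).mul_eq_zero hZy a
  rcases mul_eq_zero.1 this with h | h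
  · exact hZa h
  · simp [h] at ha

/-- A sign vector orthogonal to the circuits inside `S` can be changed outside `S` so as to become
orthogonal to all circuits. -/
theorem IsOrientedMatroid.exists_perp_extension (hC : IsOrientedMatroid C) (S : Set E)
    (y : SignVec E) (hy : ∀ X ∈ C, Function.support X ⊆ S → Orth X y) :
    ∃ Y, Perp C Y ∧ ∀ i ∈ S, Y i = y i := by
  have key : ∀ T : Finset E, ∃ Y : SignVec E, (∀ i ∈ S, Y i = y i) ∧
      ∀ X ∈ C, Function.support X ⊆ S ∪ T → Orth X Y := by
    intro T
    induction T using Finset.induction_on with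
    | empty => exact ⟨y, fun _ _ => rfl, by simpa using hy⟩
    | insert f T hf ih =>
      obtain ⟨Y, hY1, hY2⟩ := ih
      by_cases hfS : f ∈ S ∪ T
      · refine ⟨Y, hY1, ?_⟩
        have : S ∪ ↑(insert f T) = S ∪ (T : Set E) := by
          rw [Finset.coe_insert, Set.union_insert, Set.insert_eq_of_mem hfS]
        rwa [this]
      · obtain ⟨s, hs⟩ := hC.exists_orth_insert hfS hY2
        refine ⟨Function.update Y f s, fun i hi => ?_, ?_⟩
        · rw [Function.update_of_ne (by rintro rfl; exact hfS (Or.inl hi)), hY1 i hi]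
        · rwa [Finset.coe_insert, Set.union_insert]
  obtain ⟨Y, hY1, hY2⟩ := key Finset.univ
  exact ⟨Y, fun X hX => hY2 X hX (by simp), hY1⟩

/-- The painting lemma. The element `e` and those of `R` carry the signs prescribed by `s`; those of
`B` are free for circuits, and the remaining ones are free for the orthogonal vectors. -/
theorem IsOrientedMatroid.painting (hC : IsOrientedMatroid C) (s : SignVec E) (e : E) (he : s e ≠ 0)
    (R : Finset E) : ∀ B : Set E, e ∉ B → e ∉ R → (∀ i ∈ R, i ∉ B) → (∀ i ∈ R, s i ≠ 0) →
    (∃ X ∈ C, X e = s e ∧ (∀ i, X i ≠ 0 → i = e ∨ i ∈ B ∨ i ∈ R) ∧ ∀ i ∈ R, X i * s i ≠ -1) ∨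
    (∃ Y, Perp C Y ∧ Y e = s e ∧ (∀ i ∈ B, Y i = 0) ∧ ∀ i ∈ R, Y i * s i ≠ -1) := by
  induction R using Finset.induction_on with
  | empty =>
    intro B heB _ _ _
    by_cases h : ∃ X ∈ C, X e ≠ 0 ∧ Function.support X ⊆ insert e B
    · left
      obtain ⟨X, hX, hXe, hXB⟩ := h
      have hsgn : ∀ a b : SignType, a ≠ 0 → b ≠ 0 → a = b ∨ -a = b := by decide
      rcases hsgn _ _ hXe he with h | h
      · exact ⟨X, hX, h, fun i hi => (hXB hi).imp_right Or.inl, by simp⟩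
      · exact ⟨-X, hC.neg_mem _ hX, h,
          fun i hi => (hXB (show X i ≠ 0 by simpa using hi)).imp_right Or.inl, by simp⟩
    · right
      push Not at h
      obtain ⟨Y, hY, hYS⟩ := hC.exists_perp_extension (insert e B) (Pi.single e (s e)) (by
        intro X hX hXS
        refine orth_of_mul_eq_zero fun i => ?_
        by_cases hi : i = e
        · subst hi
          have : X i = 0 := by
            by_contra hX0
            exact h X hX hX0 hXS
          simp [this]
        · simp [hi])
      refine ⟨Y, hY, by simp [hYS e (by simp)], fun i hi => ?_, by simp⟩
      rw [hYS i (by simp [hi])]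
      have : i ≠ e := by rintro rfl; exact heB hi
      simp [this]
  | insert r R hr ih =>
    intro B heB heR hRB hs
    have her : e ≠ r := by rintro rfl; exact heR (by simp)
    have heR' : e ∉ R := fun h => heR (by simp [h])
    have hrs : s r ≠ 0 := hs r (by simp)
    rcases ih B heB heR' (fun i hi => hRB i (by simp [hi])) (fun i hi => hs i (by simp [hi])) with
      ⟨X, hX, hXe, hXB, hXR⟩ | ⟨Y, hY, hYe, hYB, hYR⟩
    · left
      have hXr : X r = 0 := by
        by_contra h0
        rcases hXB r h0 with h | h | h
        · exact her h.symm
        · exact hRB r (by simp) h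
        · exact hr h
      refine ⟨X, hX, hXe, fun i hi => ?_, fun i hi => ?_⟩
      · rcases hXB i hi with h | h | h <;> simp [h]
      · rcases Finset.mem_insert.1 hi with rfl | hi
        · simp [hXr]
        · exact hXR i hi
    · by_cases hYr : Y r * s r = -1
      swap
      · right
        refine ⟨Y, hY, hYe, hYB, fun i hi => ?_⟩
        rcases Finset.mem_insert.1 hi with rfl | hi
        · exact hYr
        · exact hYR i hi
      -- `Y` has the wrong sign at `r`, so `r` is made free for circuits. A vector found now
      -- vanishes at `r` and is acceptable. A circuit found now has the right sign at `r`: with the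
      -- wrong one its products with `Y` would be nonnegative, and the one at `e` positive.
      rcases ih (insert r B) (by simp [her, heB]) heR'
        (fun i hi h => by
          rcases h with rfl | h
          · exact hr hi
          · exact hRB i (by simp [hi]) h) (fun i hi => hs i (by simp [hi])) with
        ⟨X, hX, hXe, hXB, hXR⟩ | ⟨Y', hY', hYe', hYB', hYR'⟩
      · left
        refine ⟨X, hX, hXe, fun i hi => ?_, fun i hi => ?_⟩
        · rcases hXB i hi with h | (h | h) | h <;> simp [h]
        · rcases Finset.mem_insert.1 hi with rfl | hi
          swap
          · exact hXR i hi
          intro hXr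
          have hpos : ∀ j, X j * Y j ≠ -1 := by
            intro j
            by_cases hXj : X j = 0
            · simp [hXj]
            rcases hXB j hXj with rfl | (rfl | h) | h
            · rw [hXe, hYe]
              generalize s j = u
              revert u
              decide
            · revert hXr hYr
              generalize X j = u
              generalize Y j = v
              generalize s j = w
              revert u v w
              decide
            · simp [hYB j h]
            · have h1 := hXR j h
              have h2 := hYR j h
              have h3 := hs j (by simp [h])
              revert h1 h2 h3
              generalize X j = u
              generalize Y j = v
              generalize s j = w
              revert u v w
              decide
          have := (hY X hX).mul_eq_zero hpos e
          rw [hXe, hYe] at this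
          simp [he] at this
      · right
        refine ⟨Y', hY', hYe', fun i hi => hYB' i (by simp [hi]), fun i hi => ?_⟩
        rcases Finset.mem_insert.1 hi with rfl | hi
        · simp [hYB' i (by simp)]
        · exact hYR' i hi

/-- Elimination for vectors orthogonal to all circuits. -/
theorem IsOrientedMatroid.perp_elimination (hC : IsOrientedMatroid C) {Y₁ Y₂ : SignVec E}
    (h₁ : Perp C Y₁) (h₂ : Perp C Y₂) {e : E} (he : Y₁ e ≠ 0) (he' : Y₂ e = -Y₁ e) :
    ∃ Z, Perp C Z ∧ Z e = 0 ∧ ∀ i, ¬ (Y₁ i ≠ 0 ∧ Y₂ i = -Y₁ i) → Z i = comp Y₁ Y₂ i := by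
  set s := comp Y₁ Y₂ with hs
  let sep : Set E := {i | Y₁ i ≠ 0 ∧ Y₂ i = -Y₁ i}
  have hsep : ∀ i, i ∉ sep → (Y₁ i = 0 ∨ Y₁ i = s i) ∧ (Y₂ i = 0 ∨ Y₂ i = s i) ∧
      (s i ≠ 0 → Y₁ i = s i ∨ Y₂ i = s i) := by
    intro i hi
    simp only [sep, Set.mem_ofPred_eq] at hi
    simp only [hs, comp_apply]
    revert hi
    generalize Y₁ i = u
    generalize Y₂ i = v
    revert u v
    decide
  have one : ∀ f, f ∉ sep → s f ≠ 0 → ∃ Z, Perp C Z ∧ Z e = 0 ∧ Z f = s f ∧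
      ∀ i, i ∉ sep → Z i = 0 ∨ Z i = s i := by
    intro f hf hsf
    let σ : SignVec E := fun i => if s i = 0 then 1 else s i
    have hσ : ∀ i, s i ≠ 0 → σ i = s i := fun i hi => by simp [σ, hi]
    -- The sought vector must vanish at `e` and at the common zeros, is unrestricted on the rest of
    -- the separation set, and must conform to `s` elsewhere. A circuit produced instead can meet
    -- the separation set only in `e`.
    rcases hC.painting s f hsf (Finset.univ.filter fun i => i ∉ sep ∧ s i ≠ 0 ∧ i ≠ f)
        ({e} ∪ {i | i ∉ sep ∧ s i = 0}) (by
          rintro (h | h)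
          · rw [Set.mem_singleton_iff] at h
            subst h
            exact hf ⟨he, he'⟩
          · exact hsf h.2) (by simp) (by
          rintro i hi (h | h)
          · rw [Set.mem_singleton_iff] at h
            subst h
            simp only [Finset.mem_filter, Finset.mem_univ, true_and] at hi
            exact hi.1 ⟨he, he'⟩
          · simp only [Finset.mem_filter, Finset.mem_univ, true_and] at hi
            exact hi.2.1 h.2) (by
          intro i hi
          simp only [Finset.mem_filter, Finset.mem_univ, true_and] at hi
          exact hi.2.1) with ⟨X, hX, hXf, hXB, hXR⟩ | ⟨Z, hZ, hZf, hZB, hZR⟩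
    · exfalso
      have hXs : ∀ i, i ≠ e → X i * s i ≠ -1 ∧ (X i ≠ 0 → i ∉ sep) := by
        intro i hie
        by_cases hXi : X i = 0
        · simp [hXi]
        rcases hXB i hXi with h | (h | h) | h
        · subst h
          refine ⟨?_, fun _ => hf⟩
          rw [hXf]
          generalize s i = u
          revert u
          decide
        · exact absurd h hie
        · exact ⟨by simp [h.2], fun _ => h.1⟩
        · refine ⟨hXR i h, fun _ => ?_⟩
          simp only [Finset.mem_filter, Finset.mem_univ, true_and] at h
          exact h.1
      -- Outside `e` the products of the circuit with `Y₁` and `Y₂` are nonnegative, and at `e` the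
      -- two products are opposite. If they are nonzero, one of them is positive; if they vanish,
      -- the product at `f` with one of `Y₁`, `Y₂` is positive. Both contradict orthogonality.
      have aux : ∀ Y : SignVec E, Perp C Y → (∀ i, i ∉ sep → Y i = 0 ∨ Y i = s i) →
          X e * Y e ≠ -1 → X e * Y e = 0 ∧ X f * Y f = 0 := by
        intro Y hY hYs hYe
        have : ∀ i, X i * Y i ≠ -1 := by
          intro i
          by_cases hie : i = e
          · rw [hie]; exact hYe
          by_cases hXi : X i = 0
          · simp [hXi]
          rcases hYs i ((hXs i hie).2 hXi) with h | h
          · simp [h]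
          · rw [h]; exact (hXs i hie).1
        exact ⟨(hY X hX).mul_eq_zero this e, (hY X hX).mul_eq_zero this f⟩
      have h1 := aux Y₁ h₁ (fun i hi => (hsep i hi).1)
      have h2 := aux Y₂ h₂ (fun i hi => (hsep i hi).2.1)
      have hf3 := (hsep f hf).2.2 hsf
      by_cases hXe : X e = 0
      · have h1 := (h1 (by simp [hXe])).2
        have h2 := (h2 (by simp [hXe])).2
        rcases hf3 with h | h
        · rw [hXf, h] at h1; simp [hsf] at h1
        · rw [hXf, h] at h2; simp [hsf] at h2
      · by_cases hne : X e * Y₁ e = -1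
        · have hne2 : X e * Y₂ e = 1 := by rw [he', mul_neg, hne]; rfl
          have := (h2 (by rw [hne2]; decide)).1
          rw [hne2] at this
          exact absurd this (by decide)
        · have := (h1 hne).1
          simp [hXe, he] at this
    · refine ⟨Z, hZ, hZB e (by simp), hZf, fun i hi => ?_⟩
      by_cases hsi : s i = 0
      · exact Or.inl (hZB i (Or.inr ⟨hi, hsi⟩))
      by_cases hif : i = f
      · right; rw [hif, hZf]
      · have := hZR i (by simp [hi, hsi, hif])
        revert this hsi
        generalize Z i = u
        generalize s i = v
        revert u v
        decide
  -- The vectors found for single elements conform to `s` off the separation set, so composing them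
  -- prescribes all those elements simultaneously.
  have all : ∀ T : Finset E, ∃ Z, Perp C Z ∧ Z e = 0 ∧ (∀ i, i ∉ sep → Z i = 0 ∨ Z i = s i) ∧
      ∀ i ∈ T, i ∉ sep → Z i = s i := by
    intro T
    induction T using Finset.induction_on with
    | empty => exact ⟨0, perp_zero, rfl, fun i _ => Or.inl rfl, by simp⟩
    | insert f T _ ih =>
      obtain ⟨Z, hZ, hZe, hZs, hZT⟩ := ih
      by_cases hf : f ∉ sep ∧ s f ≠ 0
      · obtain ⟨Z', hZ', hZe', hZf', hZs'⟩ := one f hf.1 hf.2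
        refine ⟨comp Z Z', hZ.comp hZ', by simp [comp_apply, hZe, hZe'], ?_, ?_⟩
        · intro i hi
          rw [comp_apply]
          split_ifs
          · exact hZs i hi
          · exact hZs' i hi
        · intro i hi his
          rw [comp_apply]
          rcases Finset.mem_insert.1 hi with rfl | hi
          · split_ifs with h
            · exact (hZs i his).resolve_left h
            · exact hZf'
          · split_ifs with h
            · exact hZT i hi his
            · have h1 := hZT i hi his
              have h2 := hZs' i his
              push Not at h
              rw [h] at h1
              rcases h2 with h2 | h2
              · rw [h2, h1]
              · exact h2
      · refine ⟨Z, hZ, hZe, hZs, fun i hi his => ?_⟩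
        rcases Finset.mem_insert.1 hi with rfl | hi
        · have : s i = 0 := by
            by_contra h
            exact hf ⟨his, h⟩
          rw [this]
          rcases hZs i his with h | h
          · exact h
          · exact h.trans this
        · exact hZT i hi his
  obtain ⟨Z, hZ, hZe, -, hZs⟩ := all Finset.univ
  exact ⟨Z, hZ, hZe, fun i hi => hZs i (by simp) hi⟩

end Painting

/-! ### Cocircuits, covectors and the dual oriented matroid. -/

section Duality

variable {E : Type*} {C : Set (SignVec E)}

theorem mem_cocircuits_perp {D : SignVec E} (hD : D ∈ cocircuits C) : Perp C D := hD.2.1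

theorem perp_cocircuits_of_mem {X : SignVec E} (hX : X ∈ C) : Perp (cocircuits C) X :=
  fun _ hD => (hD.2.1 X hX).symm

variable [Fintype E]

/-- Below a vector orthogonal to all circuits there is a cocircuit through each of the elements of
its support. -/
theorem IsOrientedMatroid.exists_cocircuit_le (hC : IsOrientedMatroid C) {Y : SignVec E}
    (hY : Perp C Y) {e : E} (he : Y e ≠ 0) :
    ∃ D ∈ cocircuits C, D e = Y e ∧ ∀ i, D i ≠ 0 → D i = Y i := by
  have hfin : {Y' : SignVec E | Perp C Y' ∧ Y' e = Y e ∧ ∀ i, Y' i ≠ 0 → Y' i = Y i}.Finite :=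
    Set.toFinite _
  obtain ⟨D, ⟨hD, hDe, hDY⟩, hmin⟩ := Set.exists_min_image _
    (fun Y' : SignVec E => (Finset.univ.filter fun i => Y' i ≠ 0).card) hfin
    ⟨Y, hY, rfl, fun _ _ => rfl⟩
  refine ⟨D, ⟨fun h => he (by rw [← hDe, h]; rfl), hD, ?_⟩, hDe, hDY⟩
  intro D' hD'0 hD' hsub
  by_contra hne
  have hDe0 : D e ≠ 0 := hDe ▸ he
  obtain ⟨h₀, hh₀, hh₀'⟩ : ∃ h, D h ≠ 0 ∧ D' h = 0 := by
    by_contra hcon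
    push Not at hcon
    exact hne (Set.Subset.antisymm hsub fun i hi => hcon i hi)
  -- A vector of smaller support than `D` must be brought to pass through `e` with the sign of `D`.
  -- If it misses `e`, it is eliminated from `D` at one of its support elements; otherwise a change
  -- of sign is enough.
  have start : ∃ D' : SignVec E, Perp C D' ∧ (∀ i, D i = 0 → D' i = 0) ∧ D' e = D e ∧
      ∃ h, D h ≠ 0 ∧ D' h = 0 := by
    have hsub' : ∀ i, D i = 0 → D' i = 0 := fun i hi => by
      by_contra h
      exact hsub h hi
    by_cases hD'e : D' e = 0
    · obtain ⟨h, hh⟩ : ∃ h, D' h ≠ 0 := by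
        by_contra hcon
        push Not at hcon
        exact hD'0 (funext hcon)
      have hDh : D h ≠ 0 := hsub hh
      have : ∃ D'' : SignVec E, Perp C D'' ∧ D'' h = -D h ∧ D'' e = 0 ∧
          ∀ i, D i = 0 → D'' i = 0 := by
        have hsgn : ∀ a b : SignType, a ≠ 0 → b ≠ 0 → a = -b ∨ -a = -b := by decide
        rcases hsgn _ _ hh hDh with h' | h'
        · exact ⟨D', hD', h', hD'e, hsub'⟩
        · exact ⟨-D', Perp.neg hD', h', by simp [hD'e], fun i hi => by simp [hsub' i hi]⟩
      obtain ⟨D'', hD'', h1, h2, h3⟩ := this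
      obtain ⟨Z, hZ, hZh, hZs⟩ := hC.perp_elimination hD hD'' hDh h1
      refine ⟨Z, hZ, fun i hi => ?_, ?_, h, hDh, hZh⟩
      · rw [hZs i (by simp [hi]), comp_apply_of_eq hi, h3 i hi]
      · rw [hZs e (by rw [h2]; rintro ⟨-, h⟩; exact hDe0 (by simpa using h.symm)),
          comp_apply_of_ne hDe0]
    · have hsgn : ∀ a b : SignType, a ≠ 0 → b ≠ 0 → a = b ∨ -a = b := by decide
      rcases hsgn _ _ hD'e hDe0 with h' | h'
      · exact ⟨D', hD', hsub', h', h₀, hh₀, hh₀'⟩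
      · exact ⟨-D', Perp.neg hD', fun i hi => by simp [hsub' i hi], h', h₀, hh₀, by simp [hh₀']⟩
  have hfin : {D' : SignVec E | Perp C D' ∧ (∀ i, D i = 0 → D' i = 0) ∧ D' e = D e ∧
      ∃ h, D h ≠ 0 ∧ D' h = 0}.Finite := Set.toFinite _
  -- Among these vectors take one with fewest sign disagreements with `D`. Eliminating a
  -- disagreement against `D` would reduce their number, and the element eliminated keeps the
  -- support proper. So `F` conforms to `D`, against the minimality of `D`.
  obtain ⟨F, ⟨hF, hFs, hFe, h₁, hDh₁, hFh₁⟩, hFmin⟩ := Set.exists_min_image _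
    (fun Y' : SignVec E => (Finset.univ.filter fun i => D i ≠ 0 ∧ Y' i = -D i).card) hfin start
  by_cases hsep : ∃ h, D h ≠ 0 ∧ F h = -D h
  · obtain ⟨h, hDh, hFh⟩ := hsep
    obtain ⟨Z, hZ, hZh, hZs⟩ := hC.perp_elimination hF hD (e := h) (by rw [hFh]; simpa using hDh)
      (by rw [hFh, neg_neg])
    have hZD : ∀ i, D i ≠ 0 → Z i = -D i → F i = -D i := by
      intro i hDi hZi
      by_contra hcon
      have := hZs i (fun h => hcon (by rw [h.2, neg_neg]))
      rw [hZi, comp_apply] at this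
      split_ifs at this with h'
      · exact hcon this.symm
      · revert this hDi
        generalize D i = u
        revert u
        decide
    have := hFmin Z ⟨hZ, fun i hi => by
      rw [hZs i (by simp [hi, hFs i hi]), comp_apply_of_eq (hFs i hi), hi], by
      rw [hZs e (by rw [hFe]; rintro ⟨-, h⟩; revert h hDe0; generalize D e = u; revert u; decide),
        comp_apply_of_ne (by rw [hFe]; exact hDe0), hFe], h, hDh, hZh⟩
    refine absurd this (not_le.2 (Finset.card_lt_card ⟨?_, fun hsub => ?_⟩))
    · intro i hi
      simp only [Finset.mem_filter, Finset.mem_univ, true_and] at hi ⊢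
      exact ⟨hi.1, hZD i hi.1 hi.2⟩
    · have hm : h ∈ (Finset.univ.filter fun i => D i ≠ 0 ∧ F i = -D i) := by simp [hDh, hFh]
      have := hsub hm
      simp only [Finset.mem_filter, Finset.mem_univ, true_and, hZh] at this
      exact hDh (by simpa using this.2.symm)
  · push Not at hsep
    have hFD : ∀ i, F i ≠ 0 → F i = D i := by
      intro i hi
      have h1 : D i ≠ 0 := fun h => hi (hFs i h)
      have h2 := hsep i h1
      revert hi h1 h2
      generalize F i = u
      generalize D i = v
      revert u v
      decide
    have := hmin F ⟨hF, hFe.trans hDe, fun i hi => by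
      have := hFD i hi
      rw [this]
      exact hDY i (this ▸ hi)⟩
    refine absurd this (not_le.2 (Finset.card_lt_card ⟨?_, fun hsub => ?_⟩))
    · intro i hi
      simp only [Finset.mem_filter, Finset.mem_univ, true_and] at hi ⊢
      rw [← hFD i hi]
      exact hi
    · have hm : h₁ ∈ (Finset.univ.filter fun i => D i ≠ 0) := by simp [hDh₁]
      have := hsub hm
      simp [hFh₁] at this

/-- The covectors are the vectors orthogonal to all circuits. -/
theorem IsOrientedMatroid.isCovector_iff (hC : IsOrientedMatroid C) {Y : SignVec E} :
    IsCovector C Y ↔ Perp C Y := by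
  constructor
  · intro h
    induction h with
    | zero => exact perp_zero
    | comp hY _ ih => exact (mem_cocircuits_perp hY).comp ih
  · intro hY
    have key : ∀ T : Finset E, ∃ Z, IsCovector C Z ∧ (∀ i, Z i ≠ 0 → Z i = Y i) ∧
        ∀ i ∈ T, Z i = Y i := by
      intro T
      induction T using Finset.induction_on with
      | empty => exact ⟨0, .zero, by simp, by simp⟩
      | insert f T _ ih =>
        obtain ⟨Z, hZ, h1, h2⟩ := ih
        by_cases hf : Y f = 0
        · refine ⟨Z, hZ, h1, fun i hi => ?_⟩
          rcases Finset.mem_insert.1 hi with rfl | hi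
          · by_contra hne
            rw [hf] at hne
            exact hne ((h1 i hne).trans hf)
          · exact h2 i hi
        · obtain ⟨D, hD, hDf, hDY⟩ := hC.exists_cocircuit_le hY hf
          refine ⟨SignVec.comp D Z, .comp hD hZ, fun i hi => ?_, fun i hi => ?_⟩
          · rw [comp_apply] at hi ⊢
            split_ifs at hi ⊢ with h
            · exact hDY i h
            · exact h1 i hi
          · rw [comp_apply]
            split_ifs with h
            · exact hDY i h
            · rcases Finset.mem_insert.1 hi with rfl | hi
              · push Not at h
                exact absurd (hDf.symm.trans h) hf
              · exact h2 i hi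
    obtain ⟨Z, hZ, -, h⟩ := key Finset.univ
    rwa [← show Z = Y from funext fun i => h i (by simp)]

/-- The cocircuits form an oriented matroid. -/
theorem IsOrientedMatroid.dual (hC : IsOrientedMatroid C) : IsOrientedMatroid (cocircuits C) where
  zero_notMem h := h.1 rfl
  neg_mem D hD := by
    refine ⟨fun h => hD.1 (by rw [← neg_neg D, h]; rfl), Perp.neg hD.2.1, fun D' h0 h1 h2 => ?_⟩
    rw [SignVec.support_neg] at h2 ⊢
    exact hD.2.2 D' h0 h1 h2
  eq_or_eq_neg D hD F hF hsub := by
    have hsupp := hF.2.2 D hD.1 hD.2.1 hsub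
    have hiff : ∀ i, D i ≠ 0 ↔ F i ≠ 0 := fun i => by
      have := congrArg (i ∈ ·) hsupp
      simpa using this
    by_contra hcon
    push Not at hcon
    obtain ⟨h, hh⟩ : ∃ h, D h ≠ F h := by
      by_contra h
      push Not at h
      exact hcon.1 (funext h)
    obtain ⟨f, hf⟩ : ∃ f, D f ≠ -F f := by
      by_contra h
      push Not at h
      exact hcon.2 (funext h)
    have hDh : D h ≠ 0 ∧ F h = -D h := by
      have := hiff h
      revert this hh
      generalize D h = u
      generalize F h = v
      revert u v
      decide
    have hDf : D f ≠ 0 ∧ F f = D f := by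
      have := hiff f
      revert this hf
      generalize D f = u
      generalize F f = v
      revert u v
      decide
    -- Eliminating a disagreement `h` while keeping an agreement `f` leaves a nonzero vector of
    -- strictly smaller support.
    obtain ⟨Z, hZ, hZh, hZs⟩ := hC.perp_elimination hD.2.1 hF.2.1 hDh.1 hDh.2
    have hZf : Z f = D f := by
      rw [hZs f, comp_apply_of_ne hDf.1]
      rw [hDf.2]
      rintro ⟨-, h⟩
      have h0 := hDf.1
      revert h h0
      generalize D f = u
      revert u
      decide
    have hZD : Function.support Z ⊆ Function.support D := by
      intro i hi
      by_contra h0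
      have h0' : D i = 0 := by simpa using h0
      have h1 : F i = 0 := by
        by_contra h1
        exact h0 ((hiff i).2 h1)
      apply hi
      rw [hZs i (by simp [h0']), comp_apply_of_eq h0', h1]
    have := hD.2.2 Z (fun h => hDf.1 (by rw [← hZf, h]; rfl)) hZ hZD
    have hm : h ∈ Function.support D := hDh.1
    rw [← this] at hm
    exact hm hZh
  elimination D hD F hF hne e hDe hFe := by
    obtain ⟨Z, hZ, hZe, hZs⟩ := hC.perp_elimination hD.2.1 hF.2.1 (e := e) (by rw [hDe]; decide)
      (by rw [hDe, hFe])
    obtain ⟨f, hf⟩ : ∃ f, Z f ≠ 0 := by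
      by_contra hcon
      push Not at hcon
      apply hne
      funext i
      by_contra hi
      have hi' : ¬ (D i ≠ 0 ∧ F i = -D i) := by
        rintro ⟨-, h⟩
        exact hi (by simp [h])
      have h0 := hZs i hi'
      rw [hcon i, comp_apply] at h0
      apply hi
      split_ifs at h0 with h
      · exact absurd h0.symm h
      · push Not at h
        simp [h, ← h0]
    obtain ⟨G, hG, -, hGZ⟩ := hC.exists_cocircuit_le hZ hf
    have hsgn : ∀ i, G i ≠ 0 → ((D i ≠ 0 ∧ F i = -D i) ∨ G i = D i ∨ G i = F i) := by
      intro i hi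
      by_cases hs : D i ≠ 0 ∧ F i = -D i
      · exact Or.inl hs
      · right
        rw [hGZ i hi, hZs i hs, comp_apply]
        split_ifs
        · exact Or.inl rfl
        · exact Or.inr rfl
    refine ⟨G, hG, ?_, fun i hi => ?_, fun i hi => ?_⟩
    · by_contra h
      exact h ((hGZ e h).trans hZe)
    all_goals
      have := hsgn i (by rw [hi]; decide)
      rw [hi] at this
      revert this
      generalize D i = u
      generalize F i = v
      revert u v
      decide

/-- Below a vector orthogonal to all cocircuits there is a circuit through each of the elements of
its support. -/
theorem IsOrientedMatroid.exists_circuit_le (hC : IsOrientedMatroid C) {V : SignVec E}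
    (hV : Perp (cocircuits C) V) {e : E} (he : V e ≠ 0) :
    ∃ X ∈ C, X e = V e ∧ ∀ i, X i ≠ 0 → X i = V i := by
  -- With the support of `V` as the signed set, the first alternative is the desired circuit. In the
  -- second, a cocircuit below `Y` through `e` has only nonnegative products with `V`, and a
  -- positive one at `e`.
  rcases hC.painting V e he (Finset.univ.filter fun i => V i ≠ 0 ∧ i ≠ e) ∅ (by simp) (by simp)
    (by simp) (by intro i hi; simp at hi; exact hi.1) with
    ⟨X, hX, hXe, hXB, hXR⟩ | ⟨Y, hY, hYe, -, hYR⟩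
  · refine ⟨X, hX, hXe, fun i hi => ?_⟩
    rcases hXB i hi with rfl | h | h
    · exact hXe
    · exact absurd h (by simp)
    · have h1 := hXR i h
      simp only [Finset.mem_filter, Finset.mem_univ, true_and] at h
      have h2 := h.1
      revert h1 h2 hi
      generalize X i = u
      generalize V i = v
      revert u v
      decide
  · exfalso
    obtain ⟨D, hD, hDe, hDY⟩ := hC.exists_cocircuit_le hY (e := e) (by rwa [hYe])
    have hpos : ∀ i, D i * V i ≠ -1 := by
      intro i
      by_cases hDi : D i = 0
      · simp [hDi]
      by_cases hVi : V i = 0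
      · simp [hVi]
      rw [hDY i hDi]
      by_cases hie : i = e
      · rw [hie, hYe]
        generalize V e = u
        revert u
        decide
      · exact hYR i (by simp [hVi, hie])
    have := (hV D hD).mul_eq_zero hpos e
    rw [hDe, hYe] at this
    simp [he] at this

/-- Vectors and covectors are orthogonal. -/
theorem IsOrientedMatroid.orth_of_perp (hC : IsOrientedMatroid C) {V Y : SignVec E}
    (hV : Perp (cocircuits C) V) (hY : Perp C Y) : Orth Y V := by
  by_contra h
  obtain ⟨Z, hZ, h1, e, he⟩ := exists_of_not_orth h
  have hZ' : Perp C Z := by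
    rcases hZ with rfl | rfl
    · exact hY
    · exact hY.neg
  obtain ⟨D, hD, hDe, hDZ⟩ := hC.exists_cocircuit_le hZ' (e := e) (by rintro h; simp [h] at he)
  have hpos : ∀ i, D i * V i ≠ -1 := by
    intro i
    by_cases hDi : D i = 0
    · simp [hDi]
    rw [hDZ i hDi]
    exact h1 i
  have := (hV D hD).mul_eq_zero hpos e
  rw [hDe, he] at this
  exact absurd this (by decide)

end Duality

/-! ### Restriction along an injection. -/

section Deletion

variable {E J : Type*} {C : Set (SignVec E)} {φ : J → E}

theorem comp_eq_comp_of_support_subset_range {X X' : SignVec E}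
    (h : ∀ e, X e ≠ 0 → e ∈ Set.range φ) (h' : ∀ e, X' e ≠ 0 → e ∈ Set.range φ)
    (heq : X ∘ φ = X' ∘ φ) : X = X' := by
  funext e
  by_cases he : e ∈ Set.range φ
  · obtain ⟨j, rfl⟩ := he
    exact congrFun heq j
  · have h1 : X e = 0 := by
      by_contra hX
      exact he (h e hX)
    have h2 : X' e = 0 := by
      by_contra hX
      exact he (h' e hX)
    rw [h1, h2]

theorem IsOrientedMatroid.deletion (hC : IsOrientedMatroid C) (φ : J → E) :
    IsOrientedMatroid (deletion φ C) where
  zero_notMem := by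
    rintro ⟨X, hX, hr, h0⟩
    have : X = 0 := comp_eq_comp_of_support_subset_range hr (by simp) (by rw [← h0]; rfl)
    exact hC.zero_notMem (this ▸ hX)
  neg_mem := by
    rintro _ ⟨X, hX, hr, rfl⟩
    exact ⟨-X, hC.neg_mem X hX, fun e he => hr e (by simpa using he), rfl⟩
  eq_or_eq_neg := by
    rintro _ ⟨X, hX, hr, rfl⟩ _ ⟨Y, hY, hr', rfl⟩ hsub
    have : Function.support X ⊆ Function.support Y := by
      intro e he
      obtain ⟨j, rfl⟩ := hr e he
      exact hsub (show j ∈ Function.support (X ∘ φ) from he)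
    rcases hC.eq_or_eq_neg X hX Y hY this with rfl | rfl
    · exact Or.inl rfl
    · exact Or.inr rfl
  elimination := by
    rintro _ ⟨X, hX, hr, rfl⟩ _ ⟨Y, hY, hr', rfl⟩ hne e he he'
    obtain ⟨Z, hZ, hZe, h1, h2⟩ := hC.elimination X hX Y hY
      (by rintro rfl; exact hne rfl) (φ e) he he'
    refine ⟨Z ∘ φ, ⟨Z, hZ, fun i hi => ?_, rfl⟩, hZe, fun i => h1 (φ i), fun i => h2 (φ i)⟩
    have hsgn : ∀ a : SignType, a ≠ 0 → a = 1 ∨ a = -1 := by decide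
    rcases hsgn _ hi with h | h
    · rcases h1 i h with h | h
      · exact hr i (by rw [h]; decide)
      · exact hr' i (by rw [h]; decide)
    · rcases h2 i h with h | h
      · exact hr i (by rw [h]; decide)
      · exact hr' i (by rw [h]; decide)

/-- The vectors orthogonal to the circuits of a deletion are the restrictions of those orthogonal to
all circuits. -/
theorem IsOrientedMatroid.perp_deletion_iff [Fintype E] (hC : IsOrientedMatroid C)
    (hφ : Function.Injective φ) {y : SignVec J} :
    Perp (OM.deletion φ C) y ↔ ∃ Y, Perp C Y ∧ Y ∘ φ = y := by
  have key : ∀ X Y : SignVec E, (∀ e, X e ≠ 0 → e ∈ Set.range φ) →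
      (Orth (X ∘ φ) (Y ∘ φ) ↔ Orth X Y) := by
    intro X Y hr
    have h : ∀ s : SignType, s ≠ 0 → ((∃ e, X e * Y e = s) ↔ ∃ j, (X ∘ φ) j * (Y ∘ φ) j = s) := by
      intro s hs
      constructor
      · rintro ⟨e, he⟩
        obtain ⟨j, rfl⟩ := hr e (by rintro h; rw [h, zero_mul] at he; exact hs he.symm)
        exact ⟨j, he⟩
      · rintro ⟨j, hj⟩
        exact ⟨φ j, hj⟩
    unfold Orth
    rw [h 1 (by decide), h (-1) (by decide)]
  constructor
  · intro hy
    obtain ⟨Y, hY, hYS⟩ := hC.exists_perp_extension (Set.range φ)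
      (Function.extend φ y 0) (by
        intro X hX hXS
        rw [← key X _ hXS]
        have : Function.extend φ y 0 ∘ φ = y := funext fun j => hφ.extend_apply y 0 j
        rw [this]
        exact hy _ ⟨X, hX, hXS, rfl⟩)
    exact ⟨Y, hY, funext fun j => (hYS (φ j) ⟨j, rfl⟩).trans (hφ.extend_apply y 0 j)⟩
  · rintro ⟨Y, hY, rfl⟩ _ ⟨X, hX, hr, rfl⟩
    exact (key X Y hr).2 (hY X hX)

end Deletion

/-! ### Independent sets, rank, and small zero sets. -/

section Independence

variable {E : Type*} {C : Set (SignVec E)}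

theorem IsIndep.mono {S T : Set E} (hT : IsIndep C T) (h : S ⊆ T) : IsIndep C S :=
  fun X hX hS => hT X hX (hS.trans h)

variable [Fintype E]

/-- The augmentation property of independent sets. -/
theorem IsOrientedMatroid.indep_augment (hC : IsOrientedMatroid C) {A B : Finset E}
    (hA : IsIndep C (A : Set E)) (hB : IsIndep C (B : Set E)) (hlt : A.card < B.card) :
    ∃ b ∈ B, b ∉ A ∧ IsIndep C (insert b A : Set E) := by
  by_contra hcon
  push Not at hcon
  -- Among the independent subsets of `A ∪ B` larger than `A`, take one missing as little of `A` as
  -- possible. If it contains `A`, an additional element augments `A`. If it misses `e`, exchanging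
  -- any `f ∈ T \ A` for `e` creates a circuit through `e` avoiding `f`; two different circuits of
  -- this kind eliminate to one inside `T`.
  obtain ⟨T, ⟨hT, hTAB, hTcard⟩, hmin⟩ := Set.exists_min_image
    {T : Finset E | IsIndep C (T : Set E) ∧ T ⊆ A ∪ B ∧ A.card < T.card}
    (fun T => (A \ T).card) (Set.toFinite _) ⟨B, hB, Finset.subset_union_right, hlt⟩
  obtain ⟨e, heA, heT⟩ : ∃ e ∈ A, e ∉ T := by
    by_contra h
    push Not at h
    obtain ⟨b, hbT, hbA⟩ := Finset.exists_mem_notMem_of_card_lt_card hTcard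
    have hbB : b ∈ B := (Finset.mem_union.1 (hTAB hbT)).resolve_left hbA
    refine hcon b hbB hbA (hT.mono ?_)
    rintro i (rfl | hi)
    · exact hbT
    · exact h i hi
  have circ : ∀ f ∈ T, f ∉ A → ∃ X ∈ C, X e ≠ 0 ∧ X f = 0 ∧ ∀ i, X i ≠ 0 → i = e ∨ i ∈ T := by
    intro f hf hfA
    have hfe : f ≠ e := by rintro rfl; exact heT hf
    have hdep : ¬ IsIndep C ((insert e (T.erase f) : Finset E) : Set E) := by
      intro hind
      have := hmin (insert e (T.erase f)) ⟨hind, ?_, ?_⟩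
      · refine absurd this (not_le.2 (Finset.card_lt_card ⟨?_, fun hsub => ?_⟩))
        · intro i hi
          simp only [Finset.mem_sdiff, Finset.mem_insert, Finset.mem_erase, not_or, not_and] at hi ⊢
          exact ⟨hi.1, hi.2.2 (by rintro rfl; exact hfA hi.1)⟩
        · have : e ∈ A \ T := by simp [heA, heT]
          have := hsub this
          simp at this
      · intro i hi
        rcases Finset.mem_insert.1 hi with rfl | hi
        · simp [heA]
        · exact hTAB (Finset.mem_of_mem_erase hi)
      · rw [Finset.card_insert_of_notMem (by simp [heT]), Finset.card_erase_of_mem hf]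
        omega
    unfold IsIndep at hdep
    push Not at hdep
    obtain ⟨X, hX, hXs⟩ := hdep
    refine ⟨X, hX, fun hXe => ?_, ?_, fun i hi => ?_⟩
    · refine hT X hX fun i hi => ?_
      have := hXs hi
      simp only [Finset.coe_insert, Finset.coe_erase, Set.mem_insert_iff, Set.mem_sdiff,
        Set.mem_singleton_iff] at this
      rcases this with rfl | h
      · exact absurd hXe hi
      · exact h.1
    · by_contra h
      have := hXs h
      simp [hfe] at this
    · have := hXs hi
      simp only [Finset.coe_insert, Finset.coe_erase, Set.mem_insert_iff, Set.mem_sdiff,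
        Set.mem_singleton_iff] at this
      exact this.imp_right And.left
  obtain ⟨g, hgT, hgA⟩ := Finset.exists_mem_notMem_of_card_lt_card hTcard
  obtain ⟨X, hX, hXe, hXg, hXs⟩ := circ g hgT hgA
  obtain ⟨h, hXh, hhA⟩ : ∃ h, X h ≠ 0 ∧ h ∉ A := by
    by_contra hcon
    push Not at hcon
    exact hA X hX hcon
  have hhT : h ∈ T := (hXs h hXh).resolve_left (by rintro rfl; exact hhA heA)
  obtain ⟨Y, hY, hYe, hYh, hYs⟩ := circ h hhT hhA
  obtain ⟨Y', hY', hYe', hYh', hYs'⟩ : ∃ Y ∈ C, Y e = -X e ∧ Y h = 0 ∧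
      ∀ i, Y i ≠ 0 → i = e ∨ i ∈ T := by
    have hsgn : ∀ a b : SignType, a ≠ 0 → b ≠ 0 → a = -b ∨ -a = -b := by decide
    rcases hsgn _ _ hYe hXe with h' | h'
    · exact ⟨Y, hY, h', hYh, hYs⟩
    · exact ⟨-Y, hC.neg_mem _ hY, h', by simp [hYh], fun i hi => hYs i (by simpa using hi)⟩
  obtain ⟨Z, hZ, hZe, hZs⟩ := hC.weak_elimination hX hY' (e := e)
    (by rintro rfl; simp [hYh'] at hXh) hXe hYe'
  refine hT Z hZ fun i hi => ?_
  have hie : i ≠ e := by rintro rfl; exact hi hZe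
  rcases hZs i hi with h | h
  · exact (hXs i (h ▸ hi)).resolve_left hie
  · exact (hYs' i (h ▸ hi)).resolve_left hie

/-- A cocircuit whose zero set has at most as many elements as a hyperplane has rank has an
independent zero set. -/
theorem IsOrientedMatroid.indep_zeroSet (hC : IsOrientedMatroid C) {K : Finset E}
    (hK : IsIndep C (K : Set E)) {Y : SignVec E} (hY : Y ∈ cocircuits C)
    (hcard : (zeroSet Y).ncard < K.card) : IsIndep C (zeroSet Y) := by
  by_contra hdep
  set z : Finset E := Finset.univ.filter fun i => Y i = 0 with hz
  have hzz : (z : Set E) = zeroSet Y := by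
    ext i
    simp [hz, zeroSet]
  rw [← hzz, Set.ncard_coe_finset] at hcard
  rw [← hzz] at hdep
  obtain ⟨J, ⟨hJ, hJz⟩, hmax⟩ := Set.exists_max_image
    {J : Finset E | IsIndep C (J : Set E) ∧ J ⊆ z} Finset.card (Set.toFinite _)
    ⟨∅, hK.mono (by simp), by simp⟩
  have hJcard : J.card < z.card :=
    Finset.card_lt_card ⟨hJz, fun h => hdep (by rwa [Finset.Subset.antisymm h hJz])⟩
  have hclosed : ∀ x ∈ z, x ∉ J → ¬ IsIndep C (insert x J : Set E) := by
    intro x hx hxJ hind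
    have := hmax (insert x J) ⟨by simpa using hind, Finset.insert_subset hx hJz⟩
    rw [Finset.card_insert_of_notMem hxJ] at this
    omega
  -- If the zero set is dependent, then `J.card < z.card < K.card`, which leaves room for two
  -- augmentations of `J` from `K`. Both new elements lie outside the closure of `J`, hence outside
  -- `z`.
  obtain ⟨b₁, hb₁K, hb₁J, hb₁⟩ := hC.indep_augment hJ hK (by omega)
  obtain ⟨b₂, hb₂K, hb₂J, hb₂⟩ := hC.indep_augment (A := insert b₁ J)
    (by simpa using hb₁) hK (by rw [Finset.card_insert_of_notMem hb₁J]; omega)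
  have hb₂z : b₂ ∉ z := by
    intro h
    refine hclosed b₂ h (fun h' => hb₂J (by simp [h'])) (hb₂.mono ?_)
    intro i hi
    rcases hi with rfl | hi
    · simp
    · simp only [Finset.coe_insert, Set.mem_insert_iff]
      exact Or.inr (Or.inr hi)
  have hb₁z : b₁ ∉ z := fun h => hclosed b₁ h hb₁J hb₁
  have hb₁₂ : b₁ ≠ b₂ := by rintro rfl; exact hb₂J (by simp)
  -- This separates `b₁` from `J` and `b₂`. The vector found vanishes on `J`, hence on its closure
  -- and on `z`, and also at `b₂`, so its support is strictly smaller than that of the cocircuit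
  -- `Y`.
  rcases hC.painting 1 b₁ (by simp) ∅ (insert b₂ J) (by simp [hb₁₂, hb₁J]) (by simp) (by simp)
    (by simp) with ⟨X, hX, -, hXB, -⟩ | ⟨D, hD, hDb, hDB, -⟩
  · refine hb₂ X hX fun i hi => ?_
    rcases hXB i hi with rfl | (rfl | h) | h
    · simp
    · simp
    · simp only [Finset.coe_insert, Set.mem_insert_iff]
      exact Or.inr (Or.inr h)
    · simp at h
  · have hDz : ∀ x ∈ z, D x = 0 := by
      intro x hx
      by_cases hxJ : x ∈ J
      · exact hDB x (by simp [hxJ])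
      have := hclosed x hx hxJ
      unfold IsIndep at this
      push Not at this
      obtain ⟨X, hX, hXs⟩ := this
      have hXx : X x ≠ 0 := by
        intro h0
        refine hJ X hX fun i hi => (hXs hi).resolve_left ?_
        rintro rfl
        exact hi h0
      refine (hD X hX).eq_zero_of_single hXx fun i hi => ?_
      by_cases hXi : X i = 0
      · simp [hXi]
      · rw [hDB i (by simp [((hXs hXi).resolve_left hi : i ∈ (J : Set E))]), mul_zero]
    have hsub : Function.support D ⊆ Function.support Y := by
      intro i hi h0
      exact hi (hDz i (by simp [hz, h0]))
    have := hY.2.2 D (fun h => by rw [h] at hDb; simp at hDb) hD hsub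
    have hm : b₂ ∈ Function.support Y := fun h => hb₂z (by simp [hz, h])
    rw [← this] at hm
    exact hm (hDB b₂ (by simp))

/-- If the zero sets of the cocircuits through `e` are small, the vectors with `e` in their support
can be composed with arbitrary sign vectors. -/
theorem IsOrientedMatroid.perp_comp (hC : IsOrientedMatroid C) {K : Finset E}
    (hK : IsIndep C (K : Set E)) {e : E}
    (hcard : ∀ D ∈ cocircuits C, D e ≠ 0 → (zeroSet D).ncard < K.card) {Y : SignVec E}
    (hY : Perp C Y) (he : Y e ≠ 0) (σ : SignVec E) : Perp C (comp Y σ) := by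
  obtain ⟨D, hD, hDe, hDY⟩ := hC.exists_cocircuit_le hY he
  have hind := hC.indep_zeroSet hK hD (hcard D hD (hDe ▸ he))
  -- The zero set of `D` contains no circuit, so values on it can be prescribed freely; it contains
  -- the zero set of `Y`.
  obtain ⟨W, hW, hWσ⟩ := hC.exists_perp_extension (zeroSet D) σ
    (fun X hX hXs => absurd hXs (hind X hX))
  have : comp Y σ = comp Y W := by
    funext i
    by_cases hi : Y i = 0
    · rw [comp_apply_of_eq hi, comp_apply_of_eq hi, hWσ i]
      by_contra h
      exact h ((hDY i h).trans hi)
    · rw [comp_apply_of_ne hi, comp_apply_of_ne hi]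
  rw [this]
  exact hY.comp hW

omit [Fintype E] in
theorem exists_indep_ncard_eq_rank [Finite E] (h : (0 : SignVec E) ∉ C) :
    ∃ S, IsIndep C S ∧ S.ncard = rank C := by
  have hne : {m | ∃ S, IsIndep C S ∧ S.ncard = m}.Nonempty := by
    refine ⟨0, ∅, fun X hX hs => h ?_, by simp⟩
    have : X = 0 := by
      funext i
      by_contra hi
      exact hs hi
    exact this ▸ hX
  exact Nat.sSup_mem hne ⟨Nat.card E, by rintro _ ⟨S, -, rfl⟩; exact Set.ncard_le_card S⟩

omit [Fintype E] in
theorem IsIndep.ncard_le_rank [Finite E] {S : Set E} (h : IsIndep C S) : S.ncard ≤ rank C :=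
  le_csSup ⟨Nat.card E, by rintro _ ⟨S, -, rfl⟩; exact Set.ncard_le_card S⟩ ⟨S, h, rfl⟩

end Independence

/-- Independent sets of a contraction by one element that is not a loop. -/
theorem isIndep_contraction_some {J : Type*} [Finite J] {D : Set (SignVec (Option J))}
    (hD : (0 : SignVec (Option J)) ∉ D) (hl : ¬ IsLoop D none) {S : Set J} :
    IsIndep (contraction some D) S ↔ IsIndep D (insert none (some '' S)) := by
  constructor
  · intro h X hX hXs
    have hX0 : X ∘ some ≠ 0 := by
      intro h0
      have hsome : ∀ j, X (some j) = 0 := fun j => congrFun h0 j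
      refine hl ⟨X, hX, ?_⟩
      ext e
      cases e with
      | some j => simp [hsome j]
      | none =>
        simp only [Function.mem_support, Set.mem_singleton_iff, iff_true]
        intro hn
        refine hD ?_
        have : X = 0 := by
          funext e
          cases e with
          | some j => exact hsome j
          | none => exact hn
        exact this ▸ hX
    -- Restricting `X` need not give a circuit of the contraction; one of minimal nonzero support
    -- below it does.
    obtain ⟨W, ⟨hW, hW0, hWs⟩, hmin⟩ := Set.exists_min_image
      {W : SignVec (Option J) | W ∈ D ∧ W ∘ some ≠ 0 ∧
        Function.support (W ∘ some) ⊆ Function.support (X ∘ some)}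
      (fun W => (Function.support (W ∘ some)).ncard) (Set.toFinite _) ⟨X, hX, hX0, le_rfl⟩
    refine h (W ∘ some) ⟨W, hW, rfl, hW0, fun V hV hV0 hVs => ?_⟩ fun j hj => ?_
    · exact Set.eq_of_subset_of_ncard_le hVs (hmin V ⟨hV, hV0, hVs.trans hWs⟩) (Set.toFinite _)
    · have := hXs (show some j ∈ Function.support X from hWs hj)
      simpa using this
  · rintro h _ ⟨X, hX, rfl, -, -⟩ hXs
    refine h X hX fun e he => ?_
    cases e with
    | none => simp
    | some j =>
      right
      exact ⟨j, hXs (show j ∈ Function.support (X ∘ some) from he), rfl⟩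

/-! ### Feasibility, boundedness and duality of generic programs. -/

section Programs

variable {I : Type*}

instance instFintypeExt [Fintype I] : Fintype (Ext I) :=
  Fintype.ofSurjective
    (fun e : Option (Option I) => e.elim Ext.g fun e => e.elim Ext.f Ext.elt) (by
      rintro (i | _ | _)
      · exact ⟨some (some i), rfl⟩
      · exact ⟨none, rfl⟩
      · exact ⟨some none, rfl⟩)

namespace Ext

theorem swap_swap (e : Ext I) : e.swap.swap = e := by cases e <;> rfl

theorem swap_comp_swap : (swap : Ext I → Ext I) ∘ swap = id := funext swap_swap

theorem swap_injective : Function.Injective (swap : Ext I → Ext I) :=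
  Function.LeftInverse.injective swap_swap

theorem inclG_injective : Function.Injective (inclG : Option I → Ext I) := by
  rintro (_ | i) (_ | j) h <;> simp_all [inclG]

theorem mem_range_inclG {e : Ext I} : e ∈ Set.range inclG ↔ e ≠ f := by
  cases e with
  | elt i => exact ⟨fun _ => nofun, fun _ => ⟨some i, rfl⟩⟩
  | g => exact ⟨fun _ => nofun, fun _ => ⟨none, rfl⟩⟩
  | f => exact ⟨by rintro ⟨_ | i, h⟩ <;> simp [inclG] at h, fun h => absurd rfl h⟩

end Ext

variable {C : Set (SignVec (Ext I))}

/-- `Ext.swap` is a bijection, so this deletion removes nothing: it is a relabelling, to which the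
results on deletions apply. -/
theorem dualProgram_eq_deletion : dualProgram C = deletion Ext.swap (cocircuits C) := by
  ext X
  constructor
  · intro hX
    exact ⟨X ∘ Ext.swap, hX, fun e _ => ⟨e.swap, Ext.swap_swap e⟩, by
      rw [Function.comp_assoc, Ext.swap_comp_swap]; rfl⟩
  · rintro ⟨X, hX, -, rfl⟩
    change (X ∘ Ext.swap) ∘ Ext.swap ∈ cocircuits C
    rwa [Function.comp_assoc, Ext.swap_comp_swap]

/-- The vectors on `I` whose extension by `+` is a covector of the affine oriented matroid. -/
def feasibleVectors (C : Set (SignVec (Ext I))) : Set (SignVec I) :=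
  {y | Perp (affine C) (withG y)}

theorem withG_comp_some (Y : SignVec (Option I)) (h : Y none = 1) : withG (Y ∘ some) = Y := by
  funext e
  cases e with
  | none => exact h.symm
  | some i => rfl

theorem comp_withG (y σ : SignVec I) : comp (withG y) (withG σ) = withG (comp y σ) := by
  funext e
  cases e with
  | none => simp [comp_apply, withG]
  | some i => rfl

variable [Fintype I]

omit [Fintype I] in
theorem IsOrientedMatroid.affine (hC : IsOrientedMatroid C) : IsOrientedMatroid (affine C) :=
  hC.deletion _

theorem IsOrientedMatroid.dualProgram (hC : IsOrientedMatroid C) :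
    IsOrientedMatroid (dualProgram C) := by
  rw [dualProgram_eq_deletion]
  exact hC.dual.deletion _

theorem perp_dualProgram_iff {Y : SignVec (Ext I)} (hC : IsOrientedMatroid C) :
    Perp (OM.dualProgram C) Y ↔ Perp (cocircuits C) (Y ∘ Ext.swap) := by
  rw [dualProgram_eq_deletion, hC.dual.perp_deletion_iff Ext.swap_injective]
  constructor
  · rintro ⟨Y, hY, rfl⟩
    rwa [Function.comp_assoc, Ext.swap_comp_swap]
  · intro h
    exact ⟨_, h, by rw [Function.comp_assoc, Ext.swap_comp_swap]; rfl⟩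

theorem perp_affine_iff (hC : IsOrientedMatroid C) {y : SignVec (Option I)} :
    Perp (OM.affine C) y ↔ ∃ Y, Perp C Y ∧ Y ∘ Ext.inclG = y :=
  hC.perp_deletion_iff Ext.inclG_injective

theorem mem_feasibleVectors_iff (hC : IsOrientedMatroid C) {y : SignVec I} :
    y ∈ feasibleVectors C ↔ ∃ Y, Perp C Y ∧ Y Ext.g = 1 ∧ Y ∘ Ext.elt = y := by
  refine (perp_affine_iff hC).trans ⟨?_, ?_⟩
  · rintro ⟨Y, hY, h⟩
    exact ⟨Y, hY, congrFun h none, funext fun i => congrFun h (some i)⟩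
  · rintro ⟨Y, hY, h1, rfl⟩
    refine ⟨Y, hY, ?_⟩
    funext e
    cases e with
    | none => exact h1
    | some i => rfl

theorem mem_feasibleVectors_dualProgram_iff (hC : IsOrientedMatroid C) {y : SignVec I} :
    y ∈ feasibleVectors (OM.dualProgram C) ↔
      ∃ V, Perp (cocircuits C) V ∧ V Ext.f = 1 ∧ V ∘ Ext.elt = y := by
  rw [mem_feasibleVectors_iff hC.dualProgram]
  constructor
  · rintro ⟨Y, hY, h1, rfl⟩
    exact ⟨Y ∘ Ext.swap, (perp_dualProgram_iff hC).1 hY, h1, rfl⟩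
  · rintro ⟨V, hV, h1, rfl⟩
    refine ⟨V ∘ Ext.swap, (perp_dualProgram_iff hC).2 ?_, h1, rfl⟩
    rwa [Function.comp_assoc, Ext.swap_comp_swap]

/-- A covector without zeros has no proper composition above it, so maximality is automatic. -/
theorem mem_feasible_iff (hC : IsOrientedMatroid C) {α : SignVec I} :
    α ∈ feasible C ↔ (∀ i, α i ≠ 0) ∧ α ∈ feasibleVectors C := by
  refine and_congr_right fun hα => ?_
  unfold IsTope
  rw [hC.affine.isCovector_iff]
  refine ⟨And.left, fun h => ⟨h, fun X _ hX => ?_⟩⟩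
  funext e
  refine (isFace_iff.1 hX e ?_).symm
  cases e with
  | none => simp [withG]
  | some i => exact hα i

theorem exists_mem_commonFaces_iff (hC : IsOrientedMatroid C) {A : Set (SignVec I)}
    {S : Finset I} :
    S ∈ zeroComplex C A ↔
      ∃ y ∈ feasibleVectors C, (∀ α ∈ A, ∀ i, y i ≠ 0 → y i = α i) ∧ ∀ i ∈ S, y i = 0 := by
  constructor
  · rintro ⟨Y, ⟨⟨hY, hY1⟩, hYA⟩, hYS⟩
    refine ⟨Y ∘ some, ?_, fun α hα i hi => isFace_iff.1 (hYA α hα) (some i) hi, hYS⟩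
    change Perp _ _
    rw [withG_comp_some Y hY1]
    exact hC.affine.isCovector_iff.1 hY
  · rintro ⟨y, hy, hyA, hyS⟩
    refine ⟨withG y, ⟨⟨hC.affine.isCovector_iff.2 hy, rfl⟩, fun α hα => isFace_iff.2 ?_⟩, hyS⟩
    rintro (_ | i) he
    · rfl
    · exact hyA α hα i he

theorem IsOrientedMatroid.feasibleVectors_elimination (hC : IsOrientedMatroid C)
    {y₁ y₂ : SignVec I} (h₁ : y₁ ∈ feasibleVectors C) (h₂ : y₂ ∈ feasibleVectors C) {e : I}
    (he : y₁ e ≠ 0) (he' : y₂ e = -y₁ e) :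
    ∃ z ∈ feasibleVectors C, z e = 0 ∧
      ∀ i, ¬ (y₁ i ≠ 0 ∧ y₂ i = -y₁ i) → z i = comp y₁ y₂ i := by
  obtain ⟨Z, hZ, hZe, hZs⟩ := hC.affine.perp_elimination (e := some e) h₁ h₂ he he'
  refine ⟨Z ∘ some, ?_, hZe, fun i hi => ?_⟩
  · change Perp _ _
    rwa [withG_comp_some]
    rw [hZs none (by simp [withG]), comp_withG]
    rfl
  · have := hZs (some i) hi
    rw [comp_withG] at this
    exact this

omit [Fintype I] in
theorem IsProgram.affine_not_loop (hC : IsProgram C) : ¬ IsLoop (OM.affine C) none := by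
  rintro ⟨_, ⟨X, hX, hr, rfl⟩, hs⟩
  refine hC.g_not_loop ⟨X, hX, ?_⟩
  ext e
  cases e with
  | elt i =>
    have := Set.ext_iff.1 hs (some i)
    simpa [Ext.inclG] using this
  | g =>
    have := Set.ext_iff.1 hs none
    simpa [Ext.inclG] using this
  | f =>
    have : X Ext.f = 0 := by
      by_contra h
      exact Ext.mem_range_inclG.1 (hr _ h) rfl
    simp [this]

/-- Since g is not a loop, adding it to a basis of the core gives a basis of the affine oriented
matroid, with one element more than the rank of the core. -/
theorem IsProgram.exists_core_basis (hC : IsProgram C) :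
    ∃ S : Finset I, S.card = rank (core C) ∧
      IsIndep (OM.affine C) (insert none (some '' (S : Set I))) ∧
      ∀ i ∉ S, ¬ IsIndep (OM.affine C) (insert none (some '' (insert i (S : Set I)))) := by
  have h0 := hC.isOrientedMatroid.affine.zero_notMem
  obtain ⟨S, hS, hSr⟩ := exists_indep_ncard_eq_rank (C := core C) (fun ⟨_, _, _, h, _⟩ => h rfl)
  refine ⟨S.toFinset, ?_, ?_, ?_⟩
  · rw [← hSr, Set.ncard_eq_toFinset_card']
  · rw [Set.coe_toFinset]
    exact (isIndep_contraction_some h0 hC.affine_not_loop).1 hS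
  · intro i hi hind
    rw [Set.coe_toFinset] at hind
    have := ((isIndep_contraction_some h0 hC.affine_not_loop).2 hind).ncard_le_rank
    rw [Set.ncard_insert_of_notMem (by simpa using hi)] at this
    have h2 : rank (contraction some (OM.affine C)) = rank (core C) := rfl
    omega

/-- In a generic program a feasible vector can be composed with arbitrary sign vectors. -/
theorem IsGeneric.comp_mem (hC : IsProgram C) (hgen : IsGeneric C) {y : SignVec I}
    (hy : y ∈ feasibleVectors C) (σ : SignVec I) : comp y σ ∈ feasibleVectors C := by
  obtain ⟨S, hS, hind, -⟩ := hC.exists_core_basis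
  change Perp _ _
  rw [← comp_withG]
  have hcoe : ((insert none (S.image some) : Finset (Option I)) : Set (Option I)) =
      insert none (some '' (S : Set I)) := by simp
  -- The independent set has rank + 1 elements, and genericity allows a cocircuit through g at most
  -- rank many zeros.
  refine hC.isOrientedMatroid.affine.perp_comp (K := insert none (S.image some))
    (e := none) (by rw [hcoe]; exact hind) ?_ hy (by simp [withG]) _
  intro D hD hDn
  rw [Finset.card_insert_of_notMem (by simp), Finset.card_image_of_injective _
    (Option.some_injective _), hS]
  by_contra hcon
  exact hDn (hgen.cocircuit_g D hD (by omega))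

/-- The complement of a basis is independent in the dual. A dependency would be a cocircuit
supported on f and the complement of `S`. For `i ∉ S` the fundamental circuit of `i` meets it at
most in `i`, so it vanishes there. Finally a circuit through f, which is not a coloop, meets it at
most in f. -/
theorem IsProgram.dual_indep (hC : IsProgram C) {S : Finset I}
    (hS : IsIndep (OM.affine C) (insert none (some '' (S : Set I))))
    (hmax : ∀ i ∉ S, ¬ IsIndep (OM.affine C) (insert none (some '' (insert i (S : Set I))))) :
    IsIndep (OM.affine (OM.dualProgram C)) (insert none (some '' (S : Set I)ᶜ)) := by
  rintro _ ⟨X, hX, hr, rfl⟩ hXs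
  have hD : X ∘ Ext.swap ∈ cocircuits C := hX
  have hXf : X Ext.f = 0 := by
    by_contra h
    exact Ext.mem_range_inclG.1 (hr _ h) rfl
  have hXS : ∀ i ∈ S, X (Ext.elt i) = 0 := by
    intro i hi
    by_contra h
    have := hXs (show some i ∈ Function.support (X ∘ Ext.inclG) from h)
    simp [hi] at this
  have horth : ∀ Z ∈ C, ∀ e, Z e ≠ 0 → (∀ e', e' ≠ e → Z e' = 0 ∨ X e'.swap = 0) →
      X e.swap = 0 := by
    intro Z hZ e hZe hZX
    refine (hD.2.1 Z hZ).eq_zero_of_single (Y := X ∘ Ext.swap) hZe fun e' he' => ?_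
    rcases hZX e' he' with h | h <;> simp [h]
  have hXi : ∀ i, X (Ext.elt i) = 0 := by
    intro i
    by_cases hi : i ∈ S
    · exact hXS i hi
    have := hmax i hi
    unfold IsIndep at this
    push Not at this
    obtain ⟨_, ⟨Z, hZ, hZr, rfl⟩, hZs⟩ := this
    have hZf : Z Ext.f = 0 := by
      by_contra h
      exact Ext.mem_range_inclG.1 (hZr _ h) rfl
    have hZj : ∀ j, j ≠ i → j ∉ S → Z (Ext.elt j) = 0 := by
      intro j hj hjS
      by_contra h
      have := hZs (show some j ∈ Function.support (Z ∘ Ext.inclG) from h)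
      simp [hj, hjS] at this
    have hZi : Z (Ext.elt i) ≠ 0 := by
      intro h
      refine hS _ ⟨Z, hZ, hZr, rfl⟩ ?_
      rintro (_ | j) hj
      · simp
      · right
        have hji : j ≠ i := by rintro rfl; exact hj h
        refine ⟨j, ?_, rfl⟩
        by_contra hjS
        exact hj (hZj j hji hjS)
    refine horth Z hZ (Ext.elt i) hZi ?_
    rintro (j | _ | _) hj
    · by_cases hjS : j ∈ S
      · exact Or.inr (hXS j hjS)
      · exact Or.inl (hZj j (by rintro rfl; exact hj rfl) hjS)
    · exact Or.inr hXf
    · exact Or.inl hZf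
  have hXg : X Ext.g = 0 := by
    by_contra hXg
    refine hC.f_not_coloop fun Z hZ => ?_
    by_contra hZf
    refine hXg (horth Z hZ Ext.f hZf ?_)
    rintro (j | _ | _) hj
    · exact Or.inr (hXi j)
    · exact Or.inr hXf
    · exact absurd rfl hj
  refine hC.isOrientedMatroid.dualProgram.zero_notMem ?_
  have : X = 0 := by
    funext e
    cases e with
    | elt i => exact hXi i
    | g => exact hXg
    | f => exact hXf
  exact this ▸ hX

/-- Deletion is dual to contraction. It lets the genericity condition on the circuits of the
contraction by g be applied to the dual program. -/
theorem cocircuits_affine_dualProgram_subset (hC : IsOrientedMatroid C) :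
    cocircuits (OM.affine (OM.dualProgram C)) ⊆ contractG C := by
  intro Y hY
  obtain ⟨V, hV, rfl⟩ := (perp_affine_iff hC.dualProgram).1 hY.2.1
  rw [perp_dualProgram_iff hC] at hV
  have hperp : ∀ W ∈ C, Perp (OM.affine (OM.dualProgram C)) (W ∘ Ext.inclF) := by
    intro W hW
    refine (perp_affine_iff hC.dualProgram).2 ⟨W ∘ Ext.swap, ?_, ?_⟩
    · rw [perp_dualProgram_iff hC, Function.comp_assoc, Ext.swap_comp_swap]
      exact perp_cocircuits_of_mem hW
    · funext e
      cases e <;> rfl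
  obtain ⟨e, he⟩ : ∃ e, (V ∘ Ext.inclG) e ≠ 0 := by
    by_contra h
    push Not at h
    exact hY.1 (funext h)
  have hincl : ∀ e : Option I, (Ext.inclF e).swap = Ext.inclG e := by
    rintro (_ | i) <;> rfl
  obtain ⟨X, hX, hXe, hXV⟩ := hC.exists_circuit_le hV (e := Ext.inclF e) (by
    simp only [Function.comp_apply, hincl]
    exact he)
  have hXV' : ∀ e, (X ∘ Ext.inclF) e ≠ 0 → (X ∘ Ext.inclF) e = (V ∘ Ext.inclG) e := by
    intro e he
    have := hXV (Ext.inclF e) he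
    simpa only [Function.comp_apply, hincl] using this
  have hX0 : X ∘ Ext.inclF ≠ 0 := by
    intro h
    have h1 := congrFun h e
    simp only [Function.comp_apply, hincl] at h1 hXe he
    rw [hXe] at h1
    exact he h1
  have hsub : Function.support (X ∘ Ext.inclF) ⊆ Function.support (V ∘ Ext.inclG) := by
    intro e he h0
    exact he ((hXV' e he).trans h0)
  have hsupp := hY.2.2 _ hX0 (hperp X hX) hsub
  have hXY : V ∘ Ext.inclG = X ∘ Ext.inclF := by
    funext e
    by_cases h : (X ∘ Ext.inclF) e = 0
    · rw [h]
      by_contra hV0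
      have : e ∈ Function.support (V ∘ Ext.inclG) := hV0
      rw [← hsupp] at this
      exact this h
    · exact (hXV' e h).symm
  exact ⟨X, hX, hXY, hY.1, fun W hW hW0 hWs => hY.2.2 _ hW0 (hperp W hW) hWs⟩

/-- Dual to `IsGeneric.comp_mem`: f together with the complement of a basis of the core has n - d +
1 elements, one more than the number of zeros genericity allows. -/
theorem IsGeneric.comp_mem_dual (hC : IsProgram C) (hgen : IsGeneric C) {y : SignVec I}
    (hy : y ∈ feasibleVectors (OM.dualProgram C)) (σ : SignVec I) :
    comp y σ ∈ feasibleVectors (OM.dualProgram C) := by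
  obtain ⟨S, hS, hind, hmax⟩ := hC.exists_core_basis
  change Perp _ _
  rw [← comp_withG]
  have hcoe : ((insert none (Sᶜ.image some) : Finset (Option I)) : Set (Option I)) =
      insert none (some '' (S : Set I)ᶜ) := by simp
  refine hC.isOrientedMatroid.dualProgram.affine.perp_comp
    (K := insert none (Sᶜ.image some)) (e := none)
    (by rw [hcoe]; exact hC.dual_indep hind hmax) ?_ hy (by simp [withG]) _
  intro D hD hDn
  rw [Finset.card_insert_of_notMem (by simp), Finset.card_image_of_injective _
    (Option.some_injective _), Finset.card_compl, hS]
  by_contra hcon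
  exact hDn (hgen.circuit_f D (cocircuits_affine_dualProgram_subset hC.isOrientedMatroid hD)
    (by omega))

omit [Fintype I] in
theorem comp_of_le {y α : SignVec I} (h : ∀ i, y i * α i ≠ -1) (hα : ∀ i, α i ≠ 0) :
    comp y α = α := by
  funext i
  have h1 := h i
  have h2 := hα i
  rw [comp_apply]
  revert h1 h2
  generalize y i = u
  generalize α i = v
  revert u v
  decide

/-- The sign vector `α` on `I`, extended by `+`. -/
def withOnes (α : SignVec I) : SignVec (Ext I)
  | .elt i => α i
  | .g => 1
  | .f => 1

/-- In a generic program boundedness is feasibility for the dual program. -/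
theorem mem_bounded_iff (hC : IsProgram C) (hgen : IsGeneric C) {α : SignVec I} :
    α ∈ bounded C ↔ (∀ i, α i ≠ 0) ∧ α ∈ feasibleVectors (OM.dualProgram C) := by
  refine and_congr_right fun hα => ?_
  have hO := hC.isOrientedMatroid
  constructor
  · intro hb
    -- The Farkas alternative at f: either a circuit conforming to `α`, free at g, which shows dual
    -- feasibility after composition with `α`; or a covector vanishing at g and conforming to `α`,
    -- an unbounded direction.
    rcases hO.painting (withOnes α) Ext.f (by simp [withOnes])
      (Finset.univ.image Ext.elt) {Ext.g} (by simp) (by simp) (by simp)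
      (by simpa [withOnes] using hα) with ⟨X, hX, hXf, -, hXR⟩ | ⟨Y, hY, hYf, hYB, hYR⟩
    · have h1 : X ∘ Ext.elt ∈ feasibleVectors (OM.dualProgram C) :=
        (mem_feasibleVectors_dualProgram_iff hO).2 ⟨X, perp_cocircuits_of_mem hX, hXf, rfl⟩
      have := hgen.comp_mem_dual hC h1 α
      rwa [comp_of_le (y := X ∘ Ext.elt) (α := α) (fun i => hXR (Ext.elt i) (by simp)) hα] at this
    · exact absurd ⟨Y, hO.isCovector_iff.2 hY, hYB _ rfl, hYf,
        comp_of_le (fun i => hYR (Ext.elt i) (by simp)) hα⟩ hb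
  · rintro h ⟨Z, hZ, hZg, hZf, hZα⟩
    obtain ⟨V, hV, hVf, rfl⟩ := (mem_feasibleVectors_dualProgram_iff hO).1 h
    have hpos : ∀ e, Z e * V e ≠ -1 := by
      rintro (i | _ | _)
      · by_cases hi : Z (Ext.elt i) = 0
        · simp [hi]
        · have := isFace_iff.1 hZα i hi
          simp only [Function.comp_apply] at this
          rw [this]
          generalize V (Ext.elt i) = u
          revert u
          decide
      · simp [hZg]
      · rw [hZf, hVf]; decide
    have := (hO.orth_of_perp hV (hO.isCovector_iff.1 hZ)).mul_eq_zero hpos Ext.f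
    rw [hZf, hVf] at this
    exact absurd this (by decide)

/-- The same alternative at g, with circuits and covectors exchanged: circuits are now forced to
vanish at f, and covectors are free there. -/
theorem mem_bounded_dualProgram_iff (hC : IsProgram C) (hgen : IsGeneric C) {α : SignVec I} :
    α ∈ bounded (OM.dualProgram C) ↔ (∀ i, α i ≠ 0) ∧ α ∈ feasibleVectors C := by
  refine and_congr_right fun hα => ?_
  have hO := hC.isOrientedMatroid
  constructor
  · intro hb
    rcases hO.painting (withOnes α) Ext.g (by simp [withOnes])
      (Finset.univ.image Ext.elt) ∅ (by simp) (by simp) (by simp)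
      (by simpa [withOnes] using hα) with ⟨X, hX, hXg, hXB, hXR⟩ | ⟨Y, hY, hYg, -, hYR⟩
    · refine absurd ⟨X ∘ Ext.swap, hO.dualProgram.isCovector_iff.2
        ((perp_dualProgram_iff hO).2 ?_), ?_, hXg,
        comp_of_le (fun i => hXR (Ext.elt i) (by simp)) hα⟩ hb
      · rw [Function.comp_assoc, Ext.swap_comp_swap]
        exact perp_cocircuits_of_mem hX
      · by_contra h
        have := hXB Ext.f h
        simp at this
    · have h1 : Y ∘ Ext.elt ∈ feasibleVectors C :=
        (mem_feasibleVectors_iff hO).2 ⟨Y, hY, hYg, rfl⟩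
      have := hgen.comp_mem hC h1 α
      rwa [comp_of_le (y := Y ∘ Ext.elt) (α := α) (fun i => hYR (Ext.elt i) (by simp)) hα] at this
  · rintro h ⟨Z, hZ, hZg, hZf, hZα⟩
    obtain ⟨Y, hY, hYg, rfl⟩ := (mem_feasibleVectors_iff hO).1 h
    have hV := (perp_dualProgram_iff hO).1 (hO.dualProgram.isCovector_iff.1 hZ)
    have hpos : ∀ e, Y e * (Z ∘ Ext.swap) e ≠ -1 := by
      rintro (i | _ | _)
      · by_cases hi : Z (Ext.elt i) = 0
        · simp [hi, Ext.swap]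
        · have := isFace_iff.1 hZα i hi
          simp only [Function.comp_apply, Ext.swap] at this ⊢
          rw [this]
          generalize Y (Ext.elt i) = u
          revert u
          decide
      · simp only [Function.comp_apply, Ext.swap]
        rw [hYg, hZf]; decide
      · simp [Ext.swap, hZg]
    have := (hO.orth_of_perp hV hY).mul_eq_zero hpos Ext.g
    simp only [Function.comp_apply, Ext.swap] at this
    rw [hYg, hZf] at this
    exact absurd this (by decide)

theorem mem_boundedFeasible_iff (hC : IsProgram C) (hgen : IsGeneric C) {α : SignVec I} :
    α ∈ boundedFeasible C ↔
      (∀ i, α i ≠ 0) ∧ α ∈ feasibleVectors C ∧ α ∈ feasibleVectors (OM.dualProgram C) := by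
  unfold boundedFeasible
  rw [Set.mem_inter_iff, mem_feasible_iff hC.isOrientedMatroid, mem_bounded_iff hC hgen]
  tauto

theorem boundedFeasible_dualProgram (hC : IsProgram C) (hgen : IsGeneric C) :
    boundedFeasible (OM.dualProgram C) = boundedFeasible C := by
  ext α
  rw [mem_boundedFeasible_iff hC hgen]
  unfold boundedFeasible
  rw [Set.mem_inter_iff, mem_feasible_iff hC.isOrientedMatroid.dualProgram,
    mem_bounded_dualProgram_iff hC hgen]
  tauto

/-- If no feasible face of the bounded sign vector `α` vanishes on `S`, then changing `α` on `S`
leads to a bounded infeasible sign vector. -/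
theorem exists_bounded_infeasible (hC : IsProgram C) {α : SignVec I}
    (hα : ∀ i, α i ≠ 0) (hαd : α ∈ feasibleVectors (OM.dualProgram C)) (S : Finset I)
    (hS : ∀ y ∈ feasibleVectors C, (∀ i, y i ≠ 0 → y i = α i) → ∃ i ∈ S, y i ≠ 0) :
    ∃ γ : SignVec I, (∀ i, γ i ≠ 0) ∧ γ ∈ feasibleVectors (OM.dualProgram C) ∧
      γ ∉ feasibleVectors C ∧ ∀ i ∉ S, γ i = α i := by
  have hO := hC.isOrientedMatroid
  have hle : ∀ u v : SignType, v ≠ 0 → u * v ≠ -1 → u ≠ 0 → u = v := by decide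
  -- A covector vanishing on `S` would be a feasible face of `α`, which is excluded. The circuit `X`
  -- vanishes at f, is positive at g and agrees with `α` off `S` wherever it is nonzero. Composing
  -- `X` with a vector extending `α` keeps dual feasibility, and makes `X` a certificate of
  -- infeasibility, since its product at g would be positive and none negative.
  rcases hO.painting (withOnes α) Ext.g (by simp [withOnes])
    (Sᶜ.image Ext.elt) (Ext.elt '' (S : Set I)) (by simp) (by simp) (by simp)
    (by simpa [withOnes] using fun i _ => hα i) with
    ⟨X, hX, hXg, hXB, hXR⟩ | ⟨Y, hY, hYg, hYB, hYR⟩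
  · obtain ⟨V, hV, hVf, rfl⟩ := (mem_feasibleVectors_dualProgram_iff hO).1 hαd
    have hXf : X Ext.f = 0 := by
      by_contra h
      have := hXB Ext.f h
      simp at this
    refine ⟨comp X V ∘ Ext.elt, fun i => ?_, (mem_feasibleVectors_dualProgram_iff hO).2
      ⟨comp X V, (perp_cocircuits_of_mem hX).comp hV, ?_, rfl⟩, ?_, fun i hi => ?_⟩
    · rw [Function.comp_apply, comp_apply]
      split_ifs with h
      · exact h
      · exact hα i
    · rw [comp_apply_of_eq hXf, hVf]
    · intro hγ
      obtain ⟨Y, hY, hYg, hYα⟩ := (mem_feasibleVectors_iff hO).1 hγ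
      have hpos : ∀ e, X e * Y e ≠ -1 := by
        rintro (i | _ | _)
        · by_cases hi : X (Ext.elt i) = 0
          · simp [hi]
          · have := congrFun hYα i
            simp only [Function.comp_apply, comp_apply_of_ne hi] at this
            rw [this]
            generalize X (Ext.elt i) = u
            revert u
            decide
        · rw [hXg, hYg]; change (1 : SignType) * 1 ≠ -1; decide
        · simp [hXf]
      have := (hY X hX).mul_eq_zero hpos Ext.g
      rw [hXg, hYg] at this
      change (1 : SignType) * 1 = 0 at this
      exact absurd this (by decide)
    · rw [Function.comp_apply, comp_apply]
      split_ifs with h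
      · exact hle _ _ (hα i) (hXR (Ext.elt i) (by simp [hi])) h
      · rfl
  · exfalso
    obtain ⟨i, hi, hYi⟩ := hS (Y ∘ Ext.elt) ((mem_feasibleVectors_iff hO).2 ⟨Y, hY, hYg, rfl⟩)
      (fun i hYi => by
        by_cases hi : i ∈ S
        · exact absurd (hYB (Ext.elt i) ⟨i, hi, rfl⟩) hYi
        · exact hle _ _ (hα i) (hYR (Ext.elt i) (by simp [hi])) hYi)
    exact hYi (hYB (Ext.elt i) ⟨i, hi, rfl⟩)

end Programs

/-! ### Galleries in cubical sets of sign vectors. -/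

section Galleries

variable {I : Type*}

/-- Sets of sign vectors closed under composition with arbitrary sign vectors and under
elimination. -/
structure IsCubical (L : Set (SignVec I)) : Prop where
  comp_mem : ∀ y ∈ L, ∀ σ, comp y σ ∈ L
  elimination : ∀ y₁ ∈ L, ∀ y₂ ∈ L, ∀ e, y₁ e ≠ 0 → y₂ e = -y₁ e →
    ∃ z ∈ L, z e = 0 ∧ ∀ i, ¬ (y₁ i ≠ 0 ∧ y₂ i = -y₁ i) → z i = comp y₁ y₂ i

/-- The sign vector obtained by changing the sign of one component. -/
def flip (α : SignVec I) (i : I) : SignVec I := Function.update α i (-α i)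

theorem flip_same (α : SignVec I) (i : I) : flip α i i = -α i := by simp [flip]

theorem flip_of_ne (α : SignVec I) {i j : I} (h : j ≠ i) : flip α i j = α j := by simp [flip, h]

theorem flip_ne_zero {α : SignVec I} (hα : ∀ i, α i ≠ 0) (i j : I) : flip α i j ≠ 0 := by
  by_cases h : j = i
  · subst h
    rw [flip_same]
    simpa using hα j
  · rw [flip_of_ne α h]
    exact hα j

theorem flip_comm (α : SignVec I) {i j : I} (h : i ≠ j) : flip (flip α i) j = flip (flip α j) i := by
  funext a
  by_cases h1 : a = i
  · subst h1
    rw [flip_of_ne _ h, flip_same, flip_same, flip_of_ne _ h]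
  · by_cases h2 : a = j
    · subst h2
      rw [flip_same, flip_of_ne _ h1, flip_of_ne _ h1, flip_same]
    · rw [flip_of_ne _ h2, flip_of_ne _ h1, flip_of_ne _ h1, flip_of_ne _ h2]

theorem differsAt_flip {α : SignVec I} (hα : ∀ i, α i ≠ 0) (i : I) : DiffersAt i α (flip α i) := by
  intro j
  by_cases h : j = i
  · subst h
    simp only [flip_same, iff_true]
    have := hα j
    revert this
    generalize α j = u
    revert u
    decide
  · simp [flip_of_ne α h, h]

theorem eq_neg_of_ne {a b : SignType} (ha : a ≠ 0) (hb : b ≠ 0) (h : a ≠ b) : b = -a := by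
  revert a b
  decide

theorem DiffersAt.eq_flip {α β : SignVec I} {i : I} (h : DiffersAt i α β) (hα : ∀ i, α i ≠ 0)
    (hβ : ∀ i, β i ≠ 0) : β = flip α i := by
  funext j
  by_cases hj : j = i
  · subst hj
    rw [flip_same]
    exact eq_neg_of_ne (hα j) (hβ j) ((h j).2 rfl)
  · rw [flip_of_ne α hj]
    by_contra hne
    exact hj ((h j).1 (Ne.symm hne))

theorem DiffersAt.symm {α β : SignVec I} {i : I} (h : DiffersAt i α β) : DiffersAt i β α :=
  fun j => ne_comm.trans (h j)

namespace IsCubical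

variable {L : Set (SignVec I)}

/-- The set obtained by forgetting the component `e`. -/
def forget (L : Set (SignVec I)) (e : I) : Set (SignVec I) := {y | ∃ Y ∈ L, ∀ i, i ≠ e → y i = Y i}

theorem isCubical_forget (hL : IsCubical L) (e : I) : IsCubical (forget L e) where
  comp_mem := by
    rintro y ⟨Y, hY, hy⟩ σ
    refine ⟨_, hL.comp_mem Y hY σ, fun i hi => ?_⟩
    rw [comp_apply, comp_apply, hy i hi]
  elimination := by
    rintro y₁ ⟨Y₁, hY₁, hy₁⟩ y₂ ⟨Y₂, hY₂, hy₂⟩ e' h h'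
    by_cases hee : e' = e
    · subst hee
      refine ⟨Function.update (comp y₁ y₂) e' 0, ⟨_, hL.comp_mem Y₁ hY₁ Y₂, fun i hi => ?_⟩,
        by simp, fun i hi => ?_⟩
      · rw [Function.update_of_ne hi, comp_apply, comp_apply, hy₁ i hi, hy₂ i hi]
      · rw [Function.update_of_ne]
        rintro rfl
        exact hi ⟨h, h'⟩
    · rw [hy₁ e' hee, hy₂ e' hee] at h'
      rw [hy₁ e' hee] at h
      obtain ⟨Z, hZ, hZe, hZs⟩ := hL.elimination Y₁ hY₁ Y₂ hY₂ e' h h'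
      refine ⟨Function.update Z e (comp y₁ y₂ e), ⟨Z, hZ, fun i hi => Function.update_of_ne hi _ _⟩,
        by rw [Function.update_of_ne hee, hZe], fun i hi => ?_⟩
      by_cases hie : i = e
      · subst hie
        simp
      · rw [Function.update_of_ne hie, comp_apply, hy₁ i hie, hy₂ i hie]
        rw [hy₁ i hie, hy₂ i hie] at hi
        exact hZs i hi

theorem mem_or_flip_mem_of_forget (hL : IsCubical L) {α : SignVec I} (hα : ∀ i, α i ≠ 0) {e : I}
    (h : α ∈ forget L e) : α ∈ L ∨ flip α e ∈ L := by
  obtain ⟨Y, hY, hy⟩ := h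
  by_cases hYe : Y e = α e ∨ Y e = 0
  · left
    have := hL.comp_mem Y hY α
    convert this using 1
    funext i
    rw [comp_apply]
    by_cases hi : i = e
    · subst hi
      rcases hYe with h | h <;> simp [h]
    · rw [← hy i hi]
      simp [hα i]
  · right
    push Not at hYe
    convert hY using 1
    funext i
    by_cases hi : i = e
    · subst hi
      rw [flip_same]
      exact (eq_neg_of_ne (hα i) hYe.2 hYe.1.symm).symm
    · rw [flip_of_ne α hi, hy i hi]

variable [Fintype I]

/-- Eliminate a component `e` in which `α` and `γ` differ. If the resulting `Z` never contradicts
`α`, composing it with `flip α e` gives `flip α e` itself. Otherwise `comp Z α` differs from `α`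
only where `γ` does, and no longer at `e`, so it replaces `γ` in the induction. -/
theorem exists_flip_mem (hL : IsCubical L) (n : ℕ) : ∀ {α γ : SignVec I}, (∀ i, α i ≠ 0) →
    (∀ i, γ i ≠ 0) → α ∈ L → γ ∈ L → α ≠ γ → dist α γ ≤ n → ∃ i, α i ≠ γ i ∧ flip α i ∈ L := by
  induction n with
  | zero =>
    intro α γ _ _ _ _ hne hd
    refine absurd (funext fun i => ?_) hne
    by_contra hi
    have : i ∈ (∅ : Finset I) := by
      rw [← Finset.card_eq_zero.1 (Nat.le_zero.1 hd)]
      simpa using hi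
    simp at this
  | succ n ih =>
    intro α γ hα hγ hαL hγL hne hd
    obtain ⟨e, he⟩ : ∃ e, α e ≠ γ e := by
      by_contra h
      push Not at h
      exact hne (funext h)
    obtain ⟨Z, hZ, hZe, hZs⟩ := hL.elimination α hαL γ hγL e (hα e)
      (eq_neg_of_ne (hα e) (hγ e) he)
    have hZα : ∀ i, α i = γ i → Z i = α i := by
      intro i hi
      rw [hZs i, comp_apply_of_ne (hα i)]
      rintro ⟨h, h'⟩
      rw [← hi] at h'
      revert h h'
      generalize α i = u
      revert u
      decide
    by_cases hc : comp Z α = α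
    · refine ⟨e, he, ?_⟩
      have := hL.comp_mem Z hZ (flip α e)
      convert this using 1
      funext i
      rw [comp_apply]
      by_cases hi : i = e
      · subst hi
        simp [hZe]
      · split_ifs with h
        · have := congrFun hc i
          rw [comp_apply_of_ne h] at this
          rw [flip_of_ne α hi, this]
        · rfl
    · have hfull : ∀ i, comp Z α i ≠ 0 := by
        intro i
        rw [comp_apply]
        split_ifs with h
        · exact h
        · exact hα i
      obtain ⟨i, hi, hiL⟩ := ih hα hfull hαL (hL.comp_mem Z hZ α) (Ne.symm hc) (by
        refine Nat.lt_succ_iff.1 (lt_of_lt_of_le (Finset.card_lt_card ⟨?_, fun hsub => ?_⟩) hd)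
        · intro i hi
          simp only [Finset.mem_filter, Finset.mem_univ, true_and] at hi ⊢
          intro h
          apply hi
          rw [comp_apply]
          split_ifs with h0
          · exact (hZα i h).symm
          · rfl
        · have hm : e ∈ (Finset.univ.filter fun i => α i ≠ γ i) := by simpa using he
          have := hsub hm
          simp [comp_apply, hZe] at this)
      refine ⟨i, fun h => hi ?_, hiL⟩
      rw [comp_apply]
      split_ifs with h0
      · exact (hZα i h).symm
      · rfl

/-- Two members without zeros are joined by a gallery without detours: there is a first step. -/
theorem exists_step (hL : IsCubical L) {α γ : SignVec I} (hα : ∀ i, α i ≠ 0)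
    (hγ : ∀ i, γ i ≠ 0) (hαL : α ∈ L) (hγL : γ ∈ L) (hne : α ≠ γ) :
    ∃ i, α i ≠ γ i ∧ flip α i ∈ L :=
  hL.exists_flip_mem _ hα hγ hαL hγL hne le_rfl

/-- A first step towards the opposite corner of a square must be one of its two sides. -/
theorem flip_mem_of_flip_flip_mem (hL : IsCubical L) {α : SignVec I} (hα : ∀ i, α i ≠ 0)
    (hαL : α ∈ L) {i j : I} (hij : i ≠ j) (h : flip (flip α i) j ∈ L) :
    flip α i ∈ L ∨ flip α j ∈ L := by
  have hne : α ≠ flip (flip α i) j := by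
    intro h
    have := congrFun h i
    rw [flip_of_ne _ hij, flip_same] at this
    have h0 := hα i
    revert this h0
    generalize α i = u
    revert u
    decide
  obtain ⟨a, ha, haL⟩ := hL.exists_step hα (flip_ne_zero (flip_ne_zero hα i) j) hαL h hne
  by_cases hai : a = i
  · subst hai; exact Or.inl haL
  by_cases haj : a = j
  · subst haj; exact Or.inr haL
  rw [flip_of_ne _ haj, flip_of_ne _ hai] at ha
  exact absurd rfl ha

omit [Fintype I] in
theorem update_zero_mem (hL : IsCubical L) {α : SignVec I} (hα : ∀ i, α i ≠ 0)
    (hαL : α ∈ L) {e : I} (h : flip α e ∈ L) : Function.update α e 0 ∈ L := by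
  obtain ⟨Z, hZ, hZe, hZs⟩ := hL.elimination α hαL _ h e (hα e) (flip_same α e)
  convert hZ using 1
  funext i
  by_cases hi : i = e
  · subst hi
    simp [hZe]
  · rw [Function.update_of_ne hi, hZs i, comp_apply_of_ne (hα i)]
    rw [flip_of_ne α hi]
    have := hα i
    revert this
    generalize α i = u
    revert u
    decide

omit [Fintype I] in
/-- The three-dimensional cubes of a cubical set do not lack just two antipodal vertices. -/
theorem no_hexagon (hL : IsCubical L) {α : SignVec I} (hα : ∀ i, α i ≠ 0) {i j e : I}
    (hij : i ≠ j) (hie : i ≠ e) (hje : j ≠ e) (hi : flip α i ∈ L) (hj : flip α j ∈ L)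
    (hi' : flip (flip α i) e ∈ L) (hj' : flip (flip α j) e ∈ L) :
    flip α e ∈ L ∨ flip (flip α i) j ∈ L := by
  have h1 := hL.update_zero_mem (flip_ne_zero hα i) hi hi'
  have h2 := hL.update_zero_mem (flip_ne_zero hα j) hj hj'
  -- Both walls vanish at `e` and they disagree at `i` and `j`. Eliminating `i` leaves `Z` equal to
  -- `α` away from `i`, `j`, `e` and zero at `i` and `e`; only its value at `j` is uncontrolled, and
  -- this decides between the two conclusions.
  obtain ⟨Z, hZ, hZi, hZs⟩ := hL.elimination _ h1 _ h2 i
    (by rw [Function.update_of_ne hie]; exact flip_ne_zero hα i i)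
    (by rw [Function.update_of_ne hie, Function.update_of_ne hie, flip_same, flip_of_ne _ hij,
      neg_neg])
  have hZe : Z e = 0 := by
    rw [hZs e (by simp)]
    simp [comp_apply]
  have hZa : ∀ a, a ≠ i → a ≠ j → a ≠ e → Z a = α a := by
    intro a hai haj hae
    rw [hZs a, comp_apply, Function.update_of_ne hae, flip_of_ne _ hai, if_pos (hα a)]
    rw [Function.update_of_ne hae, Function.update_of_ne hae, flip_of_ne _ hai, flip_of_ne _ haj]
    have := hα a
    revert this
    generalize α a = u
    revert u
    decide
  by_cases hZj : Z j = -α j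
  · right
    have := hL.comp_mem Z hZ (flip (flip α i) j)
    convert this using 1
    funext a
    rw [comp_apply]
    by_cases hai : a = i
    · subst hai; simp [hZi]
    by_cases haj : a = j
    · subst haj; simp [hZj, flip_same, flip_of_ne _ hai]
    by_cases hae : a = e
    · subst hae; simp [hZe]
    · rw [flip_of_ne _ haj, flip_of_ne _ hai, hZa a hai haj hae, if_pos (hα a)]
  · left
    have := hL.comp_mem Z hZ (flip α e)
    convert this using 1
    funext a
    rw [comp_apply]
    by_cases hai : a = i
    · subst hai; simp [hZi]
    by_cases hae : a = e
    · subst hae; simp [hZe]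
    by_cases haj : a = j
    · subst haj
      rw [flip_of_ne _ hae]
      have := hα a
      revert this hZj
      generalize Z a = u
      generalize α a = v
      revert u v
      decide
    · rw [flip_of_ne _ hae, hZa a hai haj hae, if_pos (hα a)]

/-- Two possible first steps of detour-free galleries from `α` to `γ` which span a square. -/
def StepSquare (L : Set (SignVec I)) (α γ : SignVec I) (i j : I) : Prop :=
  α i ≠ γ i ∧ α j ≠ γ j ∧ i ≠ j ∧ flip α i ∈ L ∧ flip α j ∈ L ∧ flip (flip α i) j ∈ L

/-- Induction on the distance, by forgetting a component `e` other than `i` and `j` in which `α` and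
`γ` differ. Chains of squares exist after forgetting; each square either lifts to `L`, or is
replaced by two squares passing through the step `e`. If no such `e` exists, the square on `i`, `j`
has `γ` as its fourth vertex. -/
theorem step_connected (n : ℕ) : ∀ {L : Set (SignVec I)}, IsCubical L → ∀ {α γ : SignVec I},
    (∀ i, α i ≠ 0) → (∀ i, γ i ≠ 0) → α ∈ L → γ ∈ L → dist α γ ≤ n → ∀ {i j : I},
    α i ≠ γ i → α j ≠ γ j → flip α i ∈ L → flip α j ∈ L →
    Relation.ReflTransGen (StepSquare L α γ) i j := by
  induction n with
  | zero =>
    intro L _ α γ _ _ _ _ hd i _ hi _ _ _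
    have : i ∈ (∅ : Finset I) := by
      rw [← Finset.card_eq_zero.1 (Nat.le_zero.1 hd)]
      simpa using hi
    simp at this
  | succ n ih =>
    intro L hL α γ hα hγ hαL hγL hd i j hi hj hiL hjL
    by_cases hij : i = j
    · subst hij; exact .refl
    by_cases hex : ∃ e, α e ≠ γ e ∧ e ≠ i ∧ e ≠ j
    swap
    · push Not at hex
      refine .single ⟨hi, hj, hij, hiL, hjL, ?_⟩
      convert hγL using 1
      funext a
      by_cases haj : a = j
      · subst haj
        rw [flip_same, flip_of_ne _ (Ne.symm hij), eq_neg_of_ne (hα a) (hγ a) hj]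
      by_cases hai : a = i
      · subst hai
        rw [flip_of_ne _ haj, flip_same, eq_neg_of_ne (hα a) (hγ a) hi]
      · rw [flip_of_ne _ haj, flip_of_ne _ hai]
        by_contra h
        exact haj (hex a h hai)
    -- The component is chosen with care: crossing `e` from `α` leaves `L`, unless crossing every
    -- relevant component stays in `L`. This is what lifts first steps in `hW`.
    have hex' : ∃ e, α e ≠ γ e ∧ e ≠ i ∧ e ≠ j ∧
        (flip α e ∈ L → ∀ a, α a ≠ γ a → flip α a ∈ L) := by
      by_cases h : ∃ e, α e ≠ γ e ∧ flip α e ∉ L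
      · obtain ⟨e, he, heL⟩ := h
        exact ⟨e, he, by rintro rfl; exact heL hiL, by rintro rfl; exact heL hjL,
          fun h => absurd h heL⟩
      · push Not at h
        obtain ⟨e, h1, h2, h3⟩ := hex
        exact ⟨e, h1, h2, h3, fun _ => h⟩
    obtain ⟨e, he, hei, hej, heL⟩ := hex'
    have hsub : L ⊆ forget L e := fun y hy => ⟨y, hy, fun _ _ => rfl⟩
    set γ' := Function.update γ e (α e) with hγ'
    have hγ'i : ∀ a, α a ≠ γ' a ↔ α a ≠ γ a ∧ a ≠ e := by
      intro a
      by_cases hae : a = e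
      · subst hae; simp [hγ']
      · simp [hγ', hae]
    have := ih (hL.isCubical_forget e) (α := α) (γ := γ') hα (by
        intro a
        by_cases hae : a = e
        · subst hae; simpa [hγ'] using hα a
        · rw [hγ', Function.update_of_ne hae]; exact hγ a)
      (hsub hαL) ⟨γ, hγL, fun a ha => by rw [hγ', Function.update_of_ne ha]⟩ (by
        refine Nat.lt_succ_iff.1 (lt_of_lt_of_le (Finset.card_lt_card ⟨?_, fun hs => ?_⟩) hd)
        · intro a ha
          simp only [Finset.mem_filter, Finset.mem_univ, true_and, hγ'i] at ha ⊢
          exact ha.1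
        · have hm : e ∈ (Finset.univ.filter fun i => α i ≠ γ i) := by simpa using he
          have := hs hm
          simp [hγ'] at this)
      ((hγ'i i).2 ⟨hi, hei.symm⟩) ((hγ'i j).2 ⟨hj, hej.symm⟩) (hsub hiL) (hsub hjL)
    have hW : ∀ a, α a ≠ γ' a → flip α a ∈ forget L e → flip α a ∈ L := by
      intro a ha haL
      rcases hL.mem_or_flip_mem_of_forget (flip_ne_zero hα a) haL with h | h
      · exact h
      · rcases hL.flip_mem_of_flip_flip_mem hα hαL ((hγ'i a).1 ha).2 h with h | h
        · exact h
        · exact heL h a ((hγ'i a).1 ha).1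
    refine Relation.reflTransGen_closed ?_ _ _ this
    rintro a b ⟨ha, hb, hab, haL, hbL, habL⟩
    have haL := hW a ha haL
    have hbL := hW b hb hbL
    obtain ⟨ha, hae⟩ := (hγ'i a).1 ha
    obtain ⟨hb, hbe⟩ := (hγ'i b).1 hb
    by_cases habL' : flip (flip α a) b ∈ L
    · exact .single ⟨ha, hb, hab, haL, hbL, habL'⟩
    have habe := (hL.mem_or_flip_mem_of_forget (flip_ne_zero (flip_ne_zero hα a) b)
      habL).resolve_left habL'
    have hae' := (hL.flip_mem_of_flip_flip_mem (flip_ne_zero hα a) haL hbe habe).resolve_left habL'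
    have hbe' : flip (flip α b) e ∈ L := by
      rw [flip_comm α hab] at habe habL'
      exact (hL.flip_mem_of_flip_flip_mem (flip_ne_zero hα b) hbL hae habe).resolve_left habL'
    -- If the corner at `a`, `b` is missing, then all three pairwise reachable corners of the cube
    -- on `a`, `b`, `e` next to it are present, and `no_hexagon` supplies the step `e` from `α`.
    have heL' := (hL.no_hexagon hα hab hae hbe haL hbL hae' hbe').resolve_right habL'
    refine .tail (.single ⟨ha, he, hae, haL, heL', hae'⟩) ⟨he, hb, hbe.symm, heL', hbL, ?_⟩
    rwa [flip_comm α hbe.symm]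

end IsCubical

variable [Fintype I] {C : Set (SignVec (Ext I))}

theorem IsGeneric.isCubical_dual (hC : IsProgram C) (hgen : IsGeneric C) :
    IsCubical (feasibleVectors (OM.dualProgram C)) where
  comp_mem _ hy σ := hgen.comp_mem_dual hC hy σ
  elimination _ h₁ _ h₂ _ he he' :=
    hC.isOrientedMatroid.dualProgram.feasibleVectors_elimination h₁ h₂ he he'

end Galleries

/-! ### Taut elements of the algebra of a program. -/

section Taut

variable {I : Type*} [Fintype I]

theorem dist_eq_succ {α β γ : SignVec I} {i : I} (hα : ∀ i, α i ≠ 0) (hβ : ∀ i, β i ≠ 0)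
    (hγ : ∀ i, γ i ≠ 0) (h : DiffersAt i α β) (hi : α i ≠ γ i) : dist α γ = dist β γ + 1 := by
  have hβi : β i = γ i := by
    rw [eq_neg_of_ne (hα i) (hβ i) ((h i).2 rfl), eq_neg_of_ne (hα i) (hγ i) hi]
  have hj : ∀ j, j ≠ i → α j = β j := fun j hj => by
    by_contra hne
    exact hj ((h j).1 hne)
  have : (Finset.univ.filter fun j => α j ≠ γ j) =
      insert i (Finset.univ.filter fun j => β j ≠ γ j) := by
    ext j
    by_cases hji : j = i
    · subst hji; simp [hi]
    · simp [hji, hj j hji]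
  unfold dist
  rw [this, Finset.card_insert_of_notMem (by simp [hβi])]

theorem dist_self (α : SignVec I) : dist α α = 0 := by simp [dist]

variable (k : Type*) [Field k] {C : Set (SignVec (Ext I))}

/-- The map from the path algebra to `Ã`. -/
def ATilde.ofPath (C : Set (SignVec (Ext I))) : PathAlgebra k (quiverAdj C) →+* ATilde k C :=
  ((ATilde.mk k C : PolyPath k C →ₐ[MvPolynomial I k] ATilde k C) :
    PolyPath k C →+* ATilde k C).comp
  ((Algebra.TensorProduct.includeRight : PathAlgebra k (quiverAdj C) →ₐ[k] PolyPath k C) :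
    PathAlgebra k (quiverAdj C) →+* PolyPath k C)

section PathAlgebra

variable {V : Type*} [Fintype V] {adj : V → V → Prop}

theorem pathIdem_mul_self (a : V) :
    pathIdem k adj a * pathIdem k adj a = pathIdem k adj a := by
  unfold pathIdem
  rw [← map_mul]
  exact RingQuot.mkAlgHom_rel k (.idem_mul_self a)

theorem pathIdem_mul_of_ne {a b : V} (h : a ≠ b) : pathIdem k adj a * pathIdem k adj b = 0 := by
  unfold pathIdem
  rw [← map_mul, RingQuot.mkAlgHom_rel k (.idem_mul_of_ne a b h), map_zero]

theorem pathIdem_mul_pathArrow {a b : V} (h : adj a b) :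
    pathIdem k adj a * pathArrow k a b h = pathArrow k a b h := by
  unfold pathIdem pathArrow
  rw [← map_mul]
  exact RingQuot.mkAlgHom_rel k (.idem_mul_arrow a b h)

theorem pathArrow_mul_pathIdem {a b : V} (h : adj a b) :
    pathArrow k a b h * pathIdem k adj b = pathArrow k a b h := by
  unfold pathIdem pathArrow
  rw [← map_mul]
  exact RingQuot.mkAlgHom_rel k (.arrow_mul_idem a b h)

theorem sum_pathIdem : ∑ a, pathIdem k adj a = 1 := by
  unfold pathIdem
  rw [← map_sum, RingQuot.mkAlgHom_rel k .sum_idem, map_one]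

variable {k}

/-- Galleries grow at the front, whereas `IsPathOfLength` grows at the end. -/
theorem IsPathOfLength.cons {l : ℕ} {a b c : V} {x : PathAlgebra k adj} (h : adj a b)
    (hx : IsPathOfLength k l b c x) : IsPathOfLength k (l + 1) a c (pathArrow k a b h * x) := by
  induction hx with
  | nil b =>
    rw [pathArrow_mul_pathIdem, ← pathIdem_mul_pathArrow]
    exact .snoc h (.nil a)
  | snoc h' _ ih =>
    rw [← mul_assoc]
    exact .snoc h' (ih h)

end PathAlgebra

/-- Paths crossing each component at most once. -/
inductive IsGallery : feasible C → feasible C → PathAlgebra k (quiverAdj C) → Prop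
  | nil (a : feasible C) : IsGallery a a (pathIdem k (quiverAdj C) a)
  | cons {a b c : feasible C} {x : PathAlgebra k (quiverAdj C)} (h : quiverAdj C a b) {i : I}
      (hi : DiffersAt i (a : SignVec I) b) (hne : (a : SignVec I) i ≠ (c : SignVec I) i) :
      IsGallery b c x → IsGallery a c (pathArrow k a b h * x)

variable {k}

/-- The feasible sign vector obtained by crossing a wall. -/
def flipFeasible (hC : IsOrientedMatroid C) (a : feasible C) (i : I)
    (h : flip (a : SignVec I) i ∈ feasibleVectors C) : feasible C :=
  ⟨flip (a : SignVec I) i, (mem_feasible_iff hC).2 ⟨flip_ne_zero a.2.1 i, h⟩⟩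

theorem exists_isGallery (hC : IsOrientedMatroid C) (hL : IsCubical (feasibleVectors C)) (n : ℕ) :
    ∀ (a c : feasible C), dist (a : SignVec I) c = n →
      ∃ x, IsGallery k a c x ∧ IsPathOfLength k n a c x := by
  induction n with
  | zero =>
    intro a c hd
    have : a = c := by
      refine Subtype.ext (funext fun i => ?_)
      by_contra hi
      have : i ∈ (∅ : Finset I) := by
        rw [← Finset.card_eq_zero.1 hd]
        simpa using hi
      simp at this
    subst this
    exact ⟨_, .nil a, .nil a⟩
  | succ n ih =>
    intro a c hd
    have hne : (a : SignVec I) ≠ c := by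
      intro h
      rw [h, dist_self] at hd
      omega
    obtain ⟨i, hi, hiL⟩ := hL.exists_step a.2.1 c.2.1 ((mem_feasible_iff hC).1 a.2).2
      ((mem_feasible_iff hC).1 c.2).2 hne
    have hD : DiffersAt i (a : SignVec I) (flipFeasible hC a i hiL) := differsAt_flip a.2.1 i
    have := dist_eq_succ a.2.1 (flipFeasible hC a i hiL).2.1 c.2.1 hD hi
    obtain ⟨x, hx, hx'⟩ := ih (flipFeasible hC a i hiL) c (by omega)
    exact ⟨_, .cons ⟨i, hD⟩ hD hi hx, .cons ⟨i, hD⟩ hx'⟩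

variable (k) in
theorem ATilde.ofPath_arrow (a b : feasible C) (h : quiverAdj C a b) :
    ofPath k C (pathArrow k a b h) = ATilde.p k C a b h := rfl

variable (k) in
theorem ATilde.ofPath_idem (a : feasible C) :
    ofPath k C (pathIdem k (quiverAdj C) a) = ATilde.e k C a := rfl

theorem ATilde.square {a b c d : feasible C} (hab : a ≠ b) (hcd : c ≠ d)
    (hac : quiverAdj C a c) (hcb : quiverAdj C c b) (had : quiverAdj C a d)
    (hdb : quiverAdj C d b) :
    ATilde.p k C a c hac * ATilde.p k C c b hcb = ATilde.p k C a d had * ATilde.p k C d b hdb := by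
  have hne : ∀ {a b : feasible C}, quiverAdj C a b → a ≠ b := by
    rintro a _ ⟨i, hi⟩ rfl
    exact (hi i).2 rfl rfl
  have := RingQuot.mkAlgHom_rel (MvPolynomial I k) (ARel.square (k := k) a b c d hab (hne hac)
    (hne had) (hne hcb).symm (hne hdb).symm hcd hac hcb had hdb)
  rw [← ATilde.ofPath_arrow, ← ATilde.ofPath_arrow, ← ATilde.ofPath_arrow, ← ATilde.ofPath_arrow,
    ← map_mul, ← map_mul]
  exact this

theorem ATilde.p_mul_p {a b : feasible C} {i : I} (hi : DiffersAt i (a : SignVec I) b)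
    (hab : quiverAdj C a b) (hba : quiverAdj C b a) :
    ATilde.p k C a b hab * ATilde.p k C b a hba =
      (MvPolynomial.X i : MvPolynomial I k) • ATilde.e k C a := by
  have := RingQuot.mkAlgHom_rel (MvPolynomial I k) (ARel.loop (k := k) a b i hi hab hba)
  rw [← ATilde.ofPath_arrow, ← ATilde.ofPath_arrow, ← map_mul]
  refine Eq.trans this ?_
  unfold ATilde.e
  rw [← map_smul]
  simp only [TensorProduct.smul_tmul', smul_eq_mul, mul_one]
  rfl

theorem ATilde.e_eq_zero {a : feasible C} (h : (a : SignVec I) ∉ boundedFeasible C) :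
    ATilde.e k C a = 0 := by
  have := RingQuot.mkAlgHom_rel (MvPolynomial I k) (ARel.unbounded (k := k) a h)
  exact Eq.trans this (map_zero _)

/-- Induction on the distance settles galleries with a common first step. Different first steps are
joined by a chain of squares from `step_connected`, and each square in the chain is one defining
relation of the algebra. -/
theorem IsGallery.ofPath_eq (hC : IsOrientedMatroid C) (hL : IsCubical (feasibleVectors C))
    (n : ℕ) : ∀ {a c : feasible C} {x y : PathAlgebra k (quiverAdj C)},
      dist (a : SignVec I) c ≤ n → IsGallery k a c x → IsGallery k a c y →
      ATilde.ofPath k C x = ATilde.ofPath k C y := by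
  induction n with
  | zero =>
    intro a c x y hd hx hy
    have hac : ∀ i, (a : SignVec I) i = (c : SignVec I) i := by
      intro i
      by_contra hi
      have : i ∈ (∅ : Finset I) := by
        rw [← Finset.card_eq_zero.1 (Nat.le_zero.1 hd)]
        simpa using hi
      simp at this
    cases hx with
    | cons _ _ hne _ => exact absurd (hac _) hne
    | nil =>
      cases hy with
      | cons _ _ hne _ => exact absurd rfl hne
      | nil => rfl
  | succ n ih =>
    intro a c x y hd hx hy
    cases hx with
    | nil =>
      cases hy with
      | cons _ _ hne _ => exact absurd rfl hne
      | nil => rfl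
    | cons hab hi hia hbx =>
      rename_i b x i
      cases hy with
      | nil => exact absurd rfl hia
      | cons hab' hj hja hby =>
        rename_i b' y j
        have hL' : ∀ {b : feasible C} {i : I}, DiffersAt i (a : SignVec I) b →
            flip (a : SignVec I) i ∈ feasibleVectors C := by
          intro b i h
          rw [← h.eq_flip a.2.1 b.2.1]
          exact ((mem_feasible_iff hC).1 b.2).2
        have hconn := IsCubical.step_connected _ hL a.2.1 c.2.1 ((mem_feasible_iff hC).1 a.2).2
          ((mem_feasible_iff hC).1 c.2).2 le_rfl hia hja (hL' hi) (hL' hj)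
        have step : ∀ {b b' : feasible C} {i : I} {x y : PathAlgebra k (quiverAdj C)}
            (hab : quiverAdj C a b) (hab' : quiverAdj C a b'), DiffersAt i (a : SignVec I) b →
            DiffersAt i (a : SignVec I) b' → (a : SignVec I) i ≠ (c : SignVec I) i →
            IsGallery k b c x → IsGallery k b' c y →
            ATilde.ofPath k C (pathArrow k a b hab * x) =
              ATilde.ofPath k C (pathArrow k a b' hab' * y) := by
          intro b b' i x y hab hab' hi hj hne hx hy
          have : b = b' := Subtype.ext ((hi.eq_flip a.2.1 b.2.1).trans
            (hj.eq_flip a.2.1 b'.2.1).symm)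
          subst this
          have hd' := dist_eq_succ a.2.1 b.2.1 c.2.1 hi hne
          rw [map_mul, map_mul, ih (by omega) hx hy]
        clear hia
        induction hconn generalizing b' y with
        | refl => exact step hab hab' hi hj hja hbx hby
        | tail _ hs ih' =>
          rename_i l j _
          obtain ⟨hla, -, hlj, hlL, hjL, hljL⟩ := hs
          let bl := flipFeasible hC a l hlL
          let bj := flipFeasible hC a j hjL
          let bb := flipFeasible hC bl j hljL
          have hbl : DiffersAt l (a : SignVec I) bl := differsAt_flip a.2.1 l
          have hbj : DiffersAt j (a : SignVec I) bj := differsAt_flip a.2.1 j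
          have hbb : DiffersAt j (bl : SignVec I) bb := differsAt_flip bl.2.1 j
          have hbb' : DiffersAt l (bj : SignVec I) bb := by
            change DiffersAt l (bj : SignVec I) (flip (flip (a : SignVec I) l) j)
            rw [flip_comm _ hlj]
            exact differsAt_flip bj.2.1 l
          -- A gallery from the far corner of the square to `c` extends to galleries through both
          -- near corners; these agree by the square relation.
          obtain ⟨z, hz, -⟩ := exists_isGallery (k := k) hC hL _ bb c rfl
          have hg1 : IsGallery k bl c (pathArrow k bl bb ⟨j, hbb⟩ * z) := .cons _ hbb (by
            change flip (a : SignVec I) l j ≠ _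
            rwa [flip_of_ne _ hlj.symm]) hz
          have hg2 : IsGallery k bj c (pathArrow k bj bb ⟨l, hbb'⟩ * z) := .cons _ hbb' (by
            change flip (a : SignVec I) j l ≠ _
            rwa [flip_of_ne _ hlj]) hz
          have hab_ne : a ≠ bb := by
            intro h
            have h1 := congrArg (fun v : feasible C => (v : SignVec I) l) h
            change (a : SignVec I) l = flip (flip (a : SignVec I) l) j l at h1
            rw [flip_of_ne _ hlj] at h1
            exact (hbl l).2 rfl h1
          have hlj_ne : bl ≠ bj := by
            intro h
            have h1 := congrArg (fun v : feasible C => (v : SignVec I) l) h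
            change flip (a : SignVec I) l l = flip (a : SignVec I) j l at h1
            rw [flip_of_ne _ hlj] at h1
            exact (hbl l).2 rfl h1.symm
          refine (ih' (b' := bl) ⟨l, hbl⟩ hbl hg1 hla).trans (Eq.trans ?_
            (step ⟨j, hbj⟩ hab' hbj hj hja hg2 hby))
          rw [← mul_assoc, ← mul_assoc, map_mul, map_mul, map_mul, map_mul]
          congr 1
          exact ATilde.square hab_ne hlj_ne _ _ _ _

variable (k) in
/-- The common value in `Ã` of the galleries from `a` to `b`. -/
def ATilde.taut (a b : feasible C) : ATilde k C :=
  if h : ∃ x, IsGallery k a b x then ofPath k C h.choose else 0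

namespace ATilde

variable (hC : IsOrientedMatroid C) (hL : IsCubical (feasibleVectors C))

include hC hL

theorem ofPath_eq_taut {a b : feasible C} {x : PathAlgebra k (quiverAdj C)}
    (hx : IsGallery k a b x) : ofPath k C x = taut k a b := by
  have h : ∃ x, IsGallery k a b x := ⟨x, hx⟩
  rw [taut, dif_pos h]
  exact hx.ofPath_eq hC hL _ le_rfl h.choose_spec

theorem exists_path_taut (a b : feasible C) :
    ∃ x, IsPathOfLength k (dist (a : SignVec I) b) a b x ∧ ofPath k C x = taut k a b := by
  obtain ⟨x, hx, hx'⟩ := exists_isGallery (k := k) hC hL _ a b rfl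
  exact ⟨x, hx', ofPath_eq_taut hC hL hx⟩

theorem taut_self (a : feasible C) : taut k a a = e k C a :=
  (ofPath_eq_taut hC hL (.nil a)).symm

theorem p_mul_taut_of_ne {a b c : feasible C} (h : quiverAdj C a b) {i : I}
    (hi : DiffersAt i (a : SignVec I) b) (hne : (a : SignVec I) i ≠ (c : SignVec I) i) :
    p k C a b h * taut k b c = taut k a c := by
  obtain ⟨x, hx, -⟩ := exists_isGallery (k := k) hC hL _ b c rfl
  rw [← ofPath_eq_taut hC hL hx, ← ofPath_eq_taut hC hL (.cons h hi hne hx), map_mul]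
  rfl

theorem e_mul_taut (a b : feasible C) : e k C a * taut k a b = taut k a b := by
  obtain ⟨x, hx, -⟩ := exists_isGallery (k := k) hC hL _ a b rfl
  rw [← ofPath_eq_taut hC hL hx, ← ofPath_idem, ← map_mul]
  congr 1
  cases hx with
  | nil => exact pathIdem_mul_self k a
  | cons h _ _ _ => rw [← mul_assoc, pathIdem_mul_pathArrow]

/-- If `a` and `c` agree in the component crossed, a gallery from `b` to `c` may be chosen to begin
by crossing back. The loop relation turns the round trip into the variable of that component. -/
theorem p_mul_taut {a b c : feasible C} (h : quiverAdj C a b) :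
    p k C a b h * taut k b c =
      tMonomial k (detour (a : SignVec I) b c) • taut k a c := by
  obtain ⟨i, hi⟩ := id h
  by_cases hne : (a : SignVec I) i = (c : SignVec I) i
  · have hba : quiverAdj C b a := ⟨i, hi.symm⟩
    have hdet : detour (a : SignVec I) b c = {i} := by
      ext j
      simp only [detour, Finset.mem_filter, Finset.mem_univ, true_and, Finset.mem_singleton]
      constructor
      · rintro ⟨h1, h2⟩
        rw [← h1] at h2
        exact (hi j).1 h2
      · rintro rfl
        exact ⟨hne, by rw [← hne]; exact (hi j).2 rfl⟩
    rw [← p_mul_taut_of_ne hC hL hba hi.symm (by rw [← hne]; exact ((hi i).2 rfl).symm),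
      ← mul_assoc, p_mul_p hi, hdet, smul_mul_assoc, e_mul_taut hC hL]
    simp [tMonomial]
  · have hdet : detour (a : SignVec I) b c = ∅ := by
      ext j
      simp only [detour, Finset.mem_filter, Finset.mem_univ, true_and, Finset.notMem_empty,
        iff_false]
      rintro ⟨h1, h2⟩
      rw [← h1] at h2
      have := (hi j).1 h2
      subst this
      exact hne h1
    rw [p_mul_taut_of_ne hC hL h hi hne, hdet]
    simp [tMonomial]

/-- The first factor is peeled off one step at a time. The monomials match by the cocycle identity
`BTilde.detour_assoc`. -/
theorem taut_mul_taut (n : ℕ) : ∀ {a b c : feasible C}, dist (a : SignVec I) b = n →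
    taut k a b * taut k b c = tMonomial k (detour (a : SignVec I) b c) • taut k a c := by
  induction n with
  | zero =>
    intro a b c hd
    have : a = b := by
      refine Subtype.ext (funext fun i => ?_)
      by_contra hi
      have : i ∈ (∅ : Finset I) := by
        rw [← Finset.card_eq_zero.1 hd]
        simpa using hi
      simp at this
    subst this
    have hdet : detour (a : SignVec I) a c = ∅ := by
      ext j
      simp only [detour, Finset.mem_filter, Finset.mem_univ, true_and, Finset.notMem_empty,
        iff_false]
      rintro ⟨h1, h2⟩
      exact h2 h1.symm
    rw [taut_self hC hL, e_mul_taut hC hL, hdet]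
    simp [tMonomial]
  | succ n ih =>
    intro a b c hd
    have hne : (a : SignVec I) ≠ b := by
      intro h
      rw [h, dist_self] at hd
      omega
    obtain ⟨i, hi, hiL⟩ := hL.exists_step a.2.1 b.2.1 ((mem_feasible_iff hC).1 a.2).2
      ((mem_feasible_iff hC).1 b.2).2 hne
    let a' := flipFeasible hC a i hiL
    have hD : DiffersAt i (a : SignVec I) a' := differsAt_flip a.2.1 i
    have := dist_eq_succ a.2.1 a'.2.1 b.2.1 hD hi
    have haa : quiverAdj C a a' := ⟨i, hD⟩
    have hdet : detour (a : SignVec I) a' b = ∅ := by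
      ext j
      simp only [detour, Finset.mem_filter, Finset.mem_univ, true_and, Finset.notMem_empty,
        iff_false]
      rintro ⟨h1, h2⟩
      rw [← h1] at h2
      have := (hD j).1 h2
      subst this
      exact hi h1
    rw [← p_mul_taut_of_ne hC hL haa hD hi, mul_assoc, ih (by omega), mul_smul_comm,
      p_mul_taut hC hL, smul_smul]
    have hassoc := BTilde.detour_assoc (k := k) (a : SignVec I) a' b c a.2.1 a'.2.1 b.2.1 c.2.1
    rw [hdet] at hassoc
    simp only [tMonomial, Finset.prod_empty, mul_one] at hassoc ⊢
    rw [hassoc, mul_comm]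

/-- The span is stable under left multiplication by paths, by `e_mul_taut` and `p_mul_taut`, and it
contains 1 as the sum of the trivial paths. -/
theorem span_taut : Submodule.span (MvPolynomial I k)
    (Set.range fun q : feasible C × feasible C => taut k q.1 q.2) = ⊤ := by
  set M := Submodule.span (MvPolynomial I k)
    (Set.range fun q : feasible C × feasible C => taut k q.1 q.2) with hM
  have htaut : ∀ a b : feasible C, taut k a b ∈ M := fun a b => Submodule.subset_span ⟨(a, b), rfl⟩
  have hmul : ∀ (y : PathAlgebra k (quiverAdj C)) (m), m ∈ M → ofPath k C y * m ∈ M := by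
    intro y
    obtain ⟨w, rfl⟩ := RingQuot.mkAlgHom_surjective k (PathRel k (quiverAdj C)) y
    induction w using FreeAlgebra.induction with
    | grade0 r =>
      intro m hm
      have : ofPath k C (RingQuot.mkAlgHom k (PathRel k (quiverAdj C)) (algebraMap _ _ r)) =
          algebraMap (MvPolynomial I k) (ATilde k C) (MvPolynomial.C r) := by
        have h1 : ofPath k C (algebraMap k (PathAlgebra k (quiverAdj C)) r) =
            mk k C ((1 : MvPolynomial I k) ⊗ₜ[k] algebraMap k (PathAlgebra k (quiverAdj C)) r) := rfl
        rw [AlgHom.commutes, h1, Algebra.algebraMap_eq_smul_one, TensorProduct.tmul_smul,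
          TensorProduct.smul_tmul', MvPolynomial.smul_eq_C_mul, mul_one, ← AlgHom.commutes (mk k C)]
        rfl
      rw [this, ← Algebra.smul_def]
      exact M.smul_mem _ hm
    | grade1 q =>
      intro m hm
      induction hm using Submodule.span_induction with
      | zero => rw [mul_zero]; exact M.zero_mem
      | add _ _ _ _ h1 h2 => rw [mul_add]; exact M.add_mem h1 h2
      | smul r _ _ h => rw [mul_smul_comm]; exact M.smul_mem _ h
      | mem m hm =>
        obtain ⟨⟨b, c⟩, rfl⟩ := hm
        dsimp only
        cases q with
        | idem a =>
          change e k C a * taut k b c ∈ M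
          by_cases hab : a = b
          · subst hab
            rw [e_mul_taut hC hL]
            exact htaut _ _
          · rw [← e_mul_taut hC hL, ← mul_assoc, ← ofPath_idem, ← ofPath_idem, ← map_mul,
              pathIdem_mul_of_ne k hab, map_zero, zero_mul]
            exact M.zero_mem
        | arrow a a' h =>
          change p k C a a' h * taut k b c ∈ M
          by_cases hab : a' = b
          · subst hab
            rw [p_mul_taut hC hL]
            exact M.smul_mem _ (htaut _ _)
          · rw [← e_mul_taut hC hL, ← ofPath_arrow, ← pathArrow_mul_pathIdem, ← mul_assoc,
              ← ofPath_idem, ← map_mul, mul_assoc, pathIdem_mul_of_ne k hab, mul_zero, map_zero,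
              zero_mul]
            exact M.zero_mem
    | mul w w' h1 h2 =>
      intro m hm
      rw [map_mul, map_mul, mul_assoc]
      exact h1 _ (h2 _ hm)
    | add w w' h1 h2 =>
      intro m hm
      rw [map_add, map_add, add_mul]
      exact M.add_mem (h1 _ hm) (h2 _ hm)
  have hone : (1 : ATilde k C) ∈ M := by
    rw [← map_one (ofPath k C), ← sum_pathIdem, map_sum]
    refine M.sum_mem fun a _ => ?_
    rw [ofPath_idem, ← taut_self hC hL]
    exact htaut _ _
  refine eq_top_iff.2 fun z _ => ?_
  obtain ⟨w, rfl⟩ := RingQuot.mkAlgHom_surjective (MvPolynomial I k) (ARel k C) z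
  induction w using TensorProduct.induction_on with
  | zero => rw [map_zero]; exact M.zero_mem
  | add x y h1 h2 => rw [map_add]; exact M.add_mem (h1 trivial) (h2 trivial)
  | tmul q y =>
    have : q ⊗ₜ[k] y = q • ((1 : MvPolynomial I k) ⊗ₜ[k] y) := by
      rw [TensorProduct.smul_tmul', smul_eq_mul, mul_one]
    rw [this, map_smul]
    refine M.smul_mem _ ?_
    have := hmul y 1 hone
    rwa [mul_one] at this

omit hL in
theorem taut_eq_zero_left (hL : IsCubical (feasibleVectors C)) {a b : feasible C}
    (h : (a : SignVec I) ∉ boundedFeasible C) : taut k a b = 0 := by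
  rw [← e_mul_taut hC hL, e_eq_zero h, zero_mul]

theorem taut_eq_zero_right {a b : feasible C} (h : (b : SignVec I) ∉ boundedFeasible C) :
    taut k a b = 0 := by
  have hdet : detour (a : SignVec I) b b = ∅ := by
    ext j
    simp [detour]
  have := taut_mul_taut (k := k) hC hL _ (a := a) (b := b) (c := b) rfl
  rw [taut_self hC hL, e_eq_zero h, mul_zero, hdet] at this
  simpa [tMonomial] using this.symm

end ATilde

end Taut

/-- The linear map from a cyclic module determined by an element annihilated by the ideal. -/
def quotientSMul {S M : Type*} [CommRing S] [AddCommGroup M] [Module S M] (J : Ideal S) (m : M)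
    (h : ∀ q ∈ J, q • m = 0) : S ⧸ J →ₗ[S] M :=
  Submodule.liftQ J (LinearMap.toSpanSingleton S M m) fun q hq => h q hq

/-! ### The isomorphism between the two algebras before specialization. -/

section Isomorphism

variable {I : Type*} [Fintype I] {k : Type*} [Field k] {C : Set (SignVec (Ext I))}

omit [Fintype I] in
theorem tMonomial_mul_sdiff {S T : Finset I} (h : T ⊆ S) :
    tMonomial k S = tMonomial k (S \ T) * tMonomial k T :=
  (Finset.prod_sdiff h).symm

namespace BTilde

instance instIsScalarTower : IsScalarTower k (MvPolynomial I k) (BTilde k C) where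
  smul_assoc c p x := by
    rw [smul_eq_C_smul, MvPolynomial.smul_eq_C_mul, mul_smul]

theorem sum_apply {ι : Type*} (s : Finset ι) (f : ι → BTilde k C) (α β : boundedFeasible C) :
    (∑ i ∈ s, f i) α β = ∑ i ∈ s, f i α β := by
  induction s using Finset.induction_on with
  | empty => rfl
  | insert i s hi ih => rw [Finset.sum_insert hi, Finset.sum_insert hi, add_apply, ih]

theorem single_same (α β : boundedFeasible C)
    (x : FaceRing k C {(α : SignVec I), (β : SignVec I)}) : single k C α β x α β = x := by
  unfold single
  rw [Pi.single_eq_same, Pi.single_eq_same]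

theorem single_of_ne_left {α α' : boundedFeasible C} (h : α' ≠ α) (β β' : boundedFeasible C)
    (x : FaceRing k C {(α : SignVec I), (β : SignVec I)}) : single k C α β x α' β' = 0 := by
  unfold single
  rw [Pi.single_eq_of_ne h]
  rfl

theorem single_of_ne_right {β β' : boundedFeasible C} (h : β' ≠ β) (α α' : boundedFeasible C)
    (x : FaceRing k C {(α : SignVec I), (β : SignVec I)}) : single k C α β x α' β' = 0 := by
  by_cases hα : α' = α
  · subst hα
    unfold single
    rw [Pi.single_eq_same, Pi.single_eq_of_ne h]
  · exact single_of_ne_left hα _ _ _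

theorem single_mul_single (α β γ : boundedFeasible C)
    (x : FaceRing k C {(α : SignVec I), (β : SignVec I)})
    (y : FaceRing k C {(β : SignVec I), (γ : SignVec I)}) :
    single k C α β x * single k C β γ y = single k C α γ (FaceRing.star k C α β γ x y) := by
  funext α' γ'
  rw [mul_apply]
  by_cases hα : α' = α
  swap
  · rw [single_of_ne_left hα]
    exact Finset.sum_eq_zero fun δ _ => by rw [single_of_ne_left hα, star_zero_left]
  by_cases hγ : γ' = γ
  swap
  · rw [single_of_ne_right hγ]
    exact Finset.sum_eq_zero fun δ _ => by rw [single_of_ne_right hγ, star_zero_right]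
  subst hα hγ
  rw [Finset.sum_eq_single β]
  · rw [single_same, single_same, single_same]
  · intro δ _ hδ
    rw [single_of_ne_right hδ, star_zero_left]
  · simp

theorem single_mul_single_of_ne {β β' : boundedFeasible C} (h : β ≠ β') (α γ : boundedFeasible C)
    (x : FaceRing k C {(α : SignVec I), (β : SignVec I)})
    (y : FaceRing k C {(β' : SignVec I), (γ : SignVec I)}) :
    single k C α β x * single k C β' γ y = 0 := by
  funext α' γ'
  rw [mul_apply, zero_apply]
  refine Finset.sum_eq_zero fun δ _ => ?_
  by_cases hδ : δ = β
  · subst hδ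
    rw [single_of_ne_left h, star_zero_right]
  · rw [single_of_ne_right hδ, star_zero_left]

theorem smul_single (r : MvPolynomial I k) (α β : boundedFeasible C)
    (x : FaceRing k C {(α : SignVec I), (β : SignVec I)}) :
    r • single k C α β x = single k C α β (r • x) := by
  funext α' β'
  rw [smul_apply]
  by_cases hα : α' = α
  swap
  · rw [single_of_ne_left hα, single_of_ne_left hα, smul_zero]
  by_cases hβ : β' = β
  swap
  · rw [single_of_ne_right hβ, single_of_ne_right hβ, smul_zero]
  subst hα hβ
  rw [single_same, single_same]

theorem single_zero (α β : boundedFeasible C) : single k C α β 0 = 0 := by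
  unfold single
  rw [Pi.single_zero, Pi.single_zero]
  rfl

theorem sum_single (x : BTilde k C) : ∑ α, ∑ β, single k C α β (x α β) = x := by
  funext α β
  simp only [sum_apply]
  rw [Finset.sum_eq_single α, Finset.sum_eq_single β, single_same]
  · intro β' _ h
    exact single_of_ne_right h.symm _ _ _
  · simp
  · intro α' _ h
    exact Finset.sum_eq_zero fun β' _ => single_of_ne_left h.symm _ _ _
  · simp

theorem single_mk (α β : boundedFeasible C) (q : MvPolynomial I k) :
    single k C α β (Ideal.Quotient.mk _ q) = q • single k C α β 1 := by
  rw [smul_single, ← map_one (Ideal.Quotient.mk _), ← Ideal.Quotient.mk_eq_mk,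
    ← Ideal.Quotient.mk_eq_mk, ← Submodule.Quotient.mk_smul, smul_eq_mul, mul_one]

theorem one_eq_sum : (1 : BTilde k C) = ∑ α, single k C α α 1 := by
  funext α β
  rw [sum_apply, one_apply]
  by_cases h : α = β
  · subst h
    rw [if_pos rfl, Finset.sum_eq_single α, single_same]
    · intro γ _ h
      exact single_of_ne_left h.symm _ _ _
    · simp
  · rw [if_neg h]
    refine (Finset.sum_eq_zero fun γ _ => ?_).symm
    by_cases hγ : α = γ
    · subst hγ
      exact single_of_ne_right (Ne.symm h) _ _ _
    · exact single_of_ne_left hγ _ _ _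

variable (k C) in
/-- The unit of the component `R̃_{αβ}`, extended by zero to all pairs of sign vectors. -/
def unit (α β : SignVec I) : BTilde k C :=
  if h : α ∈ boundedFeasible C ∧ β ∈ boundedFeasible C then single k C ⟨α, h.1⟩ ⟨β, h.2⟩ 1 else 0

theorem unit_of_mem {α β : SignVec I} (hα : α ∈ boundedFeasible C) (hβ : β ∈ boundedFeasible C) :
    unit k C α β = single k C ⟨α, hα⟩ ⟨β, hβ⟩ 1 := dif_pos ⟨hα, hβ⟩

theorem unit_of_notMem_left {α β : SignVec I} (hα : α ∉ boundedFeasible C) :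
    unit k C α β = 0 := dif_neg fun h => hα h.1

theorem unit_of_notMem_right {α β : SignVec I} (hβ : β ∉ boundedFeasible C) :
    unit k C α β = 0 := dif_neg fun h => hβ h.2

theorem unit_mul_unit_of_ne {α β β' γ : SignVec I} (h : β ≠ β') :
    unit k C α β * unit k C β' γ = 0 := by
  unfold unit
  split_ifs
  · exact single_mul_single_of_ne (fun hh => h (congrArg Subtype.val hh)) _ _ _ _
  all_goals simp

theorem tMonomial_smul_single_eq_zero {α β : boundedFeasible C} {S : Finset I}
    (h : S ∉ zeroComplex C {(α : SignVec I), (β : SignVec I)}) :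
    tMonomial k S • single k C α β 1 = 0 := by
  have hmem : tMonomial k S ∈ nonfaceIdeal k C {(α : SignVec I), (β : SignVec I)} :=
    Ideal.subset_span ⟨S, h, rfl⟩
  rw [← single_mk, Ideal.Quotient.eq_zero_iff_mem.2 hmem, single_zero]

/-- The content is the case where the middle vector `β` is bounded but infeasible: the left side is
zero by convention, so the detour set must be a nonface. A common feasible face of `α` and `γ`
vanishing on it would be a face of `β`, since `β` differs from a common value of `α` and `γ` only on
the detour set; composing with `β` would then make `β` feasible. -/
theorem unit_mul_unit (hC : IsProgram C) (hgen : IsGeneric C) {α β γ : SignVec I}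
    (hβ : β ∈ feasible (dualProgram C)) :
    unit k C α β * unit k C β γ = tMonomial k (detour α β γ) • unit k C α γ := by
  by_cases hα : α ∈ boundedFeasible C
  swap
  · rw [unit_of_notMem_left hα, unit_of_notMem_left hα, zero_mul, smul_zero]
  by_cases hγ : γ ∈ boundedFeasible C
  swap
  · rw [unit_of_notMem_right hγ, unit_of_notMem_right hγ, mul_zero, smul_zero]
  rw [unit_of_mem hα hγ]
  by_cases hβ' : β ∈ boundedFeasible C
  · rw [unit_of_mem hα hβ', unit_of_mem hβ' hγ, single_mul_single, ← single_mk]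
    have h1 : (1 : FaceRing k C {α, β}) = Ideal.Quotient.mk _ 1 := (map_one _).symm
    have h2 : (1 : FaceRing k C {β, γ}) = Ideal.Quotient.mk _ 1 := (map_one _).symm
    rw [h1, h2, star_mk, mul_one, mul_one]
  · rw [unit_of_notMem_left hβ', mul_zero, tMonomial_smul_single_eq_zero]
    intro hdet
    obtain ⟨y, hy, hyA, hyS⟩ := (exists_mem_commonFaces_iff hC.isOrientedMatroid).1 hdet
    rw [mem_feasible_iff hC.isOrientedMatroid.dualProgram] at hβ
    refine hβ' ((mem_boundedFeasible_iff hC hgen).2 ⟨hβ.1, ?_, hβ.2⟩)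
    have := hgen.comp_mem hC hy β
    convert this using 1
    funext i
    rw [comp_apply]
    split_ifs with h
    · have h1 := hyA α (by simp) i h
      have h2 := hyA γ (by simp) i h
      by_contra hne
      refine h (hyS i ?_)
      simp only [detour, Finset.mem_filter, Finset.mem_univ, true_and]
      exact ⟨h1.symm.trans h2, fun h3 => hne (by rw [h2, h3])⟩
    · rfl

theorem detour_self_left (α β : SignVec I) : detour α α β = ∅ := by
  ext j
  simp only [detour, Finset.mem_filter, Finset.mem_univ, true_and, Finset.notMem_empty, iff_false]
  rintro ⟨h1, h2⟩
  exact h2 h1.symm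

theorem detour_self_right (α β : SignVec I) : detour α β β = ∅ := by
  ext j
  simp [detour]

end BTilde

variable (hC : IsProgram C) (hgen : IsGeneric C)

include hC hgen in
theorem mem_feasible_dualProgram_of_mem {α : SignVec I} (h : α ∈ boundedFeasible C) :
    α ∈ feasible (dualProgram C) := by
  rw [mem_feasible_iff hC.isOrientedMatroid.dualProgram]
  exact ⟨((mem_boundedFeasible_iff hC hgen).1 h).1, ((mem_boundedFeasible_iff hC hgen).1 h).2.2⟩

/-- Bounded feasible sign vectors as vertices of the quiver of the dual program. -/
def dualVertex (α : boundedFeasible C) : feasible (dualProgram C) :=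
  ⟨α, mem_feasible_dualProgram_of_mem hC hgen α.2⟩

include hC hgen in
theorem sum_unit : ∑ a : feasible (dualProgram C), BTilde.unit k C (a : SignVec I) a = 1 := by
  rw [BTilde.one_eq_sum]
  refine (Finset.sum_of_injOn (dualVertex hC hgen) ?_ ?_ ?_ ?_).symm
  · intro α _ β _ h
    exact Subtype.ext (congrArg (fun v : feasible (dualProgram C) => (v : SignVec I)) h)
  · intro α _
    simp
  · intro a _ ha
    refine BTilde.unit_of_notMem_left fun h => ha ?_
    exact ⟨⟨a, h⟩, by simp, rfl⟩
  · intro α _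
    exact (BTilde.unit_of_mem α.2 α.2).symm

/-- The images of the generators of the path algebra in `B̃`. -/
def toBTildeGen (k : Type*) [Field k] (C : Set (SignVec (Ext I))) :
    PathGen (quiverAdj (dualProgram C)) → BTilde k C
  | .idem a => BTilde.unit k C a a
  | .arrow a b _ => BTilde.unit k C a b

/-- The map from the path algebra to `B̃`. -/
def toBTildePath : PathAlgebra k (quiverAdj (dualProgram C)) →ₐ[k] BTilde k C :=
  RingQuot.liftAlgHom k ⟨FreeAlgebra.lift k (toBTildeGen k C), by
    intro x y h
    induction h with
    | idem_mul_self a =>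
      simp only [map_mul, FreeAlgebra.lift_ι_apply, toBTildeGen]
      rw [BTilde.unit_mul_unit hC hgen a.2, BTilde.detour_self_left]
      simp [tMonomial]
    | idem_mul_of_ne a b hab =>
      simp only [map_mul, FreeAlgebra.lift_ι_apply, toBTildeGen, map_zero]
      exact BTilde.unit_mul_unit_of_ne fun h => hab (Subtype.ext h)
    | idem_mul_arrow a b h =>
      simp only [map_mul, FreeAlgebra.lift_ι_apply, toBTildeGen]
      rw [BTilde.unit_mul_unit hC hgen a.2, BTilde.detour_self_left]
      simp [tMonomial]
    | arrow_mul_idem a b h =>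
      simp only [map_mul, FreeAlgebra.lift_ι_apply, toBTildeGen]
      rw [BTilde.unit_mul_unit hC hgen b.2, BTilde.detour_self_right]
      simp [tMonomial]
    | sum_idem =>
      simp only [map_sum, FreeAlgebra.lift_ι_apply, toBTildeGen, map_one]
      exact sum_unit hC hgen⟩

theorem toBTildePath_idem (a : feasible (dualProgram C)) :
    toBTildePath hC hgen (pathIdem k (quiverAdj (dualProgram C)) a) = BTilde.unit k C a a := by
  unfold toBTildePath pathIdem
  rw [RingQuot.liftAlgHom_mkAlgHom_apply, FreeAlgebra.lift_ι_apply]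
  rfl

theorem toBTildePath_arrow {a b : feasible (dualProgram C)} (h : quiverAdj (dualProgram C) a b) :
    toBTildePath hC hgen (pathArrow k a b h) = BTilde.unit k C a b := by
  unfold toBTildePath pathArrow
  rw [RingQuot.liftAlgHom_mkAlgHom_apply, FreeAlgebra.lift_ι_apply]
  rfl

/-- The map from `Sym ⊗ P(Q)` to `B̃`. -/
def toBTildePoly : PolyPath k (dualProgram C) →ₐ[MvPolynomial I k] BTilde k C :=
  Algebra.TensorProduct.lift (Algebra.ofId (MvPolynomial I k) (BTilde k C)) (toBTildePath hC hgen)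
    fun r _ => Algebra.commutes r _

theorem toBTildePoly_tmul (q : MvPolynomial I k)
    (y : PathAlgebra k (quiverAdj (dualProgram C))) :
    toBTildePoly (k := k) hC hgen (q ⊗ₜ y) = q • toBTildePath hC hgen y :=
  (Algebra.TensorProduct.lift_tmul _ _ _ q y).trans (Algebra.smul_def _ _).symm

theorem detour_of_differsAt {α β : SignVec I} {i : I} (h : DiffersAt i α β) :
    detour α β α = {i} := by
  ext j
  simp only [detour, Finset.mem_filter, Finset.mem_univ, true_and, Finset.mem_singleton]
  exact h j

/-- The two steps cross different components, so nothing is crossed twice; both sides of a square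
relation therefore map to the same unit. -/
theorem detour_of_adjacent {α β γ : SignVec I} (hα : ∀ i, α i ≠ 0) (hβ : ∀ i, β i ≠ 0)
    (hγ : ∀ i, γ i ≠ 0) (hne : α ≠ β) (h₁ : Adjacent α γ)
    (h₂ : Adjacent γ β) : detour α γ β = ∅ := by
  obtain ⟨i, hi⟩ := h₁
  obtain ⟨j, hj⟩ := h₂
  have hij : i ≠ j := by
    rintro rfl
    exact hne ((hi.symm.eq_flip hγ hα).trans (hj.eq_flip hγ hβ).symm)
  ext a
  simp only [detour, Finset.mem_filter, Finset.mem_univ, true_and, Finset.notMem_empty, iff_false]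
  rintro ⟨h1, h2⟩
  have ha : a = j := (hj a).1 (Ne.symm h2)
  have ha' : a = i := (hi a).1 (by rw [h1]; exact h2)
  exact hij (ha'.symm.trans ha)

/-- The homomorphism from `Ã` of the dual program to `B̃`. -/
def toBTilde : ATilde k (dualProgram C) →ₐ[MvPolynomial I k] BTilde k C :=
  RingQuot.liftAlgHom (MvPolynomial I k) ⟨toBTildePoly hC hgen, by
    intro x y h
    induction h with
    | unbounded a ha =>
      rw [toBTildePoly_tmul, toBTildePath_idem, map_zero, one_smul]
      rw [boundedFeasible_dualProgram hC hgen] at ha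
      exact BTilde.unit_of_notMem_left ha
    | square a b c d hab _ _ _ _ _ hac hcb had hdb =>
      have hab' : (a : SignVec I) ≠ b := fun h => hab (Subtype.ext h)
      rw [toBTildePoly_tmul, toBTildePoly_tmul, map_mul, map_mul, toBTildePath_arrow,
        toBTildePath_arrow, toBTildePath_arrow, toBTildePath_arrow,
        BTilde.unit_mul_unit hC hgen c.2, BTilde.unit_mul_unit hC hgen d.2,
        detour_of_adjacent a.2.1 b.2.1 c.2.1 hab' hac hcb,
        detour_of_adjacent a.2.1 b.2.1 d.2.1 hab' had hdb]
    | loop a b i hi hab hba =>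
      rw [toBTildePoly_tmul, toBTildePoly_tmul, map_mul, toBTildePath_arrow, toBTildePath_arrow,
        toBTildePath_idem, BTilde.unit_mul_unit hC hgen b.2, detour_of_differsAt hi, one_smul]
      simp [tMonomial]⟩

theorem toBTilde_mk (q : MvPolynomial I k) (y : PathAlgebra k (quiverAdj (dualProgram C))) :
    toBTilde (k := k) hC hgen (ATilde.mk k (dualProgram C) (q ⊗ₜ y)) = q • toBTildePath hC hgen y := by
  unfold toBTilde ATilde.mk
  rw [RingQuot.liftAlgHom_mkAlgHom_apply, toBTildePoly_tmul]

theorem toBTilde_ofPath (y : PathAlgebra k (quiverAdj (dualProgram C))) :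
    toBTilde hC hgen (ATilde.ofPath k (dualProgram C) y) = toBTildePath hC hgen y :=
  (toBTilde_mk hC hgen 1 y).trans (one_smul _ _)

theorem toBTildePath_of_isGallery {a b : feasible (dualProgram C)}
    {x : PathAlgebra k (quiverAdj (dualProgram C))} (hx : IsGallery k a b x) :
    toBTildePath hC hgen x = BTilde.unit k C a b := by
  induction hx with
  | nil a => exact toBTildePath_idem hC hgen a
  | cons h hi hne _ ih =>
    rename_i a b c x i _
    rw [map_mul, ih, toBTildePath_arrow, BTilde.unit_mul_unit hC hgen b.2]
    have : detour (a : SignVec I) b c = ∅ := by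
      ext j
      simp only [detour, Finset.mem_filter, Finset.mem_univ, true_and, Finset.notMem_empty,
        iff_false]
      rintro ⟨h1, h2⟩
      rw [← h1] at h2
      have := (hi j).1 h2
      subst this
      exact hne h1
    rw [this]
    simp [tMonomial]

theorem toBTilde_taut (a b : feasible (dualProgram C)) :
    toBTilde hC hgen (ATilde.taut k a b) = BTilde.unit k C a b := by
  obtain ⟨x, hx, -⟩ := exists_isGallery (k := k) hC.isOrientedMatroid.dualProgram
    (hgen.isCubical_dual hC) _ a b rfl
  rw [← ATilde.ofPath_eq_taut hC.isOrientedMatroid.dualProgram (hgen.isCubical_dual hC) hx,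
    toBTilde_ofPath, toBTildePath_of_isGallery hC hgen hx]

-- This makes the inverse map well defined on face rings. Routing through a bounded infeasible `γ`
-- gives zero, and equals the detour monomial times the taut element. A detour component is one
-- where `α` and `β` agree and `γ` does not, which happens only inside `S`.
include hC hgen in
theorem tMonomial_smul_taut {α β : boundedFeasible C} {S : Finset I}
    (hS : S ∉ zeroComplex C {(α : SignVec I), (β : SignVec I)}) :
    tMonomial k S • ATilde.taut k (dualVertex hC hgen α) (dualVertex hC hgen β) = 0 := by
  have hO := hC.isOrientedMatroid
  obtain ⟨γ, hγ, hγd, hγf, hγS⟩ := exists_bounded_infeasible hC (α := α) α.2.1.1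
    ((mem_boundedFeasible_iff hC hgen).1 α.2).2.2
    (S ∪ Finset.univ.filter fun i => (α : SignVec I) i ≠ (β : SignVec I) i) (by
      intro y hy hyα
      by_contra hcon
      push Not at hcon
      refine hS ((exists_mem_commonFaces_iff hO).2 ⟨y, hy, ?_, fun i hi => hcon i (by simp [hi])⟩)
      intro δ hδ i hi
      rcases hδ with rfl | hδ
      · exact hyα i hi
      · rw [Set.mem_singleton_iff] at hδ
        subst hδ
        rw [hyα i hi]
        by_contra hne
        exact hi (hcon i (by simp [hne])))
  let c : feasible (dualProgram C) := ⟨γ, (mem_feasible_iff hO.dualProgram).2 ⟨hγ, hγd⟩⟩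
  have hc : (c : SignVec I) ∉ boundedFeasible (dualProgram C) := by
    rw [boundedFeasible_dualProgram hC hgen, mem_boundedFeasible_iff hC hgen]
    exact fun h => hγf h.2.1
  have hL := hgen.isCubical_dual hC
  have hmul := ATilde.taut_mul_taut (k := k) hO.dualProgram hL _ (a := dualVertex hC hgen α)
    (b := c) (c := dualVertex hC hgen β) rfl
  rw [ATilde.taut_eq_zero_right hO.dualProgram hL hc, zero_mul] at hmul
  have hsub : detour (dualVertex hC hgen α : SignVec I) c (dualVertex hC hgen β) ⊆ S := by
    intro i hi
    simp only [detour, Finset.mem_filter, Finset.mem_univ, true_and] at hi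
    obtain ⟨h1, h2⟩ := hi
    by_contra hiS
    change (α : SignVec I) i = (β : SignVec I) i at h1
    have := hγS i (by simp [hiS, h1])
    change (β : SignVec I) i ≠ γ i at h2
    exact h2 (by rw [this, h1])
  rw [tMonomial_mul_sdiff hsub, mul_smul, ← hmul, smul_zero]

theorem smul_taut_of_mem_nonfaceIdeal (α β : boundedFeasible C) {q : MvPolynomial I k}
    (hq : q ∈ nonfaceIdeal k C {(α : SignVec I), (β : SignVec I)}) :
    q • ATilde.taut k (dualVertex hC hgen α) (dualVertex hC hgen β) = 0 := by
  induction hq using Submodule.span_induction with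
  | zero => rw [zero_smul]
  | add x y _ _ h1 h2 => rw [add_smul, h1, h2, add_zero]
  | smul r x _ h => rw [smul_eq_mul, mul_smul, h, smul_zero]
  | mem x hx =>
    obtain ⟨S, hS, rfl⟩ := hx
    exact tMonomial_smul_taut hC hgen hS

/-- The component at `(α, β)` of the inverse of `toBTilde`. -/
def ofFaceRing (α β : boundedFeasible C) :
    FaceRing k C {(α : SignVec I), (β : SignVec I)} →ₗ[MvPolynomial I k]
      ATilde k (dualProgram C) :=
  quotientSMul _ (ATilde.taut k (dualVertex hC hgen α) (dualVertex hC hgen β))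
    fun _ hq => smul_taut_of_mem_nonfaceIdeal hC hgen α β hq

theorem ofFaceRing_mk (α β : boundedFeasible C) (q : MvPolynomial I k) :
    ofFaceRing hC hgen α β (Ideal.Quotient.mk _ q) =
      q • ATilde.taut k (dualVertex hC hgen α) (dualVertex hC hgen β) := rfl

/-- The inverse of `toBTilde`. -/
def ofBTilde (x : BTilde k C) : ATilde k (dualProgram C) :=
  ∑ α, ∑ β, ofFaceRing hC hgen α β (x α β)

theorem ofBTilde_add (x y : BTilde k C) :
    ofBTilde hC hgen (x + y) = ofBTilde hC hgen x + ofBTilde hC hgen y := by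
  simp only [ofBTilde, BTilde.add_apply, map_add, Finset.sum_add_distrib]

theorem ofBTilde_smul (r : MvPolynomial I k) (x : BTilde k C) :
    ofBTilde hC hgen (r • x) = r • ofBTilde hC hgen x := by
  simp only [ofBTilde, BTilde.smul_apply, map_smul, Finset.smul_sum]

theorem ofBTilde_zero : ofBTilde hC hgen (0 : BTilde k C) = 0 := by
  simp only [ofBTilde, BTilde.zero_apply, map_zero, Finset.sum_const_zero]

theorem ofBTilde_single (α β : boundedFeasible C) :
    ofBTilde hC hgen (BTilde.single k C α β 1) =
      ATilde.taut k (dualVertex hC hgen α) (dualVertex hC hgen β) := by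
  unfold ofBTilde
  rw [Finset.sum_eq_single α, Finset.sum_eq_single β, BTilde.single_same,
    ← map_one (Ideal.Quotient.mk _), ofFaceRing_mk, one_smul]
  · intro β' _ h
    rw [BTilde.single_of_ne_right h, map_zero]
  · simp
  · intro α' _ h
    exact Finset.sum_eq_zero fun β' _ => by rw [BTilde.single_of_ne_left h, map_zero]
  · simp

/-- Both maps respect the polynomial action, so it is enough to check taut elements; those with an
endpoint outside the bounded feasible vectors vanish on both sides. -/
theorem ofBTilde_toBTilde (z : ATilde k (dualProgram C)) :
    ofBTilde hC hgen (toBTilde hC hgen z) = z := by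
  have hO := hC.isOrientedMatroid.dualProgram
  have hL := hgen.isCubical_dual hC
  have hz : z ∈ Submodule.span (MvPolynomial I k) (Set.range
      fun q : feasible (dualProgram C) × feasible (dualProgram C) => ATilde.taut k q.1 q.2) := by
    rw [ATilde.span_taut hO hL]
    trivial
  induction hz using Submodule.span_induction with
  | zero => rw [map_zero, ofBTilde_zero]
  | add x y _ _ h1 h2 => rw [map_add, ofBTilde_add, h1, h2]
  | smul r x _ h => rw [map_smul, ofBTilde_smul, h]
  | mem x hx =>
    obtain ⟨⟨a, b⟩, rfl⟩ := hx
    dsimp only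
    rw [toBTilde_taut]
    by_cases ha : (a : SignVec I) ∈ boundedFeasible C
    swap
    · rw [BTilde.unit_of_notMem_left ha, ofBTilde_zero, ATilde.taut_eq_zero_left hO hL]
      rwa [boundedFeasible_dualProgram hC hgen]
    by_cases hb : (b : SignVec I) ∈ boundedFeasible C
    swap
    · rw [BTilde.unit_of_notMem_right hb, ofBTilde_zero, ATilde.taut_eq_zero_right hO hL]
      rwa [boundedFeasible_dualProgram hC hgen]
    rw [BTilde.unit_of_mem ha hb, ofBTilde_single]
    rfl

theorem toBTilde_bijective :
    Function.Bijective (toBTilde (k := k) hC hgen) := by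
  refine ⟨Function.LeftInverse.injective (ofBTilde_toBTilde hC hgen), fun x => ?_⟩
  have : ∀ α β : boundedFeasible C, ∃ z, toBTilde (k := k) hC hgen z =
      BTilde.single k C α β (x α β) := by
    intro α β
    obtain ⟨q, hq⟩ := Ideal.Quotient.mk_surjective (x α β)
    refine ⟨q • ATilde.taut k (dualVertex hC hgen α) (dualVertex hC hgen β), ?_⟩
    rw [map_smul, toBTilde_taut, ← hq, BTilde.single_mk]
    exact congrArg _ (BTilde.unit_of_mem α.2 β.2)
  choose z hz using this
  refine ⟨∑ α, ∑ β, z α β, ?_⟩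
  simp only [map_sum, hz]
  exact BTilde.sum_single x

/-- The isomorphism from `Ã` of the dual program to `B̃`. -/
def equivBTilde : ATilde k (dualProgram C) ≃ₐ[MvPolynomial I k] BTilde k C :=
  AlgEquiv.ofBijective (toBTilde hC hgen) (toBTilde_bijective hC hgen)

theorem equivBTilde_apply (z : ATilde k (dualProgram C)) :
    equivBTilde hC hgen z = toBTilde hC hgen z := rfl

end Isomorphism

/-! ### Gradings obtained from projections, and their images. -/

section GradedAlgebra

variable {k A A' : Type*} [Field k] [Ring A] [Algebra k A] [Ring A'] [Algebra k A']

/-- The map induced on the image of a surjective homomorphism. -/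
def descend {G H K : Type*} [AddCommGroup G] [AddCommGroup H] [AddCommGroup K] (f : G →+ H)
    (hf : Function.Surjective f) (g : G →+ K) (h : ∀ x, f x = 0 → g x = 0) : H →+ K :=
  f.liftOfSurjective hf ⟨g, fun x hx => h x hx⟩

theorem descend_apply {G H K : Type*} [AddCommGroup G] [AddCommGroup H] [AddCommGroup K]
    {f : G →+ H} (hf : Function.Surjective f) {g : G →+ K} (h : ∀ x, f x = 0 → g x = 0) (x : G) :
    descend f hf g h (f x) = g x :=
  f.liftOfRightInverse_comp_apply _ _ _ _

/-- The maps `π` force independence of the pieces: each is the identity on its own piece and kills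
the others. Additivity is all that is needed of them. -/
theorem nonempty_gradedAlgebra {𝒜 : ℕ → Submodule k A} (h1 : (1 : A) ∈ 𝒜 0)
    (hmul : ∀ i j x y, x ∈ 𝒜 i → y ∈ 𝒜 j → x * y ∈ 𝒜 (i + j)) (π : ℕ → A →+ A)
    (hπ : ∀ m x, x ∈ 𝒜 m → π m x = x) (hπ0 : ∀ m n x, m ≠ n → x ∈ 𝒜 m → π n x = 0)
    (htop : ⨆ m, 𝒜 m = ⊤) : Nonempty (GradedAlgebra 𝒜) := by
  have hint : DirectSum.IsInternal 𝒜 := by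
    rw [DirectSum.isInternal_submodule_iff_iSupIndep_and_iSup_eq_top]
    refine ⟨fun n => ?_, htop⟩
    rw [Submodule.disjoint_def]
    intro x hx hx'
    rw [← hπ n x hx]
    rw [iSup_subtype'] at hx'
    clear hx
    induction hx' using Submodule.iSup_induction' with
    | mem m y hy => exact hπ0 m n y m.2 hy
    | zero => exact map_zero _
    | add y z _ _ hy hz => rw [map_add, hy, hz, add_zero]
  have : SetLike.GradedMonoid 𝒜 := { one_mem := h1, mul_mem := fun {i j x y} => hmul i j x y }
  exact ⟨{ hint.chooseDecomposition with }⟩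

/-- A kernel stable under taking homogeneous components lets the projections descend to the
quotient. -/
theorem nonempty_gradedAlgebra_of_surjective (𝒜 : ℕ → Submodule k A) [GradedAlgebra 𝒜]
    {𝒜' : ℕ → Submodule k A'} (f : A →+* A') (hf : Function.Surjective f)
    (h : ∀ m y, y ∈ 𝒜' m ↔ ∃ x ∈ 𝒜 m, f x = y)
    (hker : ∀ x, f x = 0 → ∀ m, f (GradedAlgebra.proj 𝒜 m x) = 0) :
    Nonempty (GradedAlgebra 𝒜') := by
  refine nonempty_gradedAlgebra ((h 0 1).2 ⟨1, SetLike.GradedOne.one_mem, map_one f⟩) ?_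
    (fun m => descend f.toAddMonoidHom hf
      (f.toAddMonoidHom.comp (GradedAlgebra.proj 𝒜 m).toAddMonoidHom) fun x hx => hker x hx m)
    ?_ ?_ ?_
  · intro i j x y hx hy
    obtain ⟨x, hx', rfl⟩ := (h i x).1 hx
    obtain ⟨y, hy', rfl⟩ := (h j y).1 hy
    exact (h _ _).2 ⟨x * y, SetLike.GradedMul.mul_mem hx' hy', map_mul f x y⟩
  · intro m x hx
    obtain ⟨x, hx', rfl⟩ := (h m x).1 hx
    refine (descend_apply (f := f.toAddMonoidHom) hf _ x).trans ?_
    change f (GradedAlgebra.proj 𝒜 m x) = f x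
    rw [GradedAlgebra.proj_apply, DirectSum.decompose_of_mem_same 𝒜 hx']
  · intro m n x hmn hx
    obtain ⟨x, hx', rfl⟩ := (h m x).1 hx
    refine (descend_apply (f := f.toAddMonoidHom) hf _ x).trans ?_
    change f (GradedAlgebra.proj 𝒜 n x) = 0
    rw [GradedAlgebra.proj_apply, DirectSum.decompose_of_mem_ne 𝒜 hx' hmn, map_zero]
  · rw [eq_top_iff]
    intro y _
    obtain ⟨x, rfl⟩ := hf y
    induction x using DirectSum.Decomposition.inductionOn 𝒜 with
    | zero => rw [map_zero]; exact zero_mem _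
    | homogeneous x => exact Submodule.mem_iSup_of_mem _ ((h _ _).2 ⟨x, x.2, rfl⟩)
    | add x y hx hy =>
      rw [map_add]
      exact add_mem (hx trivial) (hy trivial)

end GradedAlgebra

/-! ### Homogeneous components of face rings. -/

section FaceRing

variable {I : Type*} {k : Type*} [Field k] {C : Set (SignVec (Ext I))}

theorem homogeneousComponent_mem_nonfaceIdeal {A : Set (SignVec I)} {p : MvPolynomial I k}
    (hp : p ∈ nonfaceIdeal k C A) (n : ℕ) :
    MvPolynomial.homogeneousComponent n p ∈ nonfaceIdeal k C A := by
  let := MvPolynomial.gradedAlgebra (σ := I) (R := k)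
  refine MvPolynomial.homogeneousComponent_mem_of_mem ?_ hp n
  refine Ideal.homogeneous_span _ _ ?_
  rintro _ ⟨S, _, rfl⟩
  exact ⟨∑ i ∈ S, 1, MvPolynomial.IsHomogeneous.prod _ _ _ fun i _ => MvPolynomial.isHomogeneous_X k i⟩

/-- The homogeneous component of a face ring for the grading with variables of degree one. -/
def FaceRing.component (A : Set (SignVec I)) (n : ℕ) : FaceRing k C A →+ FaceRing k C A :=
  descend (Ideal.Quotient.mk (nonfaceIdeal k C A)).toAddMonoidHom Ideal.Quotient.mk_surjective
    ((Ideal.Quotient.mk (nonfaceIdeal k C A)).toAddMonoidHom.comp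
      (MvPolynomial.homogeneousComponent n).toAddMonoidHom) fun _ hp =>
    Ideal.Quotient.eq_zero_iff_mem.2
      (homogeneousComponent_mem_nonfaceIdeal (Ideal.Quotient.eq_zero_iff_mem.1 hp) n)

theorem FaceRing.component_mk (A : Set (SignVec I)) (n : ℕ) (p : MvPolynomial I k) :
    FaceRing.component (C := C) A n (Ideal.Quotient.mk _ p) =
      Ideal.Quotient.mk _ (MvPolynomial.homogeneousComponent n p) :=
  descend_apply (f := (Ideal.Quotient.mk (nonfaceIdeal k C A)).toAddMonoidHom)
    Ideal.Quotient.mk_surjective _ p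

theorem FaceRing.component_monomial (A : Set (SignVec I)) (n : ℕ) (c : I →₀ ℕ) (a : k) :
    FaceRing.component (C := C) A n (Ideal.Quotient.mk _ (MvPolynomial.monomial c a)) =
      if c.degree = n then Ideal.Quotient.mk _ (MvPolynomial.monomial c a) else 0 := by
  rw [component_mk, MvPolynomial.homogeneousComponent_of_mem
    (MvPolynomial.isHomogeneous_monomial a rfl)]
  by_cases h : c.degree = n
  · rw [if_pos h, if_pos h.symm]
  · rw [if_neg h, if_neg (Ne.symm h), map_zero]

theorem tMonomial_eq_monomial (S : Finset I) :
    tMonomial k S = MvPolynomial.monomial (∑ i ∈ S, Finsupp.single i 1) 1 := by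
  unfold tMonomial
  induction S using Finset.induction_on with
  | empty => simp
  | insert i S hi ih =>
    rw [Finset.prod_insert hi, Finset.sum_insert hi, ih, MvPolynomial.X, MvPolynomial.monomial_mul,
      one_mul]

theorem degree_sum_single (S : Finset I) :
    (∑ i ∈ S, Finsupp.single i 1 : I →₀ ℕ).degree = S.card := by
  rw [map_sum]
  simp [Finsupp.degree_single]

/-- Degree count for the twisted product. A detour component is crossed twice on the way through `β`
and not at all directly, which the degree two of its variable makes up for; every other component
contributes equally to both sides. -/
theorem dist_add_dist [Fintype I] {α β γ : SignVec I} (hα : ∀ i, α i ≠ 0) (hβ : ∀ i, β i ≠ 0)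
    (hγ : ∀ i, γ i ≠ 0) : dist α β + dist β γ = dist α γ + 2 * (detour α β γ).card := by
  simp only [dist, detour, Finset.card_filter, Finset.mul_sum, ← Finset.sum_add_distrib]
  refine Finset.sum_congr rfl fun i _ => ?_
  have h1 := hα i
  have h2 := hβ i
  have h3 := hγ i
  generalize α i = a at *
  generalize β i = b at *
  generalize γ i = c at *
  cases a <;> cases b <;> cases c <;> simp_all

end FaceRing

/-! ### The gradings of the algebras before specialization. -/

section Grading

variable {I : Type*} [Fintype I] {k : Type*} [Field k] {C : Set (SignVec (Ext I))}

namespace BTilde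

theorem monomial_smul_mem_grade {m : ℕ} {x : BTilde k C} (hx : x ∈ grade k C m) (c : I →₀ ℕ)
    {n : ℕ} (hn : 2 * c.degree + m = n) : MvPolynomial.monomial c (1 : k) • x ∈ grade k C n := by
  induction hx using Submodule.span_induction with
  | zero => rw [smul_zero]; exact zero_mem _
  | add x y _ _ h1 h2 => rw [smul_add]; exact add_mem h1 h2
  | smul a x _ h => rw [smul_comm]; exact Submodule.smul_mem _ a h
  | mem x hx =>
    obtain ⟨α, β, d, hd, rfl⟩ := hx
    refine Submodule.subset_span ⟨α, β, c + d, by rw [map_add]; omega, ?_⟩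
    rw [single_mk, single_mk, ← mul_smul, MvPolynomial.monomial_mul, one_mul]

theorem unit_mem_grade (α β : SignVec I) : unit k C α β ∈ grade k C (dist α β) := by
  unfold unit
  split_ifs with h
  · refine Submodule.subset_span ⟨⟨α, h.1⟩, ⟨β, h.2⟩, 0, by simp, ?_⟩
    rw [single_mk, MvPolynomial.monomial_zero', map_one, one_smul]
  · exact zero_mem _

theorem one_mem_grade : (1 : BTilde k C) ∈ grade k C 0 := by
  rw [one_eq_sum]
  refine sum_mem fun α _ => ?_
  have := unit_mem_grade (k := k) (C := C) α α
  rwa [dist_self, unit_of_mem α.2 α.2] at this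

theorem mul_mem_grade {i j : ℕ} {x y : BTilde k C} (hx : x ∈ grade k C i) (hy : y ∈ grade k C j) :
    x * y ∈ grade k C (i + j) := by
  induction hx using Submodule.span_induction with
  | zero => rw [zero_mul]; exact zero_mem _
  | add x y _ _ h1 h2 => rw [add_mul]; exact add_mem h1 h2
  | smul a x _ h => rw [smul_mul_assoc]; exact Submodule.smul_mem _ a h
  | mem x hx =>
    obtain ⟨α, β, c, hc, rfl⟩ := hx
    induction hy using Submodule.span_induction with
    | zero => rw [mul_zero]; exact zero_mem _
    | add x y _ _ h1 h2 => rw [mul_add]; exact add_mem h1 h2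
    | smul a x _ h => rw [mul_smul_comm]; exact Submodule.smul_mem _ a h
    | mem y hy =>
      obtain ⟨β', γ, d, hd, rfl⟩ := hy
      by_cases hβ : β = β'
      · subst hβ
        rw [single_mul_single, star_mk, tMonomial_eq_monomial, MvPolynomial.monomial_mul,
          MvPolynomial.monomial_mul, one_mul, one_mul]
        refine Submodule.subset_span ⟨α, γ, _, ?_, rfl⟩
        rw [map_add, map_add, degree_sum_single]
        have := dist_add_dist (α := (α : SignVec I)) (β := (β : SignVec I)) (γ := (γ : SignVec I)) α.2.1.1 β.2.1.1 γ.2.1.1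
        omega
      · rw [single_mul_single_of_ne hβ]
        exact zero_mem _

theorem iSup_grade : ⨆ m, grade k C m = ⊤ := by
  rw [eq_top_iff]
  intro x _
  rw [← sum_single x]
  refine sum_mem fun α _ => sum_mem fun β _ => ?_
  obtain ⟨q, hq⟩ := Ideal.Quotient.mk_surjective (x α β)
  rw [← hq, single_mk]
  clear hq
  induction q using MvPolynomial.induction_on' with
  | add p q hp hq =>
    rw [add_smul]
    exact add_mem hp hq
  | monomial c a =>
    have : MvPolynomial.monomial c a = a • MvPolynomial.monomial c (1 : k) := by
      rw [MvPolynomial.smul_monomial, smul_eq_mul, mul_one]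
    rw [this, smul_assoc]
    refine Submodule.smul_mem _ a (Submodule.mem_iSup_of_mem
      (2 * c.degree + dist (α : SignVec I) β) (Submodule.subset_span ⟨α, β, c, rfl, ?_⟩))
    rw [single_mk]

/-- The map underlying `BTilde.component`. -/
def componentFun (m : ℕ) (x : BTilde k C) : BTilde k C := fun α β =>
  if dist (α : SignVec I) β ≤ m ∧ 2 ∣ m - dist (α : SignVec I) β then
    FaceRing.component _ ((m - dist (α : SignVec I) β) / 2) (x α β) else 0

theorem componentFun_apply (m : ℕ) (x : BTilde k C) (α β : boundedFeasible C) :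
    componentFun m x α β = if dist (α : SignVec I) β ≤ m ∧ 2 ∣ m - dist (α : SignVec I) β then
      FaceRing.component _ ((m - dist (α : SignVec I) β) / 2) (x α β) else 0 := rfl

/-- The homogeneous component of degree `m`. -/
def component (m : ℕ) : BTilde k C →+ BTilde k C :=
  AddMonoidHom.mk' (componentFun m) fun x y => by
    funext α β
    rw [add_apply, componentFun_apply, componentFun_apply, componentFun_apply, add_apply, map_add]
    split_ifs
    · rfl
    · rw [add_zero]

theorem component_single (m : ℕ) (α β : boundedFeasible C) (c : I →₀ ℕ) (a : k) :
    component m (single k C α β (Ideal.Quotient.mk _ (MvPolynomial.monomial c a))) =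
      if 2 * c.degree + dist (α : SignVec I) β = m then
        single k C α β (Ideal.Quotient.mk _ (MvPolynomial.monomial c a)) else 0 := by
  have key : ∀ α' β' : boundedFeasible C,
      component m (single k C α β (Ideal.Quotient.mk _ (MvPolynomial.monomial c a))) α' β' =
      if dist (α' : SignVec I) β' ≤ m ∧ 2 ∣ m - dist (α' : SignVec I) β' then
        FaceRing.component _ ((m - dist (α' : SignVec I) β') / 2)
          (single k C α β (Ideal.Quotient.mk _ (MvPolynomial.monomial c a)) α' β') else 0 :=
    fun _ _ => rfl
  funext α' β'
  rw [key]
  by_cases hα : α' = α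
  swap
  · rw [single_of_ne_left hα, map_zero, ite_self]
    split_ifs
    · rw [single_of_ne_left hα]
    · rfl
  by_cases hβ : β' = β
  swap
  · rw [single_of_ne_right hβ, map_zero, ite_self]
    split_ifs
    · rw [single_of_ne_right hβ]
    · rfl
  subst hα hβ
  rw [single_same, FaceRing.component_monomial, ← ite_and]
  by_cases h : 2 * c.degree + dist (α' : SignVec I) β' = m
  · rw [if_pos h, if_pos ⟨⟨by omega, by omega⟩, by omega⟩, single_same]
  · rw [if_neg h, if_neg]
    · rfl
    · rintro ⟨⟨h1, h2⟩, h3⟩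
      omega

theorem component_of_mem {m : ℕ} {x : BTilde k C} (hx : x ∈ grade k C m) (n : ℕ) :
    component n x = if m = n then x else 0 := by
  -- `component` is known only to be additive, so the scalar is carried through the induction over
  -- the `k`-span.
  suffices h : ∀ a : k, component n (a • x) = if m = n then a • x else 0 by
    simpa only [one_smul] using h 1
  induction hx using Submodule.span_induction with
  | zero =>
    intro a
    rw [smul_zero, map_zero, ite_self]
  | add x y _ _ h1 h2 =>
    intro a
    rw [smul_add, map_add, h1, h2]
    split_ifs
    · rfl
    · rw [add_zero]
  | smul b x _ h =>
    intro a
    rw [← mul_smul, h]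
  | mem x hx =>
    intro a
    obtain ⟨α, β, c, hc, rfl⟩ := hx
    have : a • single k C α β (Ideal.Quotient.mk _ (MvPolynomial.monomial c 1)) =
        single k C α β (Ideal.Quotient.mk _ (MvPolynomial.monomial c a)) := by
      rw [single_mk, single_mk, ← smul_assoc, MvPolynomial.smul_monomial, smul_eq_mul, mul_one]
    rw [this, component_single, hc]

theorem nonempty_gradedAlgebra_grade : Nonempty (GradedAlgebra (grade k C)) := by
  refine nonempty_gradedAlgebra one_mem_grade (fun _ _ _ _ => mul_mem_grade) component ?_ ?_
    iSup_grade
  · intro m x hx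
    rw [component_of_mem hx, if_pos rfl]
  · intro m n x hmn hx
    rw [component_of_mem hx, if_neg hmn]

end BTilde

variable (hC : IsProgram C) (hgen : IsGeneric C)

theorem dist_of_differsAt {α β : SignVec I} {i : I} (h : DiffersAt i α β) : dist α β = 1 := by
  have : (Finset.univ.filter fun j => α j ≠ β j) = {i} := by
    ext j
    simp only [Finset.mem_filter, Finset.mem_univ, true_and, Finset.mem_singleton]
    exact h j
  rw [dist, this, Finset.card_singleton]

theorem toBTildePath_mem_grade {l : ℕ} {a b : feasible (dualProgram C)}
    {x : PathAlgebra k (quiverAdj (dualProgram C))} (hx : IsPathOfLength k l a b x) :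
    toBTildePath hC hgen x ∈ BTilde.grade k C l := by
  induction hx with
  | nil a =>
    rw [toBTildePath_idem, ← dist_self (a : SignVec I)]
    exact BTilde.unit_mem_grade _ _
  | @snoc l a b c x h _ ih =>
    rw [map_mul, toBTildePath_arrow]
    refine BTilde.mul_mem_grade ih ?_
    obtain ⟨i, hi⟩ := h
    rw [← dist_of_differsAt hi]
    exact BTilde.unit_mem_grade _ _

theorem toBTilde_mem_grade {m : ℕ} {x : ATilde k (dualProgram C)}
    (hx : x ∈ ATilde.grade k (dualProgram C) m) : toBTilde hC hgen x ∈ BTilde.grade k C m := by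
  induction hx using Submodule.span_induction with
  | zero => rw [map_zero]; exact zero_mem _
  | add x y _ _ h1 h2 => rw [map_add]; exact add_mem h1 h2
  | smul a x _ h =>
    rw [← algebraMap_smul (MvPolynomial I k) a x, map_smul, algebraMap_smul]
    exact Submodule.smul_mem _ a h
  | mem x hx =>
    obtain ⟨c, l, a, b, y, hy, hm, rfl⟩ := hx
    rw [toBTilde_mk]
    exact BTilde.monomial_smul_mem_grade (toBTildePath_mem_grade hC hgen hy) c hm

theorem ofBTilde_mem_grade {m : ℕ} {x : BTilde k C} (hx : x ∈ BTilde.grade k C m) :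
    ofBTilde hC hgen x ∈ ATilde.grade k (dualProgram C) m := by
  induction hx using Submodule.span_induction with
  | zero => rw [ofBTilde_zero]; exact zero_mem _
  | add x y _ _ h1 h2 => rw [ofBTilde_add]; exact add_mem h1 h2
  | smul a x _ h =>
    rw [← algebraMap_smul (MvPolynomial I k) a x, ofBTilde_smul, algebraMap_smul]
    exact Submodule.smul_mem _ a h
  | mem x hx =>
    obtain ⟨α, β, c, hm, rfl⟩ := hx
    obtain ⟨y, hy, hyt⟩ := ATilde.exists_path_taut (k := k) hC.isOrientedMatroid.dualProgram
      (hgen.isCubical_dual hC) (dualVertex hC hgen α) (dualVertex hC hgen β)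
    refine Submodule.subset_span ⟨c, _, _, _, y, hy, hm, ?_⟩
    rw [BTilde.single_mk, ofBTilde_smul, ofBTilde_single, ← hyt]
    refine (map_smul (ATilde.mk k (dualProgram C)) _ _).symm.trans ?_
    exact congrArg (ATilde.mk k (dualProgram C))
      ((TensorProduct.smul_tmul' _ _ _).trans (by rw [smul_eq_mul, mul_one]))

theorem equivBTilde_mem_grade_iff {m : ℕ} {x : ATilde k (dualProgram C)} :
    equivBTilde hC hgen x ∈ BTilde.grade k C m ↔ x ∈ ATilde.grade k (dualProgram C) m := by
  refine ⟨fun h => ?_, fun h => toBTilde_mem_grade hC hgen h⟩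
  have := ofBTilde_mem_grade hC hgen h
  rwa [equivBTilde_apply, ofBTilde_toBTilde] at this

theorem equivBTilde_e (a : feasible (dualProgram C)) :
    equivBTilde hC hgen (ATilde.e k (dualProgram C) a) = BTilde.unit k C a a := by
  rw [equivBTilde_apply, ← ATilde.ofPath_idem, toBTilde_ofPath, toBTildePath_idem]

theorem equivBTilde_p {a b : feasible (dualProgram C)} (h : quiverAdj (dualProgram C) a b) :
    equivBTilde hC hgen (ATilde.p k (dualProgram C) a b h) = BTilde.unit k C a b := by
  rw [equivBTilde_apply, ← ATilde.ofPath_arrow, toBTilde_ofPath, toBTildePath_arrow]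

/-- Only a semiring structure is assumed on `A'`, so that the grading refers to the structure
already present; negation comes from `k`. -/
theorem nonempty_gradedAlgebra_of_equiv {R A A' : Type*} [CommRing R] [Ring A] [Algebra k A]
    [Algebra R A] [Semiring A'] [Algebra k A'] [Algebra R A'] {𝒜 : ℕ → Submodule k A}
    (h𝒜 : Nonempty (GradedAlgebra 𝒜)) {𝒜' : ℕ → Submodule k A'} (e : A' ≃ₐ[R] A)
    (h : ∀ m y, y ∈ 𝒜' m ↔ e y ∈ 𝒜 m) : Nonempty (GradedAlgebra 𝒜') := by
  obtain ⟨_⟩ := h𝒜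
  let : Ring A' := Algebra.semiringToRing k
  refine nonempty_gradedAlgebra_of_surjective 𝒜 (e.symm : A →+* A') e.symm.surjective ?_ ?_
  · intro m y
    rw [h]
    refine ⟨fun hy => ⟨e y, hy, e.symm_apply_apply y⟩, ?_⟩
    rintro ⟨x, hx, rfl⟩
    change e (e.symm x) ∈ _
    rwa [e.apply_symm_apply]
  · intro x hx m
    have : x = 0 := e.symm.injective (hx.trans (map_zero _).symm)
    rw [this, map_zero, map_zero]

include hC hgen in
theorem nonempty_gradedAlgebra_grade_dualProgram :
    Nonempty (GradedAlgebra (ATilde.grade k (dualProgram C))) :=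
  nonempty_gradedAlgebra_of_equiv (𝒜 := BTilde.grade k C) BTilde.nonempty_gradedAlgebra_grade
    (equivBTilde hC hgen) fun _ _ => (equivBTilde_mem_grade_iff hC hgen).symm

end Grading

/-! ### Base change to a parameter space. -/

section Quotient

/-- Identifies the kernel of base change to `R ⧸ J`, through the isomorphism of the tensor product
with the quotient of `A` by `J • ⊤`. -/
theorem includeRight_eq_zero {R A : Type*} [CommRing R] [Ring A] [Algebra R A] {J : Ideal R}
    {x : A} : (Algebra.TensorProduct.includeRight : A →ₐ[R] (R ⧸ J) ⊗[R] A) x = 0 ↔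
      x ∈ J • (⊤ : Submodule R A) := by
  rw [← (TensorProduct.quotTensorEquivQuotSMul A J).map_eq_zero_iff,
    Algebra.TensorProduct.includeRight_apply, TensorProduct.quotTensorEquivQuotSMul_mk_one_tmul,
    Submodule.Quotient.mk_eq_zero]

variable {I : Type*} [Fintype I] {k : Type*} [Field k] {C : Set (SignVec (Ext I))}

theorem BTilde.linear_smul_mem_grade (u : I → k) {m : ℕ} {x : BTilde k C}
    (hx : x ∈ grade k C m) :
    (∑ i, MvPolynomial.C (u i) * MvPolynomial.X i : MvPolynomial I k) • x ∈ grade k C (m + 2) := by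
  rw [Finset.sum_smul]
  refine sum_mem fun i _ => ?_
  rw [mul_smul, ← smul_eq_C_smul]
  refine Submodule.smul_mem _ _ ?_
  exact monomial_smul_mem_grade hx (Finsupp.single i 1) (by rw [Finsupp.degree_single]; omega)

/-- Multiplication by a linear form shifts degrees by exactly two, so the submodule generated by
linear forms is homogeneous and the grading descends to B. -/
theorem BTilde.proj_mem_linearIdeal_smul [GradedAlgebra (BTilde.grade k C)]
    (U : Submodule k (I → k)) {x : BTilde k C}
    (hx : x ∈ linearIdeal U • (⊤ : Submodule (MvPolynomial I k) (BTilde k C))) (m : ℕ) :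
    GradedAlgebra.proj (BTilde.grade k C) m x ∈
      linearIdeal U • (⊤ : Submodule (MvPolynomial I k) (BTilde k C)) := by
  induction hx using Submodule.smul_induction_on' with
  | add x _ y _ hx hy => rw [map_add]; exact add_mem hx hy
  | smul q hq y _ =>
    -- The module element varies, so that polynomial coefficients of the generators can be absorbed
    -- into it.
    induction hq using Submodule.span_induction generalizing y with
    | zero => rw [zero_smul, map_zero]; exact zero_mem _
    | add p q _ _ hp hq => rw [add_smul, map_add]; exact add_mem (hp y trivial) (hq y trivial)
    | smul r q _ h =>
      rw [smul_eq_mul, mul_comm, mul_smul]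
      exact h _ trivial
    | mem q hq =>
      have hq' : q ∈ linearIdeal U := Ideal.subset_span hq
      obtain ⟨u, hu, rfl⟩ := hq
      induction y using DirectSum.Decomposition.inductionOn (BTilde.grade k C) with
      | zero => rw [smul_zero, map_zero]; exact zero_mem _
      | add x y hx hy =>
        rw [smul_add, map_add]
        exact add_mem (hx trivial) (hy trivial)
      | @homogeneous j y =>
        have := BTilde.linear_smul_mem_grade u y.2
        rw [GradedAlgebra.proj_apply]
        by_cases h : j + 2 = m
        · rw [← h, DirectSum.decompose_of_mem_same _ this]
          exact Submodule.smul_mem_smul hq' trivial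
        · rw [DirectSum.decompose_of_mem_ne _ this h]
          exact zero_mem _

theorem BAlg.mk_surjective (U : Submodule k (I → k)) : Function.Surjective (BAlg.mk C U) :=
  Algebra.TensorProduct.includeRight_surjective _ Ideal.Quotient.mk_surjective

theorem BAlg.mk_eq_zero {U : Submodule k (I → k)} {x : BTilde k C} : BAlg.mk C U x = 0 ↔
    x ∈ linearIdeal U • (⊤ : Submodule (MvPolynomial I k) (BTilde k C)) :=
  includeRight_eq_zero

instance (U : Submodule k (I → k)) : IsScalarTower k (MvPolynomial I k) (BAlg C U) :=
  inferInstanceAs (IsScalarTower k (MvPolynomial I k)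
    ((MvPolynomial I k ⧸ linearIdeal U) ⊗[MvPolynomial I k] BTilde k C))

instance (U : Submodule k (I → k)) : IsScalarTower k (MvPolynomial I k) (AAlg C U) :=
  inferInstanceAs (IsScalarTower k (MvPolynomial I k)
    ((MvPolynomial I k ⧸ linearIdeal (orthCompl U)) ⊗[MvPolynomial I k] ATilde k C))

/-- The image of a subspace under a `k`-linear map is already a subspace, so the span in the
definition adds nothing. -/
theorem BAlg.mem_grade_iff {U : Submodule k (I → k)} {m : ℕ} {y : BAlg C U} :
    y ∈ BAlg.grade C U m ↔ ∃ x ∈ BTilde.grade k C m, BAlg.mk C U x = y := by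
  unfold BAlg.grade
  rw [show (BAlg.mk C U '' (BTilde.grade k C m : Set (BTilde k C))) =
    ((BTilde.grade k C m).map ((BAlg.mk C U).toLinearMap.restrictScalars k) : Set (BAlg C U)) from
      rfl, Submodule.span_eq]
  rfl

theorem AAlg.mem_grade_iff {U : Submodule k (I → k)} {m : ℕ} {y : AAlg C U} :
    y ∈ AAlg.grade C U m ↔ ∃ x ∈ ATilde.grade k C m, AAlg.mk C U x = y := by
  unfold AAlg.grade
  rw [show (AAlg.mk C U '' (ATilde.grade k C m : Set (ATilde k C))) =
    ((ATilde.grade k C m).map ((AAlg.mk C U).toLinearMap.restrictScalars k) : Set (AAlg C U)) from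
      rfl, Submodule.span_eq]
  rfl

theorem BAlg.nonempty_gradedAlgebra_grade (U : Submodule k (I → k)) :
    Nonempty (GradedAlgebra (BAlg.grade C U)) := by
  obtain ⟨_⟩ := BTilde.nonempty_gradedAlgebra_grade (k := k) (C := C)
  refine nonempty_gradedAlgebra_of_surjective (BTilde.grade k C) (BAlg.mk C U : _ →+* _)
    (BAlg.mk_surjective U) (fun m y => BAlg.mem_grade_iff) fun x hx m => ?_
  exact BAlg.mk_eq_zero.2 (BTilde.proj_mem_linearIdeal_smul U (BAlg.mk_eq_zero.1 hx) m)

/-- The dot product is symmetric and nondegenerate on a finite-dimensional space. It identifies the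
linear forms imposed on the algebra of the dual program at U^⊥ with those imposed on B̃ at U. -/
theorem orthCompl_orthCompl (U : Submodule k (I → k)) : orthCompl (orthCompl U) = U := by
  have hB : ∀ W : Submodule k (I → k),
      orthCompl W = LinearMap.BilinForm.orthogonal (dotProductBilin k k) W := by
    intro W
    ext x
    rw [LinearMap.BilinForm.mem_orthogonal_iff]
    refine forall₂_congr fun u _ => ?_
    change dotProduct x u = 0 ↔ dotProduct u x = 0
    rw [dotProduct_comm]
  have hrefl : (dotProductBilin k k : (I → k) →ₗ[k] (I → k) →ₗ[k] k).IsRefl := by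
    intro x y h
    change dotProduct y x = 0
    rw [dotProduct_comm]
    exact h
  rw [hB, hB]
  refine LinearMap.BilinForm.orthogonal_orthogonal ?_ hrefl U
  refine hrefl.nondegenerate_iff_separatingLeft.2 fun x hx => ?_
  exact dotProduct_eq_zero_iff.1 hx

/-- The isomorphism from `A` of the dual program to `B`. -/
def equivBAlg (hC : IsProgram C) (hgen : IsGeneric C) (U : Submodule k (I → k)) :
    AAlg (dualProgram C) (orthCompl U) ≃ₐ[MvPolynomial I k] BAlg C U :=
  (Algebra.TensorProduct.congr (Ideal.quotientEquivAlgOfEq (MvPolynomial I k)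
      (by rw [orthCompl_orthCompl])) (equivBTilde hC hgen) :
    ((MvPolynomial I k ⧸ linearIdeal (orthCompl (orthCompl U))) ⊗[MvPolynomial I k]
      ATilde k (dualProgram C)) ≃ₐ[MvPolynomial I k]
        ((MvPolynomial I k ⧸ linearIdeal U) ⊗[MvPolynomial I k] BTilde k C))

theorem equivBAlg_mk (hC : IsProgram C) (hgen : IsGeneric C) (U : Submodule k (I → k))
    (x : ATilde k (dualProgram C)) : equivBAlg hC hgen U (AAlg.mk (dualProgram C) (orthCompl U) x) =
      BAlg.mk C U (equivBTilde hC hgen x) := by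
  refine (Algebra.TensorProduct.map_tmul _ _ _ _).trans ?_
  rw [AlgEquiv.coe_toAlgHom, map_one]
  rfl

theorem equivBAlg_mem_grade_iff (hC : IsProgram C) (hgen : IsGeneric C) (U : Submodule k (I → k))
    {m : ℕ} {y : AAlg (dualProgram C) (orthCompl U)} :
    equivBAlg hC hgen U y ∈ BAlg.grade C U m ↔
      y ∈ AAlg.grade (dualProgram C) (orthCompl U) m := by
  rw [BAlg.mem_grade_iff, AAlg.mem_grade_iff]
  constructor
  · rintro ⟨x, hx, hxy⟩
    refine ⟨(equivBTilde hC hgen).symm x, ?_, (equivBAlg hC hgen U).injective ?_⟩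
    · rwa [← equivBTilde_mem_grade_iff hC hgen, AlgEquiv.apply_symm_apply]
    · rw [equivBAlg_mk, AlgEquiv.apply_symm_apply, hxy]
  · rintro ⟨x, hx, rfl⟩
    exact ⟨_, (equivBTilde_mem_grade_iff hC hgen).2 hx, (equivBAlg_mk hC hgen U x).symm⟩

theorem AAlg.nonempty_gradedAlgebra_grade_dualProgram (hC : IsProgram C) (hgen : IsGeneric C)
    (U : Submodule k (I → k)) :
    Nonempty (GradedAlgebra (AAlg.grade (dualProgram C) (orthCompl U))) :=
  nonempty_gradedAlgebra_of_equiv (𝒜 := BAlg.grade C U) (BAlg.nonempty_gradedAlgebra_grade U)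
    (equivBAlg hC hgen U) fun _ _ => (equivBAlg_mem_grade_iff hC hgen U).symm

end Quotient

end OM
-- The main theorem.
theorem theorem5 {I : Type*} [Fintype I] {k : Type*} [Field k]
    (C : Set (SignVec (OM.Ext I))) (hC : OM.IsProgram C) (hgen : OM.IsGeneric C) :
    OM.boundedFeasible (OM.dualProgram C) = OM.boundedFeasible C ∧
    Nonempty (GradedAlgebra (OM.ATilde.grade k (OM.dualProgram C))) ∧
    Nonempty (GradedAlgebra (OM.BTilde.grade k C)) ∧
    ∃ φ : OM.ATilde k (OM.dualProgram C) ≃ₐ[MvPolynomial I k] OM.BTilde k C,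
      (∀ (a : OM.feasible (OM.dualProgram C)) (ha : (a : SignVec I) ∈ OM.boundedFeasible C),
        φ (OM.ATilde.e k (OM.dualProgram C) a) = OM.BTilde.single k C ⟨a, ha⟩ ⟨a, ha⟩ 1) ∧
      (∀ (a b : OM.feasible (OM.dualProgram C)) (h : OM.quiverAdj (OM.dualProgram C) a b)
        (ha : (a : SignVec I) ∈ OM.boundedFeasible C)
        (hb : (b : SignVec I) ∈ OM.boundedFeasible C),
        φ (OM.ATilde.p k (OM.dualProgram C) a b h) =
          OM.BTilde.single k C ⟨a, ha⟩ ⟨b, hb⟩ 1) ∧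
      (∀ m x, x ∈ OM.ATilde.grade k (OM.dualProgram C) m ↔ φ x ∈ OM.BTilde.grade k C m) ∧
      ∀ U : Submodule k (I → k), OM.IsParameterSpace (OM.core C) U →
        Nonempty (GradedAlgebra (OM.AAlg.grade (OM.dualProgram C) (OM.orthCompl U))) ∧
        Nonempty (GradedAlgebra (OM.BAlg.grade C U)) ∧
        ∃ ψ : OM.AAlg (OM.dualProgram C) (OM.orthCompl U) ≃ₐ[MvPolynomial I k] OM.BAlg C U,
          (∀ x, ψ (OM.AAlg.mk (OM.dualProgram C) (OM.orthCompl U) x) =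
            OM.BAlg.mk C U (φ x)) ∧
          ∀ m y, y ∈ OM.AAlg.grade (OM.dualProgram C) (OM.orthCompl U) m ↔
            ψ y ∈ OM.BAlg.grade C U m := by
  refine ⟨OM.boundedFeasible_dualProgram hC hgen,
    OM.nonempty_gradedAlgebra_grade_dualProgram hC hgen, OM.BTilde.nonempty_gradedAlgebra_grade,
    OM.equivBTilde hC hgen, ?_, ?_, ?_, ?_⟩
  · intro a ha
    rw [OM.equivBTilde_e, OM.BTilde.unit_of_mem ha ha]
  · intro a b h ha hb
    rw [OM.equivBTilde_p, OM.BTilde.unit_of_mem ha hb]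
  · intro m x
    exact (OM.equivBTilde_mem_grade_iff hC hgen).symm
  · intro U _
    refine ⟨OM.AAlg.nonempty_gradedAlgebra_grade_dualProgram hC hgen U,
      OM.BAlg.nonempty_gradedAlgebra_grade U, OM.equivBAlg hC hgen U,
      OM.equivBAlg_mk hC hgen U, ?_⟩
    intro m y
    exact (OM.equivBAlg_mem_grade_iff hC hgen U).symm
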